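/- **Setting.** Let $H$ and $G$ be (real or complex) Hilbert spaces, $|\cdot|$ and $\langle\cdot,\cdot\rangle$ the norm and scalar product of $H$, and $n\ge 2$ an integer. Let $A:D(A)\subset H\to H$ satisfy $(A1)$: $A$ is self-adjoint and positive, $|Au|\ge\omega|u|$ for all $u\in D(A)$ and some $\omega>0$, and $A$ has a compact resolvent. For $k\in\mathbb N$ let $H_k=D(A^{k/2})$ with norm $|A^{k/2}\cdot|$ ($H_0=H$, $H_2=D(A)$), and for $k\in\mathbb Z$ let $e_k(w,w')=\tfrac12\big(|A^{k/2}w|^2+|A^{(k-1)/2}w'|^2\big)$. For $f\in L^2([0,T];H)$, solutions of $w''+Aw=f$ on $[0,T]$ are finite energy (mild) solutions, $w\in C([0,T];H_1)\cap C^1([0,T];H)$. Let $C_{i\,i-1}$, $2\le i\le n$, be bounded linear operators on $H$, and consider the bi-diagonal cascade system, with initial data in $H_1^n\times H^n$, $$u_1''+Au_1=0,\qquad u_i''+Au_i+C_{i\,i-1}u_{i-1}=0\quad(2\le i\le n).$$ $(A2)_n$ with $\Pi_i=C_{i\,i-1}$: for every $i\in\{2,\dots,n\}$, $C_{i\,i-1}^*\in\mathcal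 L(H_k)$ for $0\le k\le n-i+1$; $|C_{i\,i-1}w|^2\le\|C_{i\,i-1}\|\,\mathrm{Re}\,\langle C_{i\,i-1}w,w\rangle$ for all $w\in H$; and there is $\alpha_i>0$ with $\alpha_i|C_{i\,i-1}w|^2\le\mathrm{Re}\,\langle C_{i\,i-1}w,w\rangle$ for all $w\in H$. $(A4)_n$: $\mathbf B_n^*\in\mathcal L(H_2\times H;G)$, and for every $T>0$ there is $D>0$ such that, for all $f\in L^2([0,T];H)$ and all solutions $w\in C([0,T];H_2)$ of $w''+Aw=f$, $$\int_0^T\|\mathbf B_n^*(w,w')\|_G^2\,dt\le D\Big(e_1(w,w')(0)+e_1(w,w')(T)+\int_0^Te_1(w,w')\,dt+\int_0^T|f|^2\,dt\Big).$$ Under $(A4)_n$, $\mathbf B_n^*(w,w')\in L^2([0,T];G)$ is defined for every solution $w$ of $w''+Aw=f$, by continuous extension with respect to $\big((w,w')(0),f\big)\in(H_1\times H)\times L^2([0,T];H)$; this is its meaning below. For $T>0$ consider the following properties. - $\mathrm{Obs}_i(T)$, $2\le i\le n$: there is $\gamma>0$ with $\int_0^T|C_{i\,i-1}w'|^2dt\ge\gamma\,e_1(w,w')(0)$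 for all solutions of $w''+Aw=0$. - $\mathrm{Obs}_{\mathbf B}(T)$: there is $R>0$ with $\int_0^T\|\mathbf B_n^*(w,w')\|_G^2dt\ge R\,e_1(w,w')(0)$ for all solutions of $w''+Aw=0$. - $\mathrm{Obs}(T)$: there is $c>0$ such that every solution of the cascade system satisfies $$c\sum_{i=1}^n e_{1+i-n}(u_i,u_i')(0)\le\int_0^T\|\mathbf B_n^*(u_n,u_n')\|_G^2\,dt.$$ We say that $(OBS)_n$ holds if there is $T_n^*>0$ such that $\mathrm{Obs}(T)$ holds for all $T>T_n^*$; that $(A3)_n$ holds if for every $i\in\{2,\dots,n\}$ there is $T_{0,i}>0$ such that $\mathrm{Obs}_i(T)$ holds for all $T>T_{0,i}$; and that $(A5)_n$ holds if there is $T_0>0$ such that $\mathrm{Obs}_{\mathbf B}(T)$ holds for all $T>T_0$. The minimal time of a property of $T>0$ is the number $T_m\ge0$ such that the property holds for all $T>T_m$ and fails for all $0<T<T_m$. **Corollary.** Assume $(A1)$, $(A4)_n$ and $(A2)_n$ with $\Pi_i=C_{i\,i-1}$ for all $i\in\{2,\dots,n\}$. Then $(OBS)_n$ holds if and only if $(A3)_n$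 and $(A5)_n$ hold. Moreover, if $T_n^*>0$ is such that $\mathrm{Obs}(T)$ holds for all $T>T_n^*$, then the minimal times $T_{i,c}$ of $\mathrm{Obs}_i$ ($2\le i\le n$) and $T_{0,n}$ of $\mathrm{Obs}_{\mathbf B}$ exist, and $$T_n^*\ge\max\Big(\max_{2\le i\le n}T_{i,c},\;T_{0,n}\Big).$$ -/

import Mathlib

noncomputable section

namespace Cascade

open MeasureTheory Filter Topology Set
open scoped ENNReal NNReal InnerProductSpace

section Operator

variable {𝕜 : Type*} [RCLike 𝕜]
variable {H : Type*} [NormedAddCommGroup H] [InnerProductSpace 𝕜 H] [CompleteSpace H]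

/-- `A` has a compact resolvent: for some scalar `z`, the operator `A - z` is a bijection from the
domain of `A` onto `H` whose inverse `R` is a compact operator of `H`. -/
def HasCompactResolvent (A : H →ₗ.[𝕜] H) : Prop :=
  ∃ (z : 𝕜) (R : H →L[𝕜] H), IsCompactOperator R ∧
    (∀ x : H, ∃ u : A.domain, (u : H) = R x ∧ A u - z • (u : H) = x) ∧
    (∀ u : A.domain, R (A u - z • (u : H)) = u)

/-- Standing assumption on the unbounded operator `A`: it is self-adjoint (in particular densely
defined), positive (so that its powers make sense), bounded below, and has a compact resolvent. -/
structure StandingAssumption (A : H →ₗ.[𝕜] H) : Prop where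
  selfAdjoint : IsSelfAdjoint A
  nonneg : ∀ u : A.domain, 0 ≤ RCLike.re (inner 𝕜 (A u) (u : H))
  bounded_below : ∃ ω : ℝ, 0 < ω ∧ ∀ u : A.domain, ω * ‖(u : H)‖ ≤ ‖A u‖
  compactResolvent : HasCompactResolvent A

/-- The eigenspace `{u ∈ D(A) | A u = μ u}`. -/
def eigenspace (A : H →ₗ.[𝕜] H) (μ : ℝ) : Submodule 𝕜 H :=
  (LinearMap.ker (A.toFun - (μ : 𝕜) • A.domain.subtype)).map A.domain.subtype

/-- Orthogonal projection onto the eigenspace for `μ`. (The eigenspaces of a self-adjoint operator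
are closed, so taking the closure changes nothing.) -/
def eigenproj (A : H →ₗ.[𝕜] H) (μ : ℝ) : H →L[𝕜] H :=
  (eigenspace A μ).topologicalClosure.starProjection

/-- `|A^{k/2} u|² = ∑_μ μ^k |P_μ u|²` for `k ∈ ℤ`, the sum running over the eigenvalues `μ` of `A`
(`P_μ = 0` for the other real numbers `μ`), with values in `[0, ∞]`. It is finite for every `u ∈ H`
if `k ≤ 0`, and finite exactly on `D(A^{k/2})` if `k ≥ 0`. -/
def powNormSq (A : H →ₗ.[𝕜] H) (k : ℤ) (u : H) : ℝ≥0∞ :=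
  ∑' μ : ℝ, ENNReal.ofReal (μ ^ k * ‖eigenproj A μ u‖ ^ 2)

/-- Membership in the space `H_k = D(A^{k/2})`, for `k ∈ ℕ`. -/
def MemPow (A : H →ₗ.[𝕜] H) (k : ℕ) (u : H) : Prop := powNormSq A k u ≠ ∞

/-- The energy of level `k`: `e_k(w, w') = (|A^{k/2} w|² + |A^{(k-1)/2} w'|²) / 2`. -/
def energy (A : H →ₗ.[𝕜] H) (k : ℤ) (w w' : H) : ℝ≥0∞ :=
  (powNormSq A k w + powNormSq A (k - 1) w') / 2

/-- `f` represents an element of `L²([0,T]; E)`. -/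
def IsL2 {E : Type*} [NormedAddCommGroup E] (T : ℝ) (f : ℝ → E) : Prop :=
  MemLp f 2 (volume.restrict (Icc 0 T))

variable [NormedSpace ℝ H]

/-- `w` is the finite energy (weak, equivalently mild) solution on `[0,T]` of `w'' + A w = f`, with
derivative `v = w'`: `w ∈ C([0,T]; H_1)`, `v ∈ C([0,T]; H)`, `v` is the derivative of `w`, and the
equation holds when tested against the elements of `D(A)` and integrated in time.
The initial data are `(w 0, v 0) ∈ H_1 × H`. -/
structure IsSolution (A : H →ₗ.[𝕜] H) (T : ℝ) (f w v : ℝ → H) : Prop where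
  mem : ∀ t ∈ Icc 0 T, MemPow A 1 (w t)
  cont : ∀ s ∈ Icc 0 T,
    Tendsto (fun t => powNormSq A 1 (w t - w s)) (𝓝[Icc 0 T] s) (𝓝 0)
  cont_deriv : ContinuousOn v (Icc 0 T)
  deriv : ∀ t ∈ Icc 0 T, HasDerivWithinAt w (v t) (Icc 0 T) t
  weak : ∀ φ : A.domain, ∀ t ∈ Icc 0 T,
    inner 𝕜 (φ : H) (v t) = inner 𝕜 (φ : H) (v 0) +
      ∫ s in (0 : ℝ)..t, (inner 𝕜 (φ : H) (f s) - inner 𝕜 (A φ) (w s))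

/-- `w ∈ C([0,T]; H_2)`, where `H_2 = D(A)` carries the norm `|A u|`. -/
def IsRegular (A : H →ₗ.[𝕜] H) (T : ℝ) (w : ℝ → H) : Prop :=
  ∃ g : ℝ → H, ContinuousOn g (Icc 0 T) ∧ ∀ t ∈ Icc 0 T, (w t, g t) ∈ A.graph

/-- The source term `f` of the `i`-th equation `u_i'' + A u_i = f` of the cascade system: `0` for
`i = 1`, and `- C_i u_{i-1}` for `i ≥ 2`. Components are indexed by `1, …, n`, and `C i` is the
operator coupling component `i` to component `i - 1`. -/
def source (C : ℕ → H →L[𝕜] H) (u : ℕ → ℝ → H) (i : ℕ) : ℝ → H :=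
  fun t => if i = 1 then 0 else - C i (u (i - 1) t)

/-- `(u_1, …, u_n)`, with derivatives `(v_1, …, v_n)`, is the finite energy solution on `[0,T]` of the
bi-diagonal cascade system `u_1'' + A u_1 = 0`, `u_i'' + A u_i + C_i u_{i-1} = 0` for `2 ≤ i ≤ n`. -/
def IsCascadeSolution (A : H →ₗ.[𝕜] H) (n : ℕ) (C : ℕ → H →L[𝕜] H) (T : ℝ)
    (u v : ℕ → ℝ → H) : Prop :=
  ∀ i ∈ Finset.Icc 1 n, IsSolution A T (source C u i) (u i) (v i)

/-- Assumption on the coupling operators `C i`, `2 ≤ i ≤ n`, with respect to operators `Pr i`: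
the adjoint of `C i` is bounded on `H_k` for `0 ≤ k ≤ n - i + 1`, and, with `β_i = ‖C i‖`,
`|C_i w|² ≤ β_i ⟨C_i w, w⟩` and `α_i |Pr_i w|² ≤ ⟨C_i w, w⟩` for some `α_i > 0`. -/
def CouplingAssumption (A : H →ₗ.[𝕜] H) (n : ℕ) (C Pr : ℕ → H →L[𝕜] H) : Prop :=
  ∀ i ∈ Finset.Icc 2 n,
    (∀ k : ℕ, k ≤ n - i + 1 → ∃ c : ℝ≥0, ∀ u : H, MemPow A k u →
      powNormSq A k (ContinuousLinearMap.adjoint (C i) u) ≤ c * powNormSq A k u) ∧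
    (∀ w : H, ‖C i w‖ ^ 2 ≤ ‖C i‖ * RCLike.re (inner 𝕜 (C i w) w)) ∧
    ∃ α : ℝ, 0 < α ∧ ∀ w : H, α * ‖Pr i w‖ ^ 2 ≤ RCLike.re (inner 𝕜 (C i w) w)

/-- Observability in time `T` of `w'' + A w = 0` through `Pr w'`. -/
def VelocityObservableAt (A : H →ₗ.[𝕜] H) (Pr : H →L[𝕜] H) (T : ℝ) : Prop :=
  ∃ γ : ℝ≥0, 0 < γ ∧ ∀ w v : ℝ → H, IsSolution A T (fun _ => 0) w v →
    γ * energy A 1 (w 0) (v 0) ≤ ∫⁻ t in Icc 0 T, ‖Pr (v t)‖ₑ ^ 2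

/-- Each operator `Pr i`, `2 ≤ i ≤ n`, observes `w'' + A w = 0` in all sufficiently large times. -/
def CouplingsObservable (A : H →ₗ.[𝕜] H) (n : ℕ) (Pr : ℕ → H →L[𝕜] H) : Prop :=
  ∀ i ∈ Finset.Icc 2 n, ∃ T₀ : ℝ, 0 < T₀ ∧ ∀ T : ℝ, T₀ < T → VelocityObservableAt A (Pr i) T

variable {G : Type*} [NormedAddCommGroup G] [InnerProductSpace 𝕜 G] [CompleteSpace G]

open Classical in
/-- The value `B (w, w')` of the observation operator `B`, defined on `H_2 × H = D(A) × H`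
(and `0` where `w` is not in `D(A)`; it is used only on trajectories with `w ∈ C([0,T]; H_2)`). -/
def observe (A : H →ₗ.[𝕜] H) (B : (A.domain × H) →ₗ[𝕜] G) (w w' : H) : G :=
  if h : w ∈ A.domain then B (⟨w, h⟩, w') else 0

/-- `B` is an admissible observation operator: it is bounded from `H_2 × H` to `G`, and for every
`T > 0` the direct inequality holds with a constant `D = D(T)`, for all solutions of `w'' + A w = f`,
`f ∈ L²([0,T]; H)`, for which `B (w, w')` is defined, that is, those in `C([0,T]; H_2)`. -/
def Admissible (A : H →ₗ.[𝕜] H) (B : (A.domain × H) →ₗ[𝕜] G) : Prop :=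
  (∃ c : ℝ, ∀ (u : A.domain) (v : H), ‖B (u, v)‖ ≤ c * (‖A u‖ + ‖v‖)) ∧
  ∀ T : ℝ, 0 < T → ∃ D : ℝ≥0, 0 < D ∧ ∀ f w v : ℝ → H,
    IsL2 T f → IsSolution A T f w v → IsRegular A T w →
    ∫⁻ t in Icc 0 T, ‖observe A B (w t) (v t)‖ₑ ^ 2 ≤
      D * (energy A 1 (w 0) (v 0) + energy A 1 (w T) (v T) +
        (∫⁻ t in Icc 0 T, energy A 1 (w t) (v t)) + ∫⁻ t in Icc 0 T, ‖f t‖ₑ ^ 2)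

/-- `y ∈ L²([0,T]; G)` is the observation `B (w, w')` of the finite energy solution `w` of
`w'' + A w = f`, with `w' = v`: it is the limit in `L²([0,T]; G)` of the observations of solutions
`w_m ∈ C([0,T]; H_2)` of `w_m'' + A w_m = f_m` whose initial data and sources converge to those of
`w` in `H_1 × H` and `L²([0,T]; H)`. For an admissible `B` there is exactly one such `y` (up to null
sets), and it is `t ↦ B (w t, v t)` if `w ∈ C([0,T]; H_2)`. -/
def IsObservation (A : H →ₗ.[𝕜] H) (B : (A.domain × H) →ₗ[𝕜] G) (T : ℝ) (f w v : ℝ → H)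
    (y : ℝ → G) : Prop :=
  IsL2 T y ∧ ∃ fm wm vm : ℕ → ℝ → H,
    (∀ m, IsL2 T (fm m) ∧ IsSolution A T (fm m) (wm m) (vm m) ∧ IsRegular A T (wm m)) ∧
    Tendsto (fun m => powNormSq A 1 (wm m 0 - w 0)) atTop (𝓝 0) ∧
    Tendsto (fun m => vm m 0) atTop (𝓝 (v 0)) ∧
    Tendsto (fun m => eLpNorm (fm m - f) 2 (volume.restrict (Icc 0 T))) atTop (𝓝 0) ∧
    Tendsto (fun m => eLpNorm (fun t => observe A B (wm m t) (vm m t) - y t) 2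
      (volume.restrict (Icc 0 T))) atTop (𝓝 0)

/-- Observability in time `T` of the single equation `w'' + A w = 0` through `B (w, w')`. -/
def ObservableAt (A : H →ₗ.[𝕜] H) (B : (A.domain × H) →ₗ[𝕜] G) (T : ℝ) : Prop :=
  ∃ R : ℝ≥0, 0 < R ∧ ∀ w v : ℝ → H, IsSolution A T (fun _ => 0) w v →
    ∃ y : ℝ → G, IsObservation A B T (fun _ => 0) w v y ∧
      R * energy A 1 (w 0) (v 0) ≤ ∫⁻ t in Icc 0 T, ‖y t‖ₑ ^ 2

/-- `w'' + A w = 0` is observable through `B (w, w')` in all sufficiently large times. -/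
def Observable (A : H →ₗ.[𝕜] H) (B : (A.domain × H) →ₗ[𝕜] G) : Prop :=
  ∃ T₀ : ℝ, 0 < T₀ ∧ ∀ T : ℝ, T₀ < T → ObservableAt A B T

/-- Observability in time `T` of the cascade system through `B (u_n, u_n')`, in the weakened
energies `e_{1+i-n}(u_i, u_i')`. -/
def CascadeObservableAt (A : H →ₗ.[𝕜] H) (n : ℕ) (C : ℕ → H →L[𝕜] H)
    (B : (A.domain × H) →ₗ[𝕜] G) (T : ℝ) : Prop :=
  ∃ c : ℝ≥0, 0 < c ∧ ∀ u v : ℕ → ℝ → H, IsCascadeSolution A n C T u v →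
    ∃ y : ℝ → G, IsObservation A B T (source C u n) (u n) (v n) y ∧
      c * ∑ i ∈ Finset.Icc 1 n, energy A (1 + (i : ℤ) - (n : ℤ)) (u i 0) (v i 0) ≤
        ∫⁻ t in Icc 0 T, ‖y t‖ₑ ^ 2

end Operator

/-- `Tm` is the minimal time for the property `P`: it holds for all `T > Tm` and fails for all
positive `T < Tm`. There is at most one such `Tm ≥ 0`. -/
def IsMinimalTime (P : ℝ → Prop) (Tm : ℝ) : Prop :=
  0 ≤ Tm ∧ (∀ T : ℝ, Tm < T → P T) ∧ ∀ T : ℝ, 0 < T → T < Tm → ¬ P T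

end Cascade

end

/-! Compactness of the resolvent gives an orthonormal basis of eigenvectors of A, in which the
equation w'' + Aw = f is a family of forced harmonic oscillators. In the variables X = (A^{1/2} w,
w') it becomes a mild equation for a group of isometries `rot` of H × H. The norm of a state
therefore changes only through the source, and the scalar product of two solutions changes only
through their two sources (`IsMild.inner_sub_inner`).

The second tool is integration in time. A primitive w of a solution u, with velocity v, satisfies Aw
= g - v for its own source g, so it equals -A^{-1}(v - g). Hence cascades integrate to cascades
(`IsCascadeSolution.primitive`), and energies of negative order are energies of order one of
iterated primitives, up to coupling terms that the bounds on the adjoints C_i^* control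
(`exists_energy_le`).

Sufficiency. Let X be the state of a primitive of u_{i-1}, and Y the state of u_i. The source of Y
is -C_i applied to the velocity of X. Differentiating ⟨X, Y⟩ and using coercivity bounds the
integral of |C_i u_{i-1}|² over [0, T] by a constant times sup‖X‖ sup‖Y‖, if the source of X is
O(sup‖X‖/T). Conversely, observability through C_i on windows of a fixed length, summed over the
windows, bounds the same integral from below by cT sup‖X‖² (`exists_le_lintegral_of_windows`). Thus
sup‖X‖ = O(sup‖Y‖/T) (`exists_norm_le_of_coupled`). This makes the source of u_i of size O(1/T) in
turn, so the argument climbs the cascade (`exists_source_le`). Component l, integrated n - l times,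
is then bounded by component n (`exists_iter_le`), and component n, whose source is O(1/T), is
recovered from the observation by the same summation over windows (`exists_cascadeObservableAt`).

Necessity, in the same time T. For B, take a cascade with only the last component nonzero
(`observableAt_of_cascade`). For C_i, start the cascade at component j = i - 1 with a free solution,
and choose the initial states of the later components so that the (n-l)-th primitive of each
component l > j starts almost from zero. These primitives are driven, step by step, by C_i applied
to the velocity of a free solution with initial state z, the (n-j)-th primitive of component j, so
the observation is bounded by that quantity plus a small error. The cascade estimate bounds ‖z‖ by
the observation. The states z obtained in this way are dense, and continuity gives the estimate for
all of them (`velocityObservableAt_of_cascade`).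

Both observabilities persist when T increases, so their minimal times are infima, and neither
exceeds a time beyond which the cascade is observable. -/

noncomputable section

namespace Cascade

open MeasureTheory Filter Topology Set
open scoped ENNReal NNReal InnerProductSpace

set_option linter.unusedSectionVars false

/-! ### Operators that are diagonal in a Hilbert basis. -/

section Diagonal

variable {𝕜 : Type*} [RCLike 𝕜]
variable {H : Type*} [NormedAddCommGroup H] [InnerProductSpace 𝕜 H]
variable {ι : Type*}

theorem hasSum_repr_sq (b : HilbertBasis ι 𝕜 H) (x : H) :
    HasSum (fun i => ‖b.repr x i‖ ^ 2) (‖x‖ ^ 2) := by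
  have := lp.hasSum_norm (p := 2) (by norm_num) (b.repr x)
  simpa using this

theorem tsum_repr_sq (b : HilbertBasis ι 𝕜 H) (x : H) :
    ∑' i, ENNReal.ofReal (‖b.repr x i‖ ^ 2) = ENNReal.ofReal (‖x‖ ^ 2) := by
  rw [← (hasSum_repr_sq b x).tsum_eq, ENNReal.ofReal_tsum_of_nonneg (fun _ => by positivity)
    (hasSum_repr_sq b x).summable]

theorem repr_ext (b : HilbertBasis ι 𝕜 H) {x y : H} (h : ∀ i, b.repr x i = b.repr y i) : x = y :=
  b.repr.injective (lp.ext (funext h))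

theorem hasSum_repr_inner (b : HilbertBasis ι 𝕜 H) (x y : H) :
    HasSum (fun i => inner 𝕜 (b.repr x i) (b.repr y i)) (inner 𝕜 x y) := by
  rw [← b.repr.inner_map_map]
  exact lp.hasSum_inner _ _

/-- A vector with prescribed square summable coordinates. -/
theorem exists_repr_eq (b : HilbertBasis ι 𝕜 H) (c : ι → 𝕜)
    (hc : ∑' i, ENNReal.ofReal (‖c i‖ ^ 2) ≠ ∞) : ∃ x : H, ∀ i, b.repr x i = c i := by
  have hs : Summable fun i => ‖c i‖ ^ 2 := by
    have := ENNReal.summable_toReal hc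
    simpa [ENNReal.toReal_ofReal (sq_nonneg _)] using this
  have hm : Memℓp c 2 := by
    rw [memℓp_gen_iff (by norm_num)]
    simpa using hs
  exact ⟨b.repr.symm ⟨c, hm⟩, fun i => by simp⟩

theorem exists_repr_eq_mul (b : HilbertBasis ι 𝕜 H) {m : ι → ℝ} (h : ∃ C : ℝ, ∀ i, |m i| ≤ C)
    (x : H) : ∃ y : H, ∀ i, b.repr y i = (m i : 𝕜) * b.repr x i := by
  obtain ⟨C, hC⟩ := h
  refine exists_repr_eq b _ (ne_top_of_le_ne_top (b := ∑' i, ENNReal.ofReal (C ^ 2) *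
    ENNReal.ofReal (‖b.repr x i‖ ^ 2)) ?_ (ENNReal.tsum_le_tsum fun i => ?_))
  · rw [ENNReal.tsum_mul_left, tsum_repr_sq]
    exact ENNReal.mul_ne_top ENNReal.ofReal_ne_top ENNReal.ofReal_ne_top
  · rw [← ENNReal.ofReal_mul (sq_nonneg _)]
    apply ENNReal.ofReal_le_ofReal
    rw [norm_mul, RCLike.norm_ofReal, mul_pow]
    have := hC i
    have h0 := abs_nonneg (m i)
    gcongr

theorem norm_le_of_repr_eq_mul (b : HilbertBasis ι 𝕜 H) {m : ι → ℝ} {C : ℝ}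
    (hm : ∀ i, |m i| ≤ C) {x y : H} (h : ∀ i, b.repr y i = (m i : 𝕜) * b.repr x i) :
    ‖y‖ ≤ |C| * ‖x‖ := by
  refine abs_le_of_sq_le_sq' ?_ (by positivity) |>.2
  rw [mul_pow]
  refine hasSum_le (fun i => ?_) (hasSum_repr_sq b _) ((hasSum_repr_sq b x).mul_left (|C| ^ 2))
  rw [h, norm_mul, RCLike.norm_ofReal, mul_pow]
  have := (hm i).trans (le_abs_self C)
  have h0 := abs_nonneg (m i)
  gcongr

open Classical in
/-- The bounded operator that multiplies the `i`-th coordinate by `m i` (zero if `m` is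
unbounded). -/
def diag (b : HilbertBasis ι 𝕜 H) (m : ι → ℝ) : H →L[𝕜] H :=
  if h : ∃ C : ℝ, ∀ i, |m i| ≤ C then
    LinearMap.mkContinuous
      { toFun := fun x => (exists_repr_eq_mul b h x).choose
        map_add' := fun x y => repr_ext b fun i => by
          rw [(exists_repr_eq_mul b h _).choose_spec, map_add, map_add, lp.coeFn_add, lp.coeFn_add,
            Pi.add_apply, Pi.add_apply, (exists_repr_eq_mul b h _).choose_spec,
            (exists_repr_eq_mul b h _).choose_spec, mul_add]
        map_smul' := fun c x => repr_ext b fun i => by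
          rw [(exists_repr_eq_mul b h _).choose_spec, map_smul, map_smul, lp.coeFn_smul,
            lp.coeFn_smul, Pi.smul_apply, Pi.smul_apply, (exists_repr_eq_mul b h _).choose_spec,
            smul_eq_mul, RingHom.id_apply, smul_eq_mul]
          ring }
      |h.choose| fun x =>
        norm_le_of_repr_eq_mul b h.choose_spec (exists_repr_eq_mul b h x).choose_spec
  else 0

theorem repr_diag (b : HilbertBasis ι 𝕜 H) {m : ι → ℝ} {C : ℝ} (hm : ∀ i, |m i| ≤ C) (x : H)
    (i : ι) : b.repr (diag b m x) i = (m i : 𝕜) * b.repr x i := by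
  have h : ∃ C : ℝ, ∀ i, |m i| ≤ C := ⟨C, hm⟩
  simp only [diag, dif_pos h]
  exact (exists_repr_eq_mul b h x).choose_spec i

theorem norm_diag_apply_le (b : HilbertBasis ι 𝕜 H) {m : ι → ℝ} {C : ℝ} (hC : 0 ≤ C)
    (hm : ∀ i, |m i| ≤ C) (x : H) : ‖diag b m x‖ ≤ C * ‖x‖ := by
  simpa [abs_of_nonneg hC] using norm_le_of_repr_eq_mul b hm (repr_diag b hm x)

theorem inner_diag (b : HilbertBasis ι 𝕜 H) {m : ι → ℝ} {C : ℝ} (hm : ∀ i, |m i| ≤ C) (x y : H) :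
    inner 𝕜 (diag b m x) y = inner 𝕜 x (diag b m y) := by
  refine (hasSum_repr_inner b _ _).unique ?_
  convert hasSum_repr_inner b x (diag b m y) using 2 with i
  rw [repr_diag b hm, repr_diag b hm]
  simp only [RCLike.inner_apply, map_mul, RCLike.conj_ofReal]
  ring

end Diagonal

/-! ### The eigenbasis of A, and the norms |A^{k/2} u| in coordinates. -/

section Spectral

variable {𝕜 : Type*} [RCLike 𝕜]
variable {H : Type*} [NormedAddCommGroup H] [InnerProductSpace 𝕜 H] [CompleteSpace H]

/-- An orthonormal basis of eigenvectors of `A`, with eigenvalues bounded below by `low > 0`. -/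
structure SpectralData (A : H →ₗ.[𝕜] H) (ι : Type*) where
  /-- the eigenvectors -/
  b : HilbertBasis ι 𝕜 H
  /-- the eigenvalues -/
  μ : ι → ℝ
  /-- a positive lower bound of the eigenvalues -/
  low : ℝ
  low_pos : 0 < low
  low_le : ∀ i, low ≤ μ i
  graph_iff : ∀ u g : H, (u, g) ∈ A.graph ↔ ∀ i, b.repr g i = (μ i : 𝕜) * b.repr u i

theorem StandingAssumption.symm {A : H →ₗ.[𝕜] H} (hA : StandingAssumption A) (u v : A.domain) :
    inner 𝕜 (A u) (v : H) = inner 𝕜 (u : H) (A v) := by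
  have h := LinearPMap.adjoint_isFormalAdjoint hA.selfAdjoint.dense_domain
  rw [LinearPMap.isSelfAdjoint_def.1 hA.selfAdjoint] at h
  exact h u v

/-- The scalar z of the compact resolvent R = (A - z)^{-1} need not be 0. Solving Au = x amounts to
(1 + zR)u = Rx. The operator 1 + zR is injective because A is bounded below, hence invertible by the
Fredholm alternative, and (1 + zR)^{-1}R is again compact. -/
theorem StandingAssumption.exists_inverse {A : H →ₗ.[𝕜] H} (hA : StandingAssumption A) :
    ∃ S : H →L[𝕜] H, IsCompactOperator S ∧ ∀ u g : H, (u, g) ∈ A.graph ↔ u = S g := by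
  obtain ⟨z, R, hRc, hR1, hR2⟩ := hA.compactResolvent
  obtain ⟨ω, hω, hlow⟩ := hA.bounded_below
  -- If u = -zRu, then d = Ru satisfies Ad = zd + u = 0, so d = 0 by the lower bound, and u = Ad -
  -- zd = 0.
  have hker : ∀ u : H, u + z • R u = 0 → u = 0 := by
    intro u hu
    obtain ⟨d, hd, hd'⟩ := hR1 u
    have h1 : A d = 0 := by
      rw [hd, ← sub_eq_zero, ← sub_eq_zero] at hd'
      have : A d - 0 = (A d - z • R u - u - 0) + (u + z • R u) := by abel
      rw [sub_zero] at this
      rw [this, hd', hu, add_zero]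
    have h2 := hlow d
    rw [h1, norm_zero] at h2
    have h3 : (d : H) = 0 := by
      rw [← norm_le_zero_iff]
      by_contra hc
      push Not at hc
      have := mul_pos hω hc
      linarith
    rw [← hd'] 
    rw [h1, h3]; simp
  have hunit : IsUnit (1 + z • R : H →L[𝕜] H) := by
    by_cases hz : z = 0
    · simp [hz]
    have hμ : -z⁻¹ ≠ 0 := by simpa using hz
    rcases hRc.hasEigenvalue_or_mem_resolventSet hμ with h | h
    · exfalso
      obtain ⟨v, hv⟩ := h.exists_hasEigenvector
      refine hv.2 (hker v ?_)
      have : R v = -z⁻¹ • v := hv.apply_eq_smul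
      rw [this, smul_smul]
      simp [hz]
    · rw [spectrum.mem_resolventSet_iff] at h
      have : (1 + z • R : H →L[𝕜] H) =
          algebraMap 𝕜 (H →L[𝕜] H) (-z) * (algebraMap 𝕜 (H →L[𝕜] H) (-z⁻¹) - R) := by
        rw [mul_sub, ← map_mul]
        ext x
        simp [hz, Algebra.algebraMap_eq_smul_one]
      rw [this]
      exact ((IsUnit.mk0 (-z) (by simpa using hz)).map _).mul h
  obtain ⟨V, hV⟩ := hunit
  have hV1 : ∀ x, (↑V⁻¹ : H →L[𝕜] H) (x + z • R x) = x := fun x => by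
    have : (↑V⁻¹ * ↑V : H →L[𝕜] H) x = x := by simp
    rw [hV] at this
    simpa using this
  have hV2 : ∀ x, (↑V⁻¹ : H →L[𝕜] H) x + z • R ((↑V⁻¹ : H →L[𝕜] H) x) = x := fun x => by
    have : (↑V * ↑V⁻¹ : H →L[𝕜] H) x = x := by simp
    rw [hV] at this
    simpa using this
  have hleft : ∀ d : A.domain, (↑V⁻¹ : H →L[𝕜] H) (R (A d)) = d := fun d => by
    have h := hR2 d
    rw [map_sub, map_smul, sub_eq_iff_eq_add] at h
    rw [h, hV1]
  have hright : ∀ x : H, ∃ d : A.domain, (d : H) = (↑V⁻¹ : H →L[𝕜] H) (R x) ∧ A d = x := by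
    intro x
    set u := (↑V⁻¹ : H →L[𝕜] H) (R x) with hu
    have h1 : u + z • R u = R x := hV2 _
    have h2 : u = R (x - z • u) := by
      rw [map_sub, map_smul, ← h1]; abel
    obtain ⟨d, hd, hd'⟩ := hR1 (x - z • u)
    rw [← h2] at hd
    refine ⟨d, hd, ?_⟩
    rw [hd] at hd'
    simpa using hd'
  refine ⟨(↑V⁻¹ : H →L[𝕜] H).comp R, hRc.clm_comp _, fun u g => ?_⟩
  rw [LinearPMap.mem_graph_iff]
  constructor
  · rintro ⟨d, hd, hd'⟩
    simp only at hd hd'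
    rw [← hd, ← hd', ContinuousLinearMap.comp_apply, hleft]
  · rintro rfl
    exact hright g

/-- The compact symmetric inverse S of A is diagonalised: Hilbert bases of its eigenspaces, put
together, form a Hilbert basis of H. Positivity of A makes the eigenvalues of S positive, and the
lower bound ω of A becomes a lower bound of their inverses. -/
theorem StandingAssumption.exists_spectralData {𝕜 : Type u} [RCLike 𝕜] {H : Type v}
    [NormedAddCommGroup H] [InnerProductSpace 𝕜 H] [CompleteSpace H] {A : H →ₗ.[𝕜] H}
    (hA : StandingAssumption A) : ∃ ι : Type (max u v), Nonempty (SpectralData A ι) := by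
  obtain ⟨S, hSc, hS⟩ := hA.exists_inverse
  obtain ⟨ω, hω, hlow⟩ := hA.bounded_below
  have hgr : ∀ g : H, ∃ d : A.domain, (d : H) = S g ∧ A d = g := fun g => by
    have := (hS (S g) g).2 rfl
    rwa [LinearPMap.mem_graph_iff] at this
  have hsymm : (S : H →ₗ[𝕜] H).IsSymmetric := by
    intro x y
    obtain ⟨d, hd, hd'⟩ := hgr x
    obtain ⟨e, he, he'⟩ := hgr y
    have := hA.symm d e
    simp only [ContinuousLinearMap.coe_coe]
    rw [hd', hd, he', he] at this
    exact this.symm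
  have hbot := ContinuousLinearMap.orthogonalComplement_iSup_eigenspaces_eq_bot hSc hsymm
  choose w bw hbw using fun μ : 𝕜 =>
    exists_hilbertBasis 𝕜 (Module.End.eigenspace (S : Module.End 𝕜 H) μ)
  have hon : Orthonormal 𝕜 (fun a : Σ μ : 𝕜, w μ => ((a.2 : Module.End.eigenspace
      (S : Module.End 𝕜 H) a.1) : H)) := by
    refine hsymm.orthogonalFamily_eigenspaces.orthonormal_sigma_orthonormal
      (v_family := fun μ (x : w μ) => (x : Module.End.eigenspace (S : Module.End 𝕜 H) μ)) ?_
    intro μ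
    rw [← hbw]
    exact (bw μ).orthonormal
  have hsp : (Submodule.span 𝕜 (Set.range (fun a : Σ μ : 𝕜, w μ => ((a.2 : Module.End.eigenspace
      (S : Module.End 𝕜 H) a.1) : H))))ᗮ = ⊥ := by
    rw [eq_bot_iff, ← hbot]
    intro x hx
    rw [Submodule.mem_orthogonal'] at hx ⊢
    intro y hy
    refine Submodule.iSup_induction _ (motive := fun y => inner 𝕜 x y = 0) hy ?_ (by simp)
      (fun a b ha hb => by rw [inner_add_right, ha, hb, add_zero])
    intro μ y hy
    have hs := (bw μ).hasSum_repr ⟨y, hy⟩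
    have hs' := (hs.mapL (Submodule.subtypeL _)).mapL (innerSL 𝕜 x)
    simp only [Submodule.subtypeL_apply, innerSL_apply_apply] at hs'
    refine hs'.unique ?_
    convert hasSum_zero with i
    rw [Submodule.coe_smul, inner_smul_right, hbw]
    rw [hx _ (Submodule.subset_span ⟨⟨μ, i⟩, rfl⟩), mul_zero]
  let b := HilbertBasis.mkOfOrthogonalEqBot hon hsp
  have hb : ∀ a : Σ μ : 𝕜, w μ, b a = ((a.2 : Module.End.eigenspace
      (S : Module.End 𝕜 H) a.1) : H) := fun a => by
    simp only [b]
    rw [HilbertBasis.coe_mkOfOrthogonalEqBot]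
  have hbS : ∀ a : Σ μ : 𝕜, w μ, S (b a) = a.1 • b a := fun a => by
    rw [hb]
    have := a.2.1.2
    rw [Module.End.mem_eigenspace_iff] at this
    exact this
  have hb1 : ∀ a, ‖b a‖ = 1 := fun a => b.orthonormal.1 a
  -- The index type also runs over the scalar 0, whose eigenspace is trivial: Sg = 0 forces g = A 0
  -- = 0.
  have hne : ∀ a : Σ μ : 𝕜, w μ, a.1 ≠ 0 := fun a h0 => by
    have h := hbS a
    rw [h0, zero_smul] at h
    obtain ⟨d, hd, hd'⟩ := hgr (b a)
    rw [h] at hd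
    have h2 : d = 0 := Subtype.ext hd
    rw [h2, LinearPMap.map_zero] at hd'
    have := hb1 a
    rw [← hd', norm_zero] at this
    exact zero_ne_one this
  have hreal : ∀ a : Σ μ : 𝕜, w μ, ((RCLike.re a.1 : ℝ) : 𝕜) = a.1 := fun a => by
    rw [← RCLike.conj_eq_iff_re]
    refine hsymm.conj_eigenvalue_eq_self (Module.End.hasEigenvalue_of_hasEigenvector (x := b a)
      ⟨Module.End.mem_eigenspace_iff.2 (hbS a), fun h => ?_⟩)
    have := hb1 a
    rw [h, norm_zero] at this
    exact zero_ne_one this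
  have hre : ∀ a : Σ μ : 𝕜, w μ, RCLike.re a.1 ≠ 0 := fun a h => by
    apply hne a
    rw [← hreal a, h, RCLike.ofReal_zero]
  have hpos : ∀ a : Σ μ : 𝕜, w μ, 0 < RCLike.re a.1 := fun a => by
    refine lt_of_le_of_ne ?_ (hre a).symm
    obtain ⟨d, hd, hd'⟩ := hgr (b a)
    have := hA.nonneg d
    rw [hd', hd, hbS, inner_smul_right, inner_self_eq_norm_sq_to_K, hb1] at this
    simpa using this
  refine ⟨Σ μ : 𝕜, w μ, ⟨⟨b, fun a => (RCLike.re a.1)⁻¹, ω, hω, fun a => ?_, fun u g => ?_⟩⟩⟩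
  · obtain ⟨d, hd, hd'⟩ := hgr (b a)
    have := hlow d
    rw [hd', hd, hbS, norm_smul, hb1, mul_one, ← hreal a, RCLike.norm_ofReal,
      abs_of_pos (hpos a)] at this
    rw [inv_eq_one_div, le_div_iff₀ (hpos a)]
    exact this
  · have hrS : ∀ a, b.repr (S g) a = a.1 * b.repr g a := fun a => by
      rw [b.repr_apply_apply, b.repr_apply_apply]
      have := hsymm (b a) g
      simp only [ContinuousLinearMap.coe_coe] at this
      rw [← this, hbS, inner_smul_left, ← hreal a, RCLike.conj_ofReal]
    rw [hS]
    constructor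
    · rintro rfl a
      rw [hrS, ← mul_assoc, RCLike.ofReal_inv, hreal, inv_mul_cancel₀ (hne a), one_mul]
    · intro h
      refine repr_ext b fun a => ?_
      rw [hrS, h a, ← mul_assoc, RCLike.ofReal_inv, hreal, mul_inv_cancel₀ (hne a), one_mul]

namespace SpectralData

variable {A : H →ₗ.[𝕜] H} {ι : Type*} (D : SpectralData A ι)

theorem μ_pos (i : ι) : 0 < D.μ i := D.low_pos.trans_le (D.low_le i)

theorem mem_eigenspace_iff {μ : ℝ} {u : H} :
    u ∈ eigenspace A μ ↔ ∀ i, D.μ i ≠ μ → D.b.repr u i = 0 := by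
  have h1 : u ∈ eigenspace A μ ↔ (u, (μ : 𝕜) • u) ∈ A.graph := by
    rw [LinearPMap.mem_graph_iff, eigenspace, Submodule.mem_map]
    constructor
    · rintro ⟨d, hd, rfl⟩
      refine ⟨d, rfl, ?_⟩
      rw [LinearMap.mem_ker, LinearMap.sub_apply, sub_eq_zero] at hd
      exact hd
    · rintro ⟨d, hd, hd'⟩
      refine ⟨d, ?_, hd⟩
      rw [LinearMap.mem_ker, LinearMap.sub_apply, sub_eq_zero]
      simp only at hd hd'
      rw [← hd] at hd'
      exact hd'
  rw [h1, D.graph_iff]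
  refine forall_congr' fun i => ?_
  rw [map_smul, lp.coeFn_smul, Pi.smul_apply, smul_eq_mul, ← sub_eq_zero, ← sub_mul, mul_eq_zero,
    sub_eq_zero, RCLike.ofReal_inj, or_iff_not_imp_left]
  exact imp_congr_left (not_congr eq_comm)

open Classical in
theorem repr_eigenproj (μ : ℝ) (u : H) (i : ι) :
    D.b.repr (eigenproj A μ u) i = if D.μ i = μ then D.b.repr u i else 0 := by
  have hm : ∀ i, |(if D.μ i = μ then 1 else 0 : ℝ)| ≤ 1 := fun i => by split_ifs <;> simp
  -- The eigenspace is closed, being an intersection of kernels of coordinate functionals.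
  have hcl : (eigenspace A μ).topologicalClosure = eigenspace A μ := by
    refine le_antisymm ?_ (Submodule.le_topologicalClosure _)
    refine Submodule.topologicalClosure_minimal _ le_rfl ?_
    have : (eigenspace A μ : Set H) = ⋂ (i) (_ : D.μ i ≠ μ), {u | inner 𝕜 (D.b i) u = 0} := by
      ext u
      simp only [SetLike.mem_coe, D.mem_eigenspace_iff, mem_iInter, mem_ofPred_eq,
        D.b.repr_apply_apply]
    rw [this]
    refine isClosed_iInter fun i => isClosed_iInter fun _ => isClosed_eq ?_ continuous_const
    exact (innerSL 𝕜 (D.b i)).continuous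
  have : eigenproj A μ u = diag D.b (fun i => if D.μ i = μ then 1 else 0) u := by
    rw [eigenproj]
    refine Submodule.eq_starProjection_of_mem_of_inner_eq_zero ?_ fun w hw => ?_
    · rw [hcl, D.mem_eigenspace_iff]
      intro i hi
      rw [repr_diag _ hm, if_neg hi]
      simp
    · rw [hcl, D.mem_eigenspace_iff] at hw
      refine (hasSum_repr_inner D.b _ _).unique ?_
      convert hasSum_zero with i
      by_cases hi : D.μ i = μ
      · rw [map_sub, lp.coeFn_sub, Pi.sub_apply, repr_diag _ hm, if_pos hi]
        simp
      · rw [hw i hi, inner_zero_right]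
  rw [this, repr_diag _ hm]
  split_ifs <;> simp

/-- Each basis vector belongs to exactly one eigenspace, and sums in [0, ∞] may be exchanged without
any summability condition; so the sum over real numbers regroups into a sum over the basis. -/
theorem powNormSq_eq (k : ℤ) (u : H) :
    powNormSq A k u = ∑' i, ENNReal.ofReal (D.μ i ^ k * ‖D.b.repr u i‖ ^ 2) := by
  classical
  have h1 : ∀ μ : ℝ, ENNReal.ofReal (μ ^ k * ‖eigenproj A μ u‖ ^ 2) =
      ∑' i, if μ = D.μ i then ENNReal.ofReal (D.μ i ^ k * ‖D.b.repr u i‖ ^ 2) else 0 := by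
    intro μ
    by_cases hμ : 0 ≤ μ ^ k
    · rw [ENNReal.ofReal_mul hμ, ← tsum_repr_sq D.b, ← ENNReal.tsum_mul_left]
      refine tsum_congr fun i => ?_
      rw [D.repr_eigenproj]
      split_ifs with h h' h'
      · rw [ENNReal.ofReal_mul (h' ▸ hμ), h]
      · exact absurd h.symm h'
      · exact absurd h'.symm h
      · simp
    -- Here μ^k < 0, so μ is not an eigenvalue, all of which are positive: the left side is
    -- truncated to 0, and no index contributes to the right side.
    · rw [ENNReal.ofReal_of_nonpos
        (mul_nonpos_of_nonpos_of_nonneg (not_le.1 hμ).le (sq_nonneg _)), eq_comm]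
      refine ENNReal.tsum_eq_zero.2 fun i => ?_
      rw [if_neg]
      rintro rfl
      exact hμ (zpow_nonneg (D.μ_pos i).le _)
  simp only [powNormSq, h1]
  rw [ENNReal.tsum_comm]
  exact tsum_congr fun i => tsum_ite_eq (D.μ i) _

end SpectralData

end Spectral

/-! ### Forced harmonic oscillators with an integrable force. -/

section Calculus

theorem hasDerivWithinAt_of_eq_integral {E : Type*} [NormedAddCommGroup E] [NormedSpace ℝ E]
    [CompleteSpace E] {T : ℝ} {w v : ℝ → E} (hv : ContinuousOn v (Icc 0 T))
    (h : ∀ t ∈ Icc 0 T, w t = w 0 + ∫ s in (0 : ℝ)..t, v s) {t : ℝ} (ht : t ∈ Icc 0 T) :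
    HasDerivWithinAt w (v t) (Icc 0 T) t := by
  have hT : (0 : ℝ) ≤ T := ht.1.trans ht.2
  -- Extending v by constants beyond [0, T] lets the two-sided fundamental theorem of calculus cover
  -- the endpoints.
  have hext : Continuous (IccExtend hT ((Icc 0 T).domRestrict v)) :=
    (continuousOn_iff_continuous_domRestrict.1 hv).Icc_extend'
  have hval : ∀ s ∈ Icc 0 T, IccExtend hT ((Icc 0 T).domRestrict v) s = v s := fun s hs => by
    rw [IccExtend_of_mem hT _ hs]; rfl
  have hd : HasDerivAt (fun t => w 0 + ∫ s in (0 : ℝ)..t, IccExtend hT ((Icc 0 T).domRestrict v) s)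
      (v t) t := by
    have := (hext.integral_hasStrictDerivAt 0 t).hasDerivAt.const_add (w 0)
    rwa [hval t ht] at this
  refine hd.hasDerivWithinAt.congr_of_mem (fun s hs => ?_) ht
  rw [h s hs]
  congr 1
  refine intervalIntegral.integral_congr fun r hr => ?_
  rw [uIcc_of_le hs.1] at hr
  exact (hval r ⟨hr.1, hr.2.trans hs.2⟩).symm

theorem eq_integral_of_hasDerivWithinAt {E : Type*} [NormedAddCommGroup E] [NormedSpace ℝ E]
    [CompleteSpace E] {T : ℝ} {w v : ℝ → E} (hv : ContinuousOn v (Icc 0 T))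
    (h : ∀ t ∈ Icc 0 T, HasDerivWithinAt w (v t) (Icc 0 T) t) {t : ℝ} (ht : t ∈ Icc 0 T) :
    w t = w 0 + ∫ s in (0 : ℝ)..t, v s := by
  have hsub : Icc 0 t ⊆ Icc 0 T := Icc_subset_Icc_right ht.2
  rw [intervalIntegral.integral_eq_sub_of_hasDerivAt_of_le ht.1
    (fun s hs => ((h s (hsub hs)).continuousWithinAt).mono hsub)
    (fun s hs => (h s (hsub (Ioo_subset_Icc_self hs))).hasDerivAt
      (mem_of_superset (Ioo_mem_nhds hs.1 hs.2) (Ioo_subset_Icc_self.trans hsub)))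
    ((hv.mono hsub).intervalIntegrable_of_Icc ht.1)]
  abel

/-- Since h is only integrable, its primitive is only absolutely continuous; this is the integration
by parts valid for such functions. -/
theorem mul_primitive_real {φ h : ℝ → ℝ} (hφ : ContDiff ℝ 1 φ) {t : ℝ}
    (hh : IntervalIntegrable h volume 0 t) (x : ℝ) :
    φ t * (x + ∫ s in (0 : ℝ)..t, h s) = φ 0 * x +
      ∫ s in (0 : ℝ)..t, (φ s * h s + deriv φ s * (x + ∫ r in (0 : ℝ)..s, h r)) := by
  have h1 : AbsolutelyContinuousOnInterval φ 0 t := hφ.contDiffOn.absolutelyContinuousOnInterval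
  have h0 : AbsolutelyContinuousOnInterval (fun _ : ℝ => x) 0 t :=
    (contDiff_const (n := 1)).contDiffOn.absolutelyContinuousOnInterval
  have h2 : AbsolutelyContinuousOnInterval (fun s => x + ∫ r in (0 : ℝ)..s, h r) 0 t :=
    h0.add (hh.absolutelyContinuousOnInterval_intervalIntegral (by simp))
  have h3 := h1.integral_deriv_mul_eq_sub h2
  simp only [intervalIntegral.integral_same, add_zero] at h3
  rw [← sub_eq_iff_eq_add', ← h3]
  refine intervalIntegral.integral_congr_ae ?_
  filter_upwards [hh.ae_hasDerivAt_integral] with s hs hst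
  have := (hs (uIoc_subset_uIcc hst) 0 (by simp)).const_add x
  rw [this.deriv]
  ring

variable {𝕜 : Type*} [RCLike 𝕜]

theorem mul_primitive {φ : ℝ → ℝ} {h : ℝ → 𝕜} (hφ : ContDiff ℝ 1 φ) {t : ℝ}
    (hh : IntervalIntegrable h volume 0 t) (x : 𝕜) :
    (φ t : 𝕜) * (x + ∫ s in (0 : ℝ)..t, h s) = (φ 0 : 𝕜) * x +
      ∫ s in (0 : ℝ)..t, ((φ s : 𝕜) * h s + ((deriv φ s : ℝ) : 𝕜) * (x + ∫ r in (0 : ℝ)..s, h r)) := by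
  have hsub : ∀ s ∈ uIcc 0 t, IntervalIntegrable h volume 0 s := fun s hs =>
    hh.mono_set (uIcc_subset_uIcc_left hs)
  have hprim : ContinuousOn (fun s => ∫ r in (0 : ℝ)..s, h r) (uIcc 0 t) :=
    intervalIntegral.continuousOn_primitive_interval' hh (by simp)
  have hint : IntervalIntegrable (fun s => (φ s : 𝕜) * h s + ((deriv φ s : ℝ) : 𝕜) *
      (x + ∫ r in (0 : ℝ)..s, h r)) volume 0 t := by
    refine (hh.continuousOn_mul ?_).add (ContinuousOn.intervalIntegrable ?_)
    · exact (RCLike.continuous_ofReal.comp hφ.continuous).continuousOn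
    · exact ((RCLike.continuous_ofReal.comp (hφ.continuous_deriv le_rfl)).continuousOn).mul
        (continuousOn_const.add hprim)
  -- The identity is linear over ℝ, so it can be checked on the real and on the imaginary part.
  have key : ∀ L : 𝕜 →L[ℝ] ℝ, (∀ (r : ℝ) (z : 𝕜), L (r * z) = r * L z) →
      L ((φ t : 𝕜) * (x + ∫ s in (0 : ℝ)..t, h s)) = L ((φ 0 : 𝕜) * x +
      ∫ s in (0 : ℝ)..t, ((φ s : 𝕜) * h s + ((deriv φ s : ℝ) : 𝕜) * (x + ∫ r in (0 : ℝ)..s, h r))) := by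
    intro L hL
    have hLh : IntervalIntegrable (fun s => L (h s)) volume 0 t :=
      ⟨L.integrable_comp hh.1, L.integrable_comp hh.2⟩
    rw [hL, map_add, map_add, hL, ← L.intervalIntegral_comp_comm hh,
      ← L.intervalIntegral_comp_comm hint, mul_primitive_real hφ hLh]
    congr 1
    refine intervalIntegral.integral_congr fun s hs => ?_
    simp only [map_add, hL, ← L.intervalIntegral_comp_comm (hsub s hs)]
  refine RCLike.ext ?_ ?_
  · exact key RCLike.reCLM fun r z => by simp
  · exact key RCLike.imCLM fun r z => by simp

theorem mul_primitive' {φ φ' : ℝ → ℝ} {g h : ℝ → 𝕜} (hφ : ∀ s, HasDerivAt φ (φ' s) s)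
    (hφ' : Continuous φ') {t : ℝ} (ht : 0 ≤ t) (hh : IntervalIntegrable h volume 0 t)
    (hg : ∀ s ∈ Icc 0 t, g s = g 0 + ∫ r in (0 : ℝ)..s, h r) :
    (φ t : 𝕜) * g t = (φ 0 : 𝕜) * g 0 +
      ∫ s in (0 : ℝ)..t, ((φ s : 𝕜) * h s + (φ' s : 𝕜) * g s) := by
  have hd : deriv φ = φ' := funext fun s => (hφ s).deriv
  have hc : ContDiff ℝ 1 φ := by
    rw [contDiff_one_iff_deriv]
    exact ⟨fun s => (hφ s).differentiableAt, hd ▸ hφ'⟩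
  rw [hg t ⟨ht, le_rfl⟩, mul_primitive hc hh (g 0), hd]
  congr 1
  refine intervalIntegral.integral_congr fun s hs => ?_
  rw [uIcc_of_le ht] at hs
  rw [hg s hs]

theorem hasDerivAt_cos_mul (ω s : ℝ) :
    HasDerivAt (fun s => Real.cos (ω * s)) (-(ω * Real.sin (ω * s))) s := by
  have := ((hasDerivAt_id s).const_mul ω).cos
  simpa [mul_comm] using this

theorem hasDerivAt_sin_mul (ω s : ℝ) :
    HasDerivAt (fun s => Real.sin (ω * s)) (ω * Real.cos (ω * s)) s := by
  have := ((hasDerivAt_id s).const_mul ω).sin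
  simpa [mul_comm] using this

section

variable {ω : ℝ} {a v f : ℝ → 𝕜} {t : ℝ}

/-- A forced harmonic oscillator, in rotating coordinates. -/
theorem oscillator_rotate (ht : 0 ≤ t) (ha : ContinuousOn a (Icc 0 t))
    (hv : ContinuousOn v (Icc 0 t)) (hf : IntervalIntegrable f volume 0 t)
    (ha' : ∀ s ∈ Icc 0 t, a s = a 0 + ∫ r in (0 : ℝ)..s, (ω : 𝕜) * v r)
    (hv' : ∀ s ∈ Icc 0 t, v s = v 0 + ∫ r in (0 : ℝ)..s, (f r - (ω : 𝕜) * a r)) :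
    (Real.cos (ω * t) : 𝕜) * a t - (Real.sin (ω * t) : 𝕜) * v t =
        a 0 - ∫ s in (0 : ℝ)..t, (Real.sin (ω * s) : 𝕜) * f s ∧
    (Real.sin (ω * t) : 𝕜) * a t + (Real.cos (ω * t) : 𝕜) * v t =
        v 0 + ∫ s in (0 : ℝ)..t, (Real.cos (ω * s) : 𝕜) * f s := by
  rw [← uIcc_of_le ht] at ha hv
  have hcos : ContinuousOn (fun s => (Real.cos (ω * s) : 𝕜)) (uIcc 0 t) :=
    (RCLike.continuous_ofReal.comp (by fun_prop)).continuousOn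
  have hsin : ContinuousOn (fun s => (Real.sin (ω * s) : 𝕜)) (uIcc 0 t) :=
    (RCLike.continuous_ofReal.comp (by fun_prop)).continuousOn
  have ia : IntervalIntegrable (fun r => (ω : 𝕜) * v r) volume 0 t :=
    (continuousOn_const.mul hv).intervalIntegrable
  have iv : IntervalIntegrable (fun r => f r - (ω : 𝕜) * a r) volume 0 t :=
    hf.sub (continuousOn_const.mul ha).intervalIntegrable
  have h1 := mul_primitive' (hasDerivAt_cos_mul ω) (by fun_prop) ht ia ha'
  have h2 := mul_primitive' (hasDerivAt_sin_mul ω) (by fun_prop) ht ia ha'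
  have h3 := mul_primitive' (hasDerivAt_cos_mul ω) (by fun_prop) ht iv hv'
  have h4 := mul_primitive' (hasDerivAt_sin_mul ω) (by fun_prop) ht iv hv'
  simp only [mul_zero, Real.cos_zero, Real.sin_zero, RCLike.ofReal_one, RCLike.ofReal_zero,
    one_mul, zero_mul, zero_add, RCLike.ofReal_neg, RCLike.ofReal_mul] at h1 h2 h3 h4
  have hωc : ContinuousOn (fun _ : ℝ => (ω : 𝕜)) (uIcc 0 t) := continuousOn_const
  have i1 : IntervalIntegrable (fun s => (Real.cos (ω * s) : 𝕜) * ((ω : 𝕜) * v s) +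
      -((ω : 𝕜) * (Real.sin (ω * s) : 𝕜)) * a s) volume 0 t :=
    ((hcos.mul (hωc.mul hv)).add ((hωc.mul hsin).neg.mul ha)).intervalIntegrable
  have i2 : IntervalIntegrable (fun s => (Real.sin (ω * s) : 𝕜) * ((ω : 𝕜) * v s) +
      ((ω : 𝕜) * (Real.cos (ω * s) : 𝕜)) * a s) volume 0 t :=
    ((hsin.mul (hωc.mul hv)).add ((hωc.mul hcos).mul ha)).intervalIntegrable
  have i3 : IntervalIntegrable (fun s => (Real.cos (ω * s) : 𝕜) * (f s - (ω : 𝕜) * a s) +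
      -((ω : 𝕜) * (Real.sin (ω * s) : 𝕜)) * v s) volume 0 t :=
    (iv.continuousOn_mul hcos).add ((hωc.mul hsin).neg.mul hv).intervalIntegrable
  have i4 : IntervalIntegrable (fun s => (Real.sin (ω * s) : 𝕜) * (f s - (ω : 𝕜) * a s) +
      ((ω : 𝕜) * (Real.cos (ω * s) : 𝕜)) * v s) volume 0 t :=
    (iv.continuousOn_mul hsin).add ((hωc.mul hcos).mul hv).intervalIntegrable
  constructor
  -- All terms containing ω cancel between the two product rules; only the force survives.
  · rw [h1, h4, add_sub_assoc, sub_eq_add_neg (a 0), ← intervalIntegral.integral_sub i1 i4,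
      ← intervalIntegral.integral_neg]
    congr 1
    exact intervalIntegral.integral_congr fun s _ => by ring
  · rw [h2, h3, add_left_comm, ← intervalIntegral.integral_add i2 i3]
    congr 1
    exact intervalIntegral.integral_congr fun s _ => by ring

/-- The inverse change of variables. -/
theorem oscillator_unrotate {p q : ℝ → 𝕜} (ht : 0 ≤ t) (hf : IntervalIntegrable f volume 0 t)
    (hp : ContinuousOn p (Icc 0 t)) (hq : ContinuousOn q (Icc 0 t))
    (hp' : ∀ s ∈ Icc 0 t, p s = p 0 + ∫ r in (0 : ℝ)..s, -((Real.sin (ω * r) : 𝕜) * f r))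
    (hq' : ∀ s ∈ Icc 0 t, q s = q 0 + ∫ r in (0 : ℝ)..s, (Real.cos (ω * r) : 𝕜) * f r)
    (ha : ∀ s ∈ Icc 0 t, a s = (Real.cos (ω * s) : 𝕜) * p s + (Real.sin (ω * s) : 𝕜) * q s)
    (hv : ∀ s ∈ Icc 0 t, v s = (Real.cos (ω * s) : 𝕜) * q s - (Real.sin (ω * s) : 𝕜) * p s) :
    a t = a 0 + ∫ s in (0 : ℝ)..t, (ω : 𝕜) * v s ∧
    v t = v 0 + ∫ s in (0 : ℝ)..t, (f s - (ω : 𝕜) * a s) := by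
  rw [← uIcc_of_le ht] at hp hq
  have hcos : ContinuousOn (fun s => (Real.cos (ω * s) : 𝕜)) (uIcc 0 t) :=
    (RCLike.continuous_ofReal.comp (by fun_prop)).continuousOn
  have hsin : ContinuousOn (fun s => (Real.sin (ω * s) : 𝕜)) (uIcc 0 t) :=
    (RCLike.continuous_ofReal.comp (by fun_prop)).continuousOn
  have ip : IntervalIntegrable (fun r => -((Real.sin (ω * r) : 𝕜) * f r)) volume 0 t :=
    (hf.continuousOn_mul hsin).neg
  have iq : IntervalIntegrable (fun r => (Real.cos (ω * r) : 𝕜) * f r) volume 0 t :=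
    hf.continuousOn_mul hcos
  have h1 := mul_primitive' (hasDerivAt_cos_mul ω) (by fun_prop) ht ip hp'
  have h2 := mul_primitive' (hasDerivAt_sin_mul ω) (by fun_prop) ht ip hp'
  have h3 := mul_primitive' (hasDerivAt_cos_mul ω) (by fun_prop) ht iq hq'
  have h4 := mul_primitive' (hasDerivAt_sin_mul ω) (by fun_prop) ht iq hq'
  have h0 : (0 : ℝ) ∈ Icc 0 t := ⟨le_rfl, ht⟩
  have ha0 := ha 0 h0
  have hv0 := hv 0 h0
  simp only [mul_zero, Real.cos_zero, Real.sin_zero, RCLike.ofReal_one, RCLike.ofReal_zero,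
    one_mul, zero_mul, zero_add, add_zero, sub_zero, RCLike.ofReal_neg, RCLike.ofReal_mul] at *
  have hωc : ContinuousOn (fun _ : ℝ => (ω : 𝕜)) (uIcc 0 t) := continuousOn_const
  have i1 : IntervalIntegrable (fun s => (Real.cos (ω * s) : 𝕜) * -((Real.sin (ω * s) : 𝕜) * f s) +
      -((ω : 𝕜) * (Real.sin (ω * s) : 𝕜)) * p s) volume 0 t :=
    (ip.continuousOn_mul hcos).add ((hωc.mul hsin).neg.mul hp).intervalIntegrable
  have i2 : IntervalIntegrable (fun s => (Real.sin (ω * s) : 𝕜) * -((Real.sin (ω * s) : 𝕜) * f s) +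
      ((ω : 𝕜) * (Real.cos (ω * s) : 𝕜)) * p s) volume 0 t :=
    (ip.continuousOn_mul hsin).add ((hωc.mul hcos).mul hp).intervalIntegrable
  have i3 : IntervalIntegrable (fun s => (Real.cos (ω * s) : 𝕜) * ((Real.cos (ω * s) : 𝕜) * f s) +
      -((ω : 𝕜) * (Real.sin (ω * s) : 𝕜)) * q s) volume 0 t :=
    (iq.continuousOn_mul hcos).add ((hωc.mul hsin).neg.mul hq).intervalIntegrable
  have i4 : IntervalIntegrable (fun s => (Real.sin (ω * s) : 𝕜) * ((Real.cos (ω * s) : 𝕜) * f s) +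
      ((ω : 𝕜) * (Real.cos (ω * s) : 𝕜)) * q s) volume 0 t :=
    (iq.continuousOn_mul hsin).add ((hωc.mul hcos).mul hq).intervalIntegrable
  have hcs : ∀ s, (Real.cos (ω * s) : 𝕜) * (Real.cos (ω * s) : 𝕜) =
      1 - (Real.sin (ω * s) : 𝕜) * (Real.sin (ω * s) : 𝕜) := fun s => by
    rw [← RCLike.ofReal_mul, ← RCLike.ofReal_mul, ← RCLike.ofReal_one, ← RCLike.ofReal_sub]
    congr 1
    linear_combination Real.sin_sq_add_cos_sq (ω * s)
  have hmem : ∀ s ∈ uIcc 0 t, s ∈ Icc 0 t := fun s hs => by rwa [uIcc_of_le ht] at hs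
  constructor
  · rw [ha t ⟨ht, le_rfl⟩, h1, h4, ha0, add_assoc, ← intervalIntegral.integral_add i1 i4]
    congr 1
    refine intervalIntegral.integral_congr fun s hs => ?_
    rw [hv s (hmem s hs)]
    ring
  · rw [hv t ⟨ht, le_rfl⟩, h3, h2, hv0, add_sub_assoc, ← intervalIntegral.integral_sub i3 i2]
    congr 1
    refine intervalIntegral.integral_congr fun s hs => ?_
    rw [ha s (hmem s hs)]
    linear_combination f s * hcs s

end

end Calculus

/-! ### Strong convergence of diagonal operators. -/

section DiagonalLimits

variable {𝕜 : Type*} [RCLike 𝕜]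
variable {H : Type*} [NormedAddCommGroup H] [InnerProductSpace 𝕜 H]
variable {ι : Type*}

/-- Uniformly bounded multipliers that converge pointwise converge strongly. -/
theorem tendsto_diag_apply {β : Type*} {l : Filter β} [l.IsCountablyGenerated]
    (b : HilbertBasis ι 𝕜 H) {m : β → ι → ℝ}
    {m₀ : ι → ℝ} {C : ℝ} (hm : ∀ s i, |m s i| ≤ C) (hm₀ : ∀ i, |m₀ i| ≤ C)
    (h : ∀ i, Tendsto (fun s => m s i) l (𝓝 (m₀ i))) (x : H) :
    Tendsto (fun s => diag b (m s) x) l (𝓝 (diag b m₀ x)) := by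
  rw [tendsto_iff_norm_sub_tendsto_zero]
  have h1 : ∀ s, ‖diag b (m s) x - diag b m₀ x‖ ^ 2 =
      ∑' i, (m s i - m₀ i) ^ 2 * ‖b.repr x i‖ ^ 2 := fun s => by
    rw [← (hasSum_repr_sq b _).tsum_eq]
    refine tsum_congr fun i => ?_
    rw [map_sub, lp.coeFn_sub, Pi.sub_apply, repr_diag b (hm s), repr_diag b hm₀, ← sub_mul,
      norm_mul, ← RCLike.ofReal_sub, RCLike.norm_ofReal, mul_pow, sq_abs]
  have h2 : Tendsto (fun s => ‖diag b (m s) x - diag b m₀ x‖ ^ 2) l (𝓝 0) := by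
    simp only [h1]
    have : (0 : ℝ) = ∑' i : ι, (0 : ℝ) := by simp
    rw [this]
    refine tendsto_tsum_of_dominated_convergence
      (bound := fun i => (2 * C) ^ 2 * ‖b.repr x i‖ ^ 2)
      ((hasSum_repr_sq b x).summable.mul_left _) (fun i => ?_) (Eventually.of_forall fun s i => ?_)
    · have := ((h i).sub_const (m₀ i)).pow 2 |>.mul_const (‖b.repr x i‖ ^ 2)
      simpa using this
    · rw [Real.norm_of_nonneg (by positivity)]
      have h3 := abs_sub (m s i) (m₀ i)
      have h4 : |m s i - m₀ i| ≤ 2 * C := by linarith [hm s i, hm₀ i]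
      have h5 := sq_le_sq' (by linarith [abs_nonneg (m s i - m₀ i), neg_abs_le (m s i - m₀ i)])
        ((le_abs_self _).trans h4)
      gcongr
  have h3 := (Real.continuous_sqrt.tendsto 0).comp h2
  simpa [Function.comp_def, Real.sqrt_sq (norm_nonneg _)] using h3

end DiagonalLimits

/-! ### The energy space H × H and the isometry group of the free equation. -/

namespace SpectralData

variable {𝕜 : Type*} [RCLike 𝕜]
variable {H : Type*} [NormedAddCommGroup H] [InnerProductSpace 𝕜 H] [CompleteSpace H]
variable {A : H →ₗ.[𝕜] H} {ι : Type*} (D : SpectralData A ι)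

/-- The frequencies, square roots of the eigenvalues. -/
def om (i : ι) : ℝ := √(D.μ i)

theorem om_pos (i : ι) : 0 < D.om i := Real.sqrt_pos.2 (D.μ_pos i)

theorem om_sq (i : ι) : D.om i ^ 2 = D.μ i := Real.sq_sqrt (D.μ_pos i).le

/-- The bounded operator `A^{-1/2}`. -/
def lam : H →L[𝕜] H := diag D.b fun i => (D.om i)⁻¹

theorem abs_inv_om_le (i : ι) : |(D.om i)⁻¹| ≤ (√D.low)⁻¹ := by
  rw [abs_of_pos (inv_pos.2 (D.om_pos i))]
  exact inv_anti₀ (Real.sqrt_pos.2 D.low_pos) (Real.sqrt_le_sqrt (D.low_le i))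

theorem repr_lam (x : H) (i : ι) : D.b.repr (D.lam x) i = ((D.om i)⁻¹ : ℝ) * D.b.repr x i :=
  repr_diag _ D.abs_inv_om_le x i

/-- The bounded operator `A^{-1}`. -/
def inv : H →L[𝕜] H := diag D.b fun i => (D.μ i)⁻¹

theorem abs_inv_μ_le (i : ι) : |(D.μ i)⁻¹| ≤ D.low⁻¹ := by
  rw [abs_of_pos (inv_pos.2 (D.μ_pos i))]
  exact inv_anti₀ D.low_pos (D.low_le i)

theorem repr_inv (x : H) (i : ι) : D.b.repr (D.inv x) i = ((D.μ i)⁻¹ : ℝ) * D.b.repr x i :=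
  repr_diag _ D.abs_inv_μ_le x i

theorem lam_lam (x : H) : D.lam (D.lam x) = D.inv x := by
  refine repr_ext D.b fun i => ?_
  rw [repr_lam, repr_lam, repr_inv, ← mul_assoc, ← RCLike.ofReal_mul, ← mul_inv, ← sq, om_sq]

theorem memPow_one_iff {u : H} : MemPow A 1 u ↔
    ∑' i, ENNReal.ofReal (‖(D.om i : 𝕜) * D.b.repr u i‖ ^ 2) ≠ ∞ := by
  rw [MemPow, D.powNormSq_eq]
  simp only [norm_mul, RCLike.norm_ofReal, mul_pow, sq_abs, om_sq, Nat.cast_one, zpow_one]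

open Classical in
/-- The vector `A^{1/2} u` for `u ∈ H_1` (zero for other `u`). -/
def root (u : H) : H :=
  if h : MemPow A 1 u then (exists_repr_eq D.b _ (D.memPow_one_iff.1 h)).choose else 0

variable {D}

theorem repr_root {u : H} (h : MemPow A 1 u) (i : ι) :
    D.b.repr (D.root u) i = (D.om i : 𝕜) * D.b.repr u i := by
  rw [root, dif_pos h]
  exact (exists_repr_eq D.b _ (D.memPow_one_iff.1 h)).choose_spec i

theorem lam_root {u : H} (h : MemPow A 1 u) : D.lam (D.root u) = u := by
  refine repr_ext D.b fun i => ?_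
  rw [repr_lam, repr_root h, ← mul_assoc, ← RCLike.ofReal_mul,
    inv_mul_cancel₀ (D.om_pos i).ne', RCLike.ofReal_one, one_mul]

theorem om_mul_repr_lam (x : H) (i : ι) :
    (D.om i : 𝕜) * D.b.repr (D.lam x) i = D.b.repr x i := by
  rw [repr_lam, ← mul_assoc, ← RCLike.ofReal_mul, mul_inv_cancel₀ (D.om_pos i).ne',
    RCLike.ofReal_one, one_mul]

variable (D) in
theorem memPow_lam (x : H) : MemPow A 1 (D.lam x) := by
  rw [D.memPow_one_iff]
  simp only [om_mul_repr_lam, tsum_repr_sq]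
  exact ENNReal.ofReal_ne_top

theorem root_lam (x : H) : D.root (D.lam x) = x := by
  refine repr_ext D.b fun i => ?_
  rw [repr_root (D.memPow_lam x), om_mul_repr_lam]

theorem powNormSq_lam (x : H) : powNormSq A 1 (D.lam x) = ENNReal.ofReal (‖x‖ ^ 2) := by
  rw [D.powNormSq_eq, ← tsum_repr_sq D.b]
  refine tsum_congr fun i => ?_
  rw [← om_mul_repr_lam (D := D) x i, norm_mul, RCLike.norm_ofReal, mul_pow, sq_abs, om_sq,
    zpow_one]

theorem powNormSq_one {u : H} (h : MemPow A 1 u) :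
    powNormSq A 1 u = ENNReal.ofReal (‖D.root u‖ ^ 2) := by
  rw [← powNormSq_lam (D := D), lam_root h]

variable (D) in
include D in
theorem powNormSq_zero (u : H) : powNormSq A 0 u = ENNReal.ofReal (‖u‖ ^ 2) := by
  rw [D.powNormSq_eq, ← tsum_repr_sq D.b]
  simp

variable (D) in
include D in
theorem memPow_sub {u v : H} (hu : MemPow A 1 u) (hv : MemPow A 1 v) : MemPow A 1 (u - v) := by
  rw [← lam_root (D := D) hu, ← lam_root (D := D) hv, ← map_sub]
  exact D.memPow_lam _

theorem root_sub {u v : H} (hu : MemPow A 1 u) (hv : MemPow A 1 v) :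
    D.root (u - v) = D.root u - D.root v := by
  nth_rewrite 1 [← lam_root (D := D) hu, ← lam_root (D := D) hv]
  rw [← map_sub, root_lam]

theorem root_zero : D.root (0 : H) = 0 := by
  have := root_lam (D := D) 0
  rwa [map_zero] at this

theorem abs_cos_le (t : ℝ) (i : ι) : |Real.cos (D.om i * t)| ≤ 1 := Real.abs_cos_le_one _

theorem abs_sin_le (t : ℝ) (i : ι) : |Real.sin (D.om i * t)| ≤ 1 := Real.abs_sin_le_one _

variable (D) in
/-- `cos (t A^{1/2})` -/
def cosOp (t : ℝ) : H →L[𝕜] H := diag D.b fun i => Real.cos (D.om i * t)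

variable (D) in
/-- `sin (t A^{1/2})` -/
def sinOp (t : ℝ) : H →L[𝕜] H := diag D.b fun i => Real.sin (D.om i * t)

theorem repr_cosOp (t : ℝ) (x : H) (i : ι) :
    D.b.repr (D.cosOp t x) i = (Real.cos (D.om i * t) : 𝕜) * D.b.repr x i :=
  repr_diag _ (abs_cos_le t) x i

theorem repr_sinOp (t : ℝ) (x : H) (i : ι) :
    D.b.repr (D.sinOp t x) i = (Real.sin (D.om i * t) : 𝕜) * D.b.repr x i :=
  repr_diag _ (abs_sin_le t) x i

theorem continuous_cosOp_apply (x : H) : Continuous fun t => D.cosOp t x :=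
  continuous_iff_continuousAt.2 fun t₀ => tendsto_diag_apply D.b (fun t i => abs_cos_le t i)
    (fun i => abs_cos_le t₀ i) (fun i => (by fun_prop : Continuous fun t =>
      Real.cos (D.om i * t)).tendsto t₀) x

theorem continuous_sinOp_apply (x : H) : Continuous fun t => D.sinOp t x :=
  continuous_iff_continuousAt.2 fun t₀ => tendsto_diag_apply D.b (fun t i => abs_sin_le t i)
    (fun i => abs_sin_le t₀ i) (fun i => (by fun_prop : Continuous fun t =>
      Real.sin (D.om i * t)).tendsto t₀) x

/-- The rotation `(a, v) ↦ (cos a - sin v, sin a + cos v)`, which undoes the free evolution of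
`(A^{1/2} w, w')`. -/
def rotLin (D : SpectralData A ι) (t : ℝ) : WithLp 2 (H × H) →ₗ[𝕜] WithLp 2 (H × H) where
  toFun x := WithLp.toLp 2 (D.cosOp t x.fst - D.sinOp t x.snd, D.sinOp t x.fst + D.cosOp t x.snd)
  map_add' x y := by
    apply WithLp.ofLp_injective
    ext <;> simp <;> abel
  map_smul' c x := by
    apply WithLp.ofLp_injective
    ext <;> simp [smul_sub]

theorem norm_rotLin (t : ℝ) (x : WithLp 2 (H × H)) : ‖D.rotLin t x‖ = ‖x‖ := by
  rw [← sq_eq_sq₀ (norm_nonneg _) (norm_nonneg _), WithLp.prod_norm_sq_eq_of_L2,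
    WithLp.prod_norm_sq_eq_of_L2]
  refine ((hasSum_repr_sq D.b _).add (hasSum_repr_sq D.b _)).unique ?_
  convert (hasSum_repr_sq D.b x.fst).add (hasSum_repr_sq D.b x.snd) using 2 with i
  simp only [rotLin, LinearMap.coe_mk, AddHom.coe_mk, WithLp.fst, WithLp.snd, map_sub, map_add,
    lp.coeFn_sub, lp.coeFn_add, Pi.sub_apply, Pi.add_apply, repr_cosOp, repr_sinOp]
  set a := D.b.repr x.ofLp.1 i
  set v := D.b.repr x.ofLp.2 i
  have h := Real.sin_sq_add_cos_sq (D.om i * t)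
  set s := Real.sin (D.om i * t)
  set c := Real.cos (D.om i * t)
  simp only [RCLike.norm_sq_eq_def, map_add, map_sub, RCLike.re_ofReal_mul, RCLike.im_ofReal_mul]
  linear_combination (RCLike.re a ^ 2 + RCLike.im a ^ 2 + RCLike.re v ^ 2 + RCLike.im v ^ 2) * h

/-- The rotation `rotLin` as an isometry. -/
def rot (D : SpectralData A ι) (t : ℝ) : WithLp 2 (H × H) →ₗᵢ[𝕜] WithLp 2 (H × H) :=
  ⟨D.rotLin t, norm_rotLin t⟩

theorem rot_fst (t : ℝ) (x : WithLp 2 (H × H)) :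
    (D.rot t x).fst = D.cosOp t x.fst - D.sinOp t x.snd := rfl

theorem rot_snd (t : ℝ) (x : WithLp 2 (H × H)) :
    (D.rot t x).snd = D.sinOp t x.fst + D.cosOp t x.snd := rfl

theorem state_ext {x y : WithLp 2 (H × H)} (h1 : ∀ i, D.b.repr x.fst i = D.b.repr y.fst i)
    (h2 : ∀ i, D.b.repr x.snd i = D.b.repr y.snd i) : x = y := by
  apply WithLp.ofLp_injective
  exact Prod.ext (repr_ext D.b h1) (repr_ext D.b h2)

theorem repr_rot_fst (t : ℝ) (x : WithLp 2 (H × H)) (i : ι) : D.b.repr (D.rot t x).fst i =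
    (Real.cos (D.om i * t) : 𝕜) * D.b.repr x.fst i -
      (Real.sin (D.om i * t) : 𝕜) * D.b.repr x.snd i := by
  rw [rot_fst, map_sub, lp.coeFn_sub, Pi.sub_apply, repr_cosOp, repr_sinOp]

theorem repr_rot_snd (t : ℝ) (x : WithLp 2 (H × H)) (i : ι) : D.b.repr (D.rot t x).snd i =
    (Real.sin (D.om i * t) : 𝕜) * D.b.repr x.fst i +
      (Real.cos (D.om i * t) : 𝕜) * D.b.repr x.snd i := by
  rw [rot_snd, map_add, lp.coeFn_add, Pi.add_apply, repr_cosOp, repr_sinOp]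

theorem rot_rot (s t : ℝ) (x : WithLp 2 (H × H)) : D.rot s (D.rot t x) = D.rot (s + t) x := by
  refine state_ext (D := D) (fun i => ?_) (fun i => ?_)
  · simp only [repr_rot_fst, repr_rot_snd, mul_add, Real.cos_add, Real.sin_add,
      RCLike.ofReal_add, RCLike.ofReal_sub, RCLike.ofReal_mul]
    ring
  · simp only [repr_rot_fst, repr_rot_snd, mul_add, Real.cos_add, Real.sin_add,
      RCLike.ofReal_add, RCLike.ofReal_sub, RCLike.ofReal_mul]
    ring

theorem rot_zero (x : WithLp 2 (H × H)) : D.rot 0 x = x := by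
  refine state_ext (D := D) (fun i => ?_) (fun i => ?_)
  · simp [repr_rot_fst]
  · simp [repr_rot_snd]

theorem rot_neg_rot (t : ℝ) (x : WithLp 2 (H × H)) : D.rot (-t) (D.rot t x) = x := by
  rw [rot_rot, neg_add_cancel, rot_zero]

theorem rot_rot_neg (t : ℝ) (x : WithLp 2 (H × H)) : D.rot t (D.rot (-t) x) = x := by
  rw [rot_rot, add_neg_cancel, rot_zero]

theorem continuous_rot_apply (x : WithLp 2 (H × H)) : Continuous fun t => D.rot t x :=
  (WithLp.prod_continuous_toLp 2 H H).comp
    (((continuous_cosOp_apply _).sub (continuous_sinOp_apply _)).prodMk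
      ((continuous_sinOp_apply _).add (continuous_cosOp_apply _)))

/-- Strong continuity in t becomes joint continuity because every rotation is an isometry. -/
theorem continuous_rot : Continuous fun p : ℝ × WithLp 2 (H × H) => D.rot p.1 p.2 := by
  refine continuous_iff_continuousAt.2 fun p₀ => ?_
  rw [ContinuousAt, tendsto_iff_norm_sub_tendsto_zero]
  have h1 : Tendsto (fun p : ℝ × WithLp 2 (H × H) => ‖p.2 - p₀.2‖ +
      ‖D.rot p.1 p₀.2 - D.rot p₀.1 p₀.2‖) (𝓝 p₀) (𝓝 0) := by
    have c : Continuous fun p : ℝ × WithLp 2 (H × H) => ‖p.2 - p₀.2‖ +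
      ‖D.rot p.1 p₀.2 - D.rot p₀.1 p₀.2‖ := by
      have := (continuous_rot_apply (D := D) p₀.2).comp
        (continuous_fst (X := ℝ) (Y := WithLp 2 (H × H)))
      simp only [Function.comp_def] at this
      fun_prop
    simpa using c.tendsto p₀
  refine squeeze_zero (fun _ => norm_nonneg _) (fun p => ?_) h1
  calc ‖D.rot p.1 p.2 - D.rot p₀.1 p₀.2‖
      = ‖D.rot p.1 (p.2 - p₀.2) + (D.rot p.1 p₀.2 - D.rot p₀.1 p₀.2)‖ := by
        rw [map_sub]; congr 1; abel
    _ ≤ _ := by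
        refine (norm_add_le _ _).trans ?_
        rw [LinearIsometry.norm_map]

/-- The state `(A^{1/2} w, v)` of the energy space `H × H`. -/
def st (D : SpectralData A ι) (w v : H) : WithLp 2 (H × H) := WithLp.toLp 2 (D.root w, v)

/-- The state `(0, x)`. -/
def inj (x : H) : WithLp 2 (H × H) := WithLp.toLp 2 (0, x)

theorem norm_inj (x : H) : ‖(inj x : WithLp 2 (H × H))‖ = ‖x‖ := by
  rw [← sq_eq_sq₀ (norm_nonneg _) (norm_nonneg _), WithLp.prod_norm_sq_eq_of_L2]
  simp [inj]

theorem inj_sub (x y : H) : (inj (x - y) : WithLp 2 (H × H)) = inj x - inj y := by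
  apply WithLp.ofLp_injective
  ext <;> simp [inj]

theorem continuous_inj : Continuous (inj : H → WithLp 2 (H × H)) :=
  (WithLp.prod_continuous_toLp 2 H H).comp (continuous_const.prodMk continuous_id)

theorem norm_st_sq (w v : H) : ‖D.st w v‖ ^ 2 = ‖D.root w‖ ^ 2 + ‖v‖ ^ 2 :=
  WithLp.prod_norm_sq_eq_of_L2 _

theorem norm_snd_le (x : WithLp 2 (H × H)) : ‖x.snd‖ ≤ ‖x‖ := by
  refine abs_le_of_sq_le_sq' ?_ (norm_nonneg _) |>.2
  rw [WithLp.prod_norm_sq_eq_of_L2 x]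
  linarith [sq_nonneg ‖x.fst‖]

theorem energy_one {w v : H} (hw : MemPow A 1 w) :
    energy A 1 w v = ENNReal.ofReal (‖D.st w v‖ ^ 2 / 2) := by
  rw [energy, powNormSq_one (D := D) hw, sub_self, D.powNormSq_zero, ← ENNReal.ofReal_add
    (sq_nonneg _) (sq_nonneg _), norm_st_sq, ENNReal.ofReal_div_of_pos (by norm_num)]
  simp

section Mild

variable [NormedSpace ℝ H]

/-- `X` is the mild solution of the first order form of `w'' + A w = f`. -/
def IsMild (D : SpectralData A ι) (T : ℝ) (f : ℝ → H) (X : ℝ → WithLp 2 (H × H)) : Prop :=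
  ∀ t ∈ Icc 0 T, D.rot t (X t) = X 0 + ∫ s in (0 : ℝ)..t, D.rot s (inj (f s))

theorem integrable_rot_inj {m : Measure ℝ} {f : ℝ → H} (hf : Integrable f m) :
    Integrable (fun s => D.rot s (inj (f s))) m := by
  have h1 : AEStronglyMeasurable (fun s => (inj (f s) : WithLp 2 (H × H))) m :=
    continuous_inj.comp_aestronglyMeasurable hf.1
  have h2 : AEStronglyMeasurable (fun s : ℝ => s) m := aestronglyMeasurable_id
  have h3 := (continuous_rot (D := D)).comp_aestronglyMeasurable (h2.prodMk h1)
  refine Integrable.mono hf h3 (Eventually.of_forall fun s => ?_)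
  rw [LinearIsometry.norm_map, norm_inj]

theorem intervalIntegrable_rot_inj {s t : ℝ} {f : ℝ → H} (hf : IntervalIntegrable f volume s t) :
    IntervalIntegrable (fun s => D.rot s (inj (f s))) volume s t :=
  ⟨integrable_rot_inj hf.1, integrable_rot_inj hf.2⟩

/-- A coordinate of the first component. -/
def coordFst (D : SpectralData A ι) (i : ι) : WithLp 2 (H × H) →L[𝕜] 𝕜 :=
  (innerSL 𝕜 (D.b i)).comp (WithLp.fstL 2 𝕜 H H)

/-- A coordinate of the second component. -/
def coordSnd (D : SpectralData A ι) (i : ι) : WithLp 2 (H × H) →L[𝕜] 𝕜 :=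
  (innerSL 𝕜 (D.b i)).comp (WithLp.sndL 2 𝕜 H H)

theorem coordFst_apply (i : ι) (x : WithLp 2 (H × H)) : D.coordFst i x = D.b.repr x.fst i := by
  rw [D.b.repr_apply_apply]; rfl

theorem coordSnd_apply (i : ι) (x : WithLp 2 (H × H)) : D.coordSnd i x = D.b.repr x.snd i := by
  rw [D.b.repr_apply_apply]; rfl

theorem repr_fst_integral {s t : ℝ} {g : ℝ → WithLp 2 (H × H)}
    (hg : IntervalIntegrable g volume s t) (i : ι) :
    D.b.repr (∫ r in s..t, g r).fst i = ∫ r in s..t, D.b.repr (g r).fst i := by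
  simp only [← coordFst_apply]
  exact ((D.coordFst i).intervalIntegral_comp_comm hg).symm

theorem repr_snd_integral {s t : ℝ} {g : ℝ → WithLp 2 (H × H)}
    (hg : IntervalIntegrable g volume s t) (i : ι) :
    D.b.repr (∫ r in s..t, g r).snd i = ∫ r in s..t, D.b.repr (g r).snd i := by
  simp only [← coordSnd_apply]
  exact ((D.coordSnd i).intervalIntegral_comp_comm hg).symm

theorem repr_integral {s t : ℝ} {g : ℝ → H} (hg : IntervalIntegrable g volume s t) (i : ι) :
    D.b.repr (∫ r in s..t, g r) i = ∫ r in s..t, D.b.repr (g r) i := by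
  simp only [D.b.repr_apply_apply]
  exact ((innerSL 𝕜 (D.b i)).intervalIntegral_comp_comm hg).symm

end Mild

end SpectralData

/-! ### Equivalence of weak and mild solutions. -/

namespace SpectralData

variable {𝕜 : Type*} [RCLike 𝕜]
variable {H : Type*} [NormedAddCommGroup H] [InnerProductSpace 𝕜 H] [CompleteSpace H]
variable [NormedSpace ℝ H]
variable {A : H →ₗ.[𝕜] H} {ι : Type*} {D : SpectralData A ι}

theorem intervalIntegrable_of_mem {E : Type*} [NormedAddCommGroup E] {T : ℝ} {f : ℝ → E}
    (hf : IntegrableOn f (Icc 0 T)) {s t : ℝ} (hs : s ∈ Icc 0 T) (ht : t ∈ Icc 0 T) :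
    IntervalIntegrable f volume s t :=
  (hf.mono_set (uIcc_subset_Icc hs ht)).intervalIntegrable

variable (D) in
theorem exists_domain_eq (i : ι) : ∃ d : A.domain, (d : H) = D.b i ∧ A d = (D.μ i : 𝕜) • D.b i := by
  have : (D.b i, (D.μ i : 𝕜) • D.b i) ∈ A.graph := by
    rw [D.graph_iff]
    intro j
    rw [map_smul, lp.coeFn_smul, Pi.smul_apply, smul_eq_mul]
    by_cases hij : j = i
    · rw [hij]
    · rw [D.b.repr_apply_apply, D.b.orthonormal.2 hij, mul_zero, mul_zero]
  rw [LinearPMap.mem_graph_iff] at this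
  exact this

variable (D) in
include D in
theorem inner_graph {u g u' g' : H} (h : (u, g) ∈ A.graph) (h' : (u', g') ∈ A.graph) :
    inner 𝕜 g u' = inner 𝕜 u g' := by
  rw [D.graph_iff] at h h'
  refine (hasSum_repr_inner D.b _ _).unique ?_
  convert hasSum_repr_inner D.b u g' using 2 with i
  rw [h, h']
  simp only [RCLike.inner_apply, map_mul, RCLike.conj_ofReal]
  ring

theorem repr_rot_inj_fst (s : ℝ) (x : H) (i : ι) :
    D.b.repr (D.rot s (inj x)).fst i = -((Real.sin (D.om i * s) : 𝕜) * D.b.repr x i) := by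
  rw [repr_rot_fst]
  simp [inj]

theorem repr_rot_inj_snd (s : ℝ) (x : H) (i : ι) :
    D.b.repr (D.rot s (inj x)).snd i = (Real.cos (D.om i * s) : 𝕜) * D.b.repr x i := by
  rw [repr_rot_snd]
  simp [inj]

theorem repr_add (x y : H) (i : ι) : D.b.repr (x + y) i = D.b.repr x i + D.b.repr y i := by
  rw [map_add, lp.coeFn_add, Pi.add_apply]

theorem repr_sub (x y : H) (i : ι) : D.b.repr (x - y) i = D.b.repr x i - D.b.repr y i := by
  rw [map_sub, lp.coeFn_sub, Pi.sub_apply]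

theorem repr_neg (x : H) (i : ι) : D.b.repr (-x) i = -D.b.repr x i := by
  rw [map_neg, lp.coeFn_neg, Pi.neg_apply]

theorem continuous_repr (i : ι) : Continuous fun x => D.b.repr x i := by
  simp only [D.b.repr_apply_apply]
  exact (innerSL 𝕜 (D.b i)).continuous

theorem intervalIntegrable_repr {s t : ℝ} {f : ℝ → H} (hf : IntervalIntegrable f volume s t)
    (i : ι) : IntervalIntegrable (fun r => D.b.repr (f r) i) volume s t := by
  simp only [D.b.repr_apply_apply]
  exact ⟨(innerSL 𝕜 (D.b i)).integrable_comp hf.1, (innerSL 𝕜 (D.b i)).integrable_comp hf.2⟩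

/-- Tested against an eigenvector, the weak equation is a scalar oscillator for the coordinates of
A^{1/2} w and of v. `oscillator_rotate` solves it, and the coordinates determine the state. -/
theorem isMild_of_isSolution {T : ℝ} {f w v : ℝ → H} (hf : IntegrableOn f (Icc 0 T))
    (h : IsSolution A T f w v) : IsMild D T f fun t => D.st (w t) (v t) := by
  intro t ht
  have h0 : (0 : ℝ) ∈ Icc 0 T := ⟨le_rfl, ht.1.trans ht.2⟩
  have hft := intervalIntegrable_of_mem hf h0 ht
  have hsub : Icc 0 t ⊆ Icc 0 T := Icc_subset_Icc_right ht.2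
  have key : ∀ i, _ := fun i => oscillator_rotate (ω := D.om i) (t := t)
    (a := fun s => (D.om i : 𝕜) * D.b.repr (w s) i) (v := fun s => D.b.repr (v s) i)
    (f := fun s => D.b.repr (f s) i) ht.1 ?_ ?_ ?_ ?_ ?_
  · have hint := intervalIntegrable_rot_inj (D := D) hft
    refine state_ext (D := D) (fun i => ?_) (fun i => ?_)
    · rw [repr_rot_fst, WithLp.add_fst, repr_add, repr_fst_integral hint]
      simp only [repr_rot_inj_fst, intervalIntegral.integral_neg]
      rw [← sub_eq_add_neg, st, st]
      simp only [repr_root (h.mem t ht), repr_root (h.mem 0 h0), WithLp.toLp_fst, WithLp.toLp_snd]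
      exact (key i).1
    · rw [repr_rot_snd, WithLp.add_snd, repr_add, repr_snd_integral hint]
      simp only [repr_rot_inj_snd]
      rw [st, st]
      simp only [repr_root (h.mem t ht), WithLp.toLp_fst, WithLp.toLp_snd]
      exact (key i).2
  · refine continuousOn_const.mul ((continuous_repr i).comp_continuousOn fun s hs => ?_)
    exact (h.deriv s (hsub hs)).continuousWithinAt.mono hsub
  · exact (continuous_repr i).comp_continuousOn (h.cont_deriv.mono hsub)
  · exact intervalIntegrable_repr hft i
  · intro s hs
    have hs' := hsub hs
    have h1 := eq_integral_of_hasDerivWithinAt h.cont_deriv h.deriv hs'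
    have h2 : IntervalIntegrable v volume 0 s :=
      (h.cont_deriv.mono (Icc_subset_Icc_right hs'.2)).intervalIntegrable_of_Icc hs.1
    rw [h1, repr_add, repr_integral h2, mul_add, intervalIntegral.integral_const_mul]
  · intro s hs
    obtain ⟨d, hd, hd'⟩ := D.exists_domain_eq i
    have h1 := h.weak d s (hsub hs)
    rw [hd, hd'] at h1
    simp only [D.b.repr_apply_apply]
    rw [h1]
    congr 1
    refine intervalIntegral.integral_congr fun r _ => ?_
    simp only [inner_smul_left, RCLike.conj_ofReal]
    rw [← mul_assoc, ← RCLike.ofReal_mul, ← sq, om_sq]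

theorem IsMild.eq {T : ℝ} {f : ℝ → H} {X : ℝ → WithLp 2 (H × H)} (h : IsMild D T f X) {t : ℝ}
    (ht : t ∈ Icc 0 T) :
    X t = D.rot (-t) (X 0 + ∫ s in (0 : ℝ)..t, D.rot s (inj (f s))) := by
  rw [← h t ht, rot_neg_rot]

theorem continuousOn_primitive {T : ℝ} {f : ℝ → H} (hf : IntegrableOn f (Icc 0 T)) :
    ContinuousOn (fun t => ∫ s in (0 : ℝ)..t, D.rot s (inj (f s))) (Icc 0 T) := by
  rcases le_or_gt 0 T with hT | hT
  · rw [← uIcc_of_le hT]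
    refine intervalIntegral.continuousOn_primitive_interval' (b₁ := 0) (b₂ := T) ?_ (by simp)
    exact intervalIntegrable_rot_inj (intervalIntegrable_of_mem hf ⟨le_rfl, hT⟩ ⟨hT, le_rfl⟩)
  · rw [Icc_eq_empty (not_le.2 hT)]
    exact continuousOn_empty _

theorem IsMild.continuousOn {T : ℝ} {f : ℝ → H} {X : ℝ → WithLp 2 (H × H)} (h : IsMild D T f X)
    (hf : IntegrableOn f (Icc 0 T)) : ContinuousOn X (Icc 0 T) := by
  have h1 : ContinuousOn (fun t => (-t, X 0 + ∫ s in (0 : ℝ)..t, D.rot s (inj (f s)))) (Icc 0 T) :=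
    continuousOn_id.neg.prodMk (continuousOn_const.add (continuousOn_primitive hf))
  exact ((continuous_rot (D := D)).comp_continuousOn h1).congr fun t ht => h.eq ht

theorem continuous_fst : Continuous fun x : WithLp 2 (H × H) => x.fst :=
  _root_.continuous_fst.comp (WithLp.prod_continuous_ofLp 2 H H)

theorem continuous_snd : Continuous fun x : WithLp 2 (H × H) => x.snd :=
  _root_.continuous_snd.comp (WithLp.prod_continuous_ofLp 2 H H)

theorem tendsto_powNormSq_lam {β : Type*} {l : Filter β} {x : β → H} {y : H}
    (h : Tendsto x l (𝓝 y)) : Tendsto (fun t => powNormSq A 1 (D.lam (x t) - D.lam y)) l (𝓝 0) := by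
  simp only [← map_sub, powNormSq_lam]
  rw [tendsto_iff_norm_sub_tendsto_zero] at h
  have := ENNReal.tendsto_ofReal (h.pow 2)
  simpa using this

theorem continuousOn_rot {s : Set ℝ} {X : ℝ → WithLp 2 (H × H)} (hX : ContinuousOn X s) :
    ContinuousOn (fun t => D.rot t (X t)) s := by
  have h2 : ContinuousOn (fun t : ℝ => (t, X t)) s := continuousOn_id.prodMk hX
  have h3 := (continuous_rot (D := D)).comp_continuousOn h2
  exact h3

theorem isSolution_of_isMild {T : ℝ} {f : ℝ → H} {X : ℝ → WithLp 2 (H × H)}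
    (hf : IntegrableOn f (Icc 0 T)) (h : IsMild D T f X) :
    IsSolution A T f (fun t => D.lam (X t).fst) (fun t => (X t).snd) := by
  have hX := h.continuousOn hf
  have hX1 : ContinuousOn (fun t => (X t).fst) (Icc 0 T) := continuous_fst.comp_continuousOn hX
  have hX2 : ContinuousOn (fun t => (X t).snd) (Icc 0 T) := continuous_snd.comp_continuousOn hX
  have hXl : ContinuousOn (fun t => D.lam (X t).fst) (Icc 0 T) :=
    D.lam.continuous.comp_continuousOn hX1
  -- Undoing the rotation in each mode gives back the first order system for the coordinates.
  have key : ∀ t ∈ Icc 0 T, ∀ i,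
      D.b.repr (X t).fst i = D.b.repr (X 0).fst i +
        ∫ s in (0 : ℝ)..t, (D.om i : 𝕜) * D.b.repr (X s).snd i ∧
      D.b.repr (X t).snd i = D.b.repr (X 0).snd i +
        ∫ s in (0 : ℝ)..t, (D.b.repr (f s) i - (D.om i : 𝕜) * D.b.repr (X s).fst i) := by
    intro t ht i
    have h0 : (0 : ℝ) ∈ Icc 0 T := ⟨le_rfl, ht.1.trans ht.2⟩
    have hsub : Icc 0 t ⊆ Icc 0 T := Icc_subset_Icc_right ht.2
    have hft := intervalIntegrable_of_mem hf h0 ht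
    have hYc : ContinuousOn (fun t => D.rot t (X t)) (Icc 0 t) := continuousOn_rot (hX.mono hsub)
    refine oscillator_unrotate (ω := D.om i) (a := fun s => D.b.repr (X s).fst i)
      (v := fun s => D.b.repr (X s).snd i) (f := fun s => D.b.repr (f s) i)
      (p := fun s => D.b.repr (D.rot s (X s)).fst i)
      (q := fun s => D.b.repr (D.rot s (X s)).snd i) ht.1 (intervalIntegrable_repr hft i) ?_ ?_ ?_ ?_
      ?_ ?_
    · exact (continuous_repr i).comp_continuousOn (continuous_fst.comp_continuousOn hYc)
    · exact (continuous_repr i).comp_continuousOn (continuous_snd.comp_continuousOn hYc)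
    · intro s hs
      have hint := intervalIntegrable_rot_inj (D := D) (intervalIntegrable_of_mem hf h0 (hsub hs))
      simp only [rot_zero]
      rw [h s (hsub hs), WithLp.add_fst, repr_add, repr_fst_integral hint]
      simp only [repr_rot_inj_fst]
    · intro s hs
      have hint := intervalIntegrable_rot_inj (D := D) (intervalIntegrable_of_mem hf h0 (hsub hs))
      simp only [rot_zero]
      rw [h s (hsub hs), WithLp.add_snd, repr_add, repr_snd_integral hint]
      simp only [repr_rot_inj_snd]
    · intro s _
      nth_rewrite 1 [← rot_neg_rot (D := D) s (X s)]
      rw [repr_rot_fst]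
      simp
    · intro s _
      nth_rewrite 1 [← rot_neg_rot (D := D) s (X s)]
      rw [repr_rot_snd]
      simp only [mul_neg, Real.cos_neg, Real.sin_neg, RCLike.ofReal_neg]
      ring
  have hint : ∀ {g : ℝ → H}, ContinuousOn g (Icc 0 T) → ∀ t ∈ Icc 0 T,
      IntervalIntegrable g volume 0 t := fun hg t ht =>
    (hg.mono (Icc_subset_Icc_right ht.2)).intervalIntegrable_of_Icc ht.1
  refine ⟨fun t _ => D.memPow_lam _, fun s hs => tendsto_powNormSq_lam (hX1 s hs), hX2,
    fun t ht => ?_, fun φ t ht => ?_⟩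
  · refine hasDerivWithinAt_of_eq_integral hX2 (fun t ht => ?_) ht
    refine repr_ext D.b fun i => ?_
    rw [repr_add, repr_integral (hint hX2 t ht), repr_lam, repr_lam, (key t ht i).1,
      intervalIntegral.integral_const_mul, mul_add, ← mul_assoc, ← RCLike.ofReal_mul,
      inv_mul_cancel₀ (D.om_pos i).ne', RCLike.ofReal_one, one_mul]
  · have h0 : (0 : ℝ) ∈ Icc 0 T := ⟨le_rfl, ht.1.trans ht.2⟩
    have hft := intervalIntegrable_of_mem hf h0 ht
    -- The coordinates only give the equation tested against eigenvectors. For a general φ in D(A),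
    -- one uses that the time integral of w lies in D(A) and that A maps it to v(0) + ∫ f - v(t);
    -- the symmetry of A then moves A onto φ.
    have hgr : (∫ s in (0 : ℝ)..t, D.lam (X s).fst,
        (X 0).snd + (∫ s in (0 : ℝ)..t, f s) - (X t).snd) ∈ A.graph := by
      rw [D.graph_iff]
      intro i
      rw [repr_sub, repr_add, repr_integral hft, repr_integral (hint hXl t ht), (key t ht i).2,
        intervalIntegral.integral_sub (intervalIntegrable_repr hft i), ← om_sq]
      · simp only [repr_lam, intervalIntegral.integral_const_mul, RCLike.ofReal_pow,
          RCLike.ofReal_inv]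
        have := (D.om_pos i).ne'
        have : (D.om i : 𝕜) ≠ 0 := by exact_mod_cast this
        field_simp
        ring
      · exact (intervalIntegrable_repr (hint hX1 t ht) i).const_mul _
    have hφ : ((φ : H), A φ) ∈ A.graph := (LinearPMap.mem_graph_iff _).2 ⟨φ, rfl, rfl⟩
    have h1 := D.inner_graph hφ hgr
    rw [inner_sub_right, inner_add_right] at h1
    have h2 : inner 𝕜 (φ : H) (∫ s in (0 : ℝ)..t, f s) = ∫ s in (0 : ℝ)..t, inner 𝕜 (φ : H) (f s) :=
      ((innerSL 𝕜 (φ : H)).intervalIntegral_comp_comm hft).symm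
    have h3 : inner 𝕜 (A φ) (∫ s in (0 : ℝ)..t, D.lam (X s).fst) =
        ∫ s in (0 : ℝ)..t, inner 𝕜 (A φ) (D.lam (X s).fst) :=
      ((innerSL 𝕜 (A φ)).intervalIntegral_comp_comm (hint hXl t ht)).symm
    rw [intervalIntegral.integral_sub, ← h2, ← h3, h1]
    · ring
    · exact ⟨(innerSL 𝕜 (φ : H)).integrable_comp hft.1, (innerSL 𝕜 (φ : H)).integrable_comp hft.2⟩
    · have := hint hXl t ht
      exact ⟨(innerSL 𝕜 (A φ)).integrable_comp this.1, (innerSL 𝕜 (A φ)).integrable_comp this.2⟩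

theorem _root_.Cascade.IsSolution.congr {T : ℝ} {f w v f' w' v' : ℝ → H}
    (h : IsSolution A T f w v) (hf : EqOn f f' (Icc 0 T)) (hw : EqOn w w' (Icc 0 T))
    (hv : EqOn v v' (Icc 0 T)) : IsSolution A T f' w' v' where
  mem t ht := hw ht ▸ h.mem t ht
  cont s hs := by
    refine (h.cont s hs).congr' ?_
    filter_upwards [self_mem_nhdsWithin] with t ht
    rw [hw ht, hw hs]
  cont_deriv := h.cont_deriv.congr hv.symm
  deriv t ht := by
    rw [← hv ht]
    exact (h.deriv t ht).congr_of_mem hw.symm ht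
  weak φ t ht := by
    have h0 : (0 : ℝ) ∈ Icc 0 T := ⟨le_rfl, ht.1.trans ht.2⟩
    rw [← hv ht, ← hv h0, h.weak φ t ht]
    congr 1
    refine intervalIntegral.integral_congr fun s hs => ?_
    have hs' := uIcc_subset_Icc h0 ht hs
    simp only [hf hs', hw hs']

theorem isSolution_iff {T : ℝ} {f w v : ℝ → H} (hf : IntegrableOn f (Icc 0 T)) :
    IsSolution A T f w v ↔ (∀ t ∈ Icc 0 T, MemPow A 1 (w t)) ∧
      IsMild D T f fun t => D.st (w t) (v t) := by
  refine ⟨fun h => ⟨h.mem, isMild_of_isSolution hf h⟩, fun h => ?_⟩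
  refine (isSolution_of_isMild hf h.2).congr (fun _ _ => rfl) (fun t ht => ?_) (fun _ _ => rfl)
  exact lam_root (h.1 t ht)

end SpectralData

/-! ### Differences, time shifts and energy identities of mild solutions. -/

namespace SpectralData

variable {𝕜 : Type*} [RCLike 𝕜]
variable {H : Type*} [NormedAddCommGroup H] [InnerProductSpace 𝕜 H] [CompleteSpace H]
variable [NormedSpace ℝ H]
variable {A : H →ₗ.[𝕜] H} {ι : Type*} {D : SpectralData A ι}

theorem inj_zero : (inj (0 : H) : WithLp 2 (H × H)) = 0 := by
  apply WithLp.ofLp_injective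
  ext <;> simp [inj]

variable {T : ℝ} {f g : ℝ → H} {X Y : ℝ → WithLp 2 (H × H)}

theorem IsMild.sub (hf : IntegrableOn f (Icc 0 T)) (hg : IntegrableOn g (Icc 0 T))
    (hX : IsMild D T f X) (hY : IsMild D T g Y) :
    IsMild D T (fun t => f t - g t) (fun t => X t - Y t) := by
  intro t ht
  have h0 : (0 : ℝ) ∈ Icc 0 T := ⟨le_rfl, ht.1.trans ht.2⟩
  simp only [inj_sub, map_sub]
  rw [intervalIntegral.integral_sub, hX t ht, hY t ht]
  · abel
  · exact intervalIntegrable_rot_inj (intervalIntegrable_of_mem hf h0 ht)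
  · exact intervalIntegrable_rot_inj (intervalIntegrable_of_mem hg h0 ht)

theorem IsMild.congr (hX : IsMild D T f X) (hf : EqOn f g (Icc 0 T)) (h : EqOn X Y (Icc 0 T)) :
    IsMild D T g Y := by
  intro t ht
  have h0 : (0 : ℝ) ∈ Icc 0 T := ⟨le_rfl, ht.1.trans ht.2⟩
  rw [← h ht, ← h h0, hX t ht]
  congr 1
  refine intervalIntegral.integral_congr fun s hs => ?_
  rw [hf (uIcc_subset_Icc h0 ht hs)]

theorem IsMild.increment (hf : IntegrableOn f (Icc 0 T)) (hX : IsMild D T f X) {s t : ℝ}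
    (hs : s ∈ Icc 0 T) (ht : t ∈ Icc 0 T) :
    D.rot t (X t) = D.rot s (X s) + ∫ r in s..t, D.rot r (inj (f r)) := by
  have h0 : (0 : ℝ) ∈ Icc 0 T := ⟨le_rfl, ht.1.trans ht.2⟩
  rw [hX t ht, hX s hs, add_assoc, intervalIntegral.integral_add_adjacent_intervals]
  · exact intervalIntegrable_rot_inj (intervalIntegrable_of_mem hf h0 hs)
  · exact intervalIntegrable_rot_inj (intervalIntegrable_of_mem hf hs ht)

theorem IsMild.norm_rot_sub_le (hf : IntegrableOn f (Icc 0 T)) (hX : IsMild D T f X) {s t : ℝ}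
    (hs : s ∈ Icc 0 T) (ht : t ∈ Icc 0 T) (hst : s ≤ t) :
    ‖D.rot t (X t) - D.rot s (X s)‖ ≤ ∫ r in s..t, ‖f r‖ := by
  rw [hX.increment hf hs ht, add_sub_cancel_left]
  refine (intervalIntegral.norm_integral_le_integral_norm hst).trans (le_of_eq ?_)
  simp only [LinearIsometry.norm_map, norm_inj]

theorem IsMild.abs_norm_sub_le (hf : IntegrableOn f (Icc 0 T)) (hX : IsMild D T f X) {s t : ℝ}
    (hs : s ∈ Icc 0 T) (ht : t ∈ Icc 0 T) (hst : s ≤ t) :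
    |‖X t‖ - ‖X s‖| ≤ ∫ r in s..t, ‖f r‖ := by
  have h := abs_norm_sub_norm_le (D.rot t (X t)) (D.rot s (X s))
  rw [LinearIsometry.norm_map, LinearIsometry.norm_map] at h
  exact h.trans (hX.norm_rot_sub_le hf hs ht hst)

/-- Rotations preserve the norm, so only the source can change it. With a source of size O(1/T),
this is the slow variation that the summation over windows requires. -/
theorem IsMild.abs_norm_sub_le_mul (hf : IntegrableOn f (Icc 0 T)) (hX : IsMild D T f X) {c : ℝ}
    (hc : ∀ t ∈ Icc 0 T, ‖f t‖ ≤ c) {s t : ℝ}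
    (hs : s ∈ Icc 0 T) (ht : t ∈ Icc 0 T) : |‖X t‖ - ‖X s‖| ≤ c * |t - s| := by
  have key : ∀ {s t : ℝ}, s ∈ Icc 0 T → t ∈ Icc 0 T → s ≤ t → |‖X t‖ - ‖X s‖| ≤ c * |t - s| := by
    intro s t hs ht hst
    refine (hX.abs_norm_sub_le hf hs ht hst).trans ?_
    have := intervalIntegral.norm_integral_le_of_norm_le_const (a := s) (b := t) (C := c)
      (f := fun r => ‖f r‖) fun r hr => by
        rw [norm_norm]
        rw [uIoc_of_le hst] at hr
        exact hc r ⟨hs.1.trans hr.1.le, hr.2.trans ht.2⟩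
    exact (le_abs_self _).trans this
  rcases le_total s t with h | h
  · exact key hs ht h
  · rw [abs_sub_comm, abs_sub_comm t]
    exact key ht hs h

theorem integrableOn_shift {E : Type*} [NormedAddCommGroup E] {f : ℝ → E}
    (hf : IntegrableOn f (Icc 0 T)) {s L : ℝ} (hs : 0 ≤ s) (hL : s + L ≤ T) :
    IntegrableOn (fun t => f (s + t)) (Icc 0 L) := by
  have h1 : IntegrableOn f (Icc s (s + L)) := hf.mono_set (Icc_subset_Icc hs hL)
  have h2 := (measurePreserving_add_left volume s).integrableOn_comp_preimage
    (measurableEmbedding_addLeft s) (f := f) (s := Icc s (s + L))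
  rw [Function.comp_def] at h2
  have h3 : (fun t => s + t) ⁻¹' Icc s (s + L) = Icc 0 L := by
    ext t; simp
  rw [h3] at h2
  exact h2.2 h1

theorem IsMild.shift (hf : IntegrableOn f (Icc 0 T)) (hX : IsMild D T f X) {s L : ℝ} (hs : 0 ≤ s)
    (hL : s + L ≤ T) : IsMild D L (fun t => f (s + t)) (fun t => X (s + t)) := by
  intro t ht
  have hs' : s ∈ Icc 0 T := ⟨hs, by linarith [ht.1, ht.2]⟩
  have hst : s + t ∈ Icc 0 T := ⟨add_nonneg hs ht.1, by linarith [ht.2]⟩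
  have h1 := congrArg (D.rot (-s)) (hX.increment hf hs' hst)
  rw [map_add, rot_neg_rot, rot_rot, neg_add_cancel_left] at h1
  beta_reduce
  rw [h1, add_zero]
  congr 1
  have h2 : ∫ r in s..(s + t), D.rot r (inj (f r)) =
      ∫ r in (0 : ℝ)..t, D.rot (s + r) (inj (f (s + r))) := by
    rw [intervalIntegral.integral_comp_add_left (fun r => D.rot r (inj (f r))), add_zero]
  rw [h2]
  have h3 : IntegrableOn (fun t => f (s + t)) (Icc 0 L) := integrableOn_shift hf hs hL
  have h4 : IntervalIntegrable (fun r => D.rot (s + r) (inj (f (s + r)))) volume 0 t := by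
    have h5 := intervalIntegrable_rot_inj (D := D)
      (intervalIntegrable_of_mem h3 ⟨le_rfl, ht.1.trans ht.2⟩ ht)
    have h6 : ∀ r, D.rot (s + r) (inj (f (s + r))) = D.rot s (D.rot r (inj (f (s + r)))) :=
      fun r => (rot_rot _ _ _).symm
    simp only [h6]
    exact ⟨(D.rot s).toContinuousLinearMap.integrable_comp h5.1,
      (D.rot s).toContinuousLinearMap.integrable_comp h5.2⟩
  have h7 := ((D.rot (-s)).toContinuousLinearMap.intervalIntegral_comp_comm h4).symm
  refine h7.trans (intervalIntegral.integral_congr fun r _ => ?_)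
  simp only [LinearIsometry.coe_toContinuousLinearMap]
  rw [rot_rot, neg_add_cancel_left]

variable (D) in
theorem isMild_duhamel (T : ℝ) (f : ℝ → H) (x : WithLp 2 (H × H)) :
    IsMild D T f fun t => D.rot (-t) (x + ∫ s in (0 : ℝ)..t, D.rot s (inj (f s))) := by
  intro t _
  simp only [rot_rot_neg, intervalIntegral.integral_same, add_zero, neg_zero, rot_zero]

variable (D) in
theorem isMild_free (T : ℝ) (x : WithLp 2 (H × H)) :
    IsMild D T (fun _ => (0 : H)) fun t => D.rot (-t) x := by
  intro t _
  simp only [rot_rot_neg, inj_zero, map_zero, intervalIntegral.integral_zero, add_zero, neg_zero,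
    rot_zero]

theorem inner_inj_right (x : WithLp 2 (H × H)) (y : H) : inner 𝕜 x (inj y) = inner 𝕜 x.snd y := by
  rw [WithLp.prod_inner_apply]
  simp [inj]

theorem inner_inj_left (x : WithLp 2 (H × H)) (y : H) : inner 𝕜 (inj y) x = inner 𝕜 y x.snd := by
  rw [WithLp.prod_inner_apply]
  simp [inj]

/-- The scalar product is unchanged when both states are rotated, and the derivative of a rotated
state is its rotated source; the free evolution drops out. For g = -C(X').snd-type couplings, taken
with the velocity of X itself, this identity produces the coercive term ⟨Cx, x⟩. -/
theorem IsMild.inner_sub_inner (hT : 0 ≤ T) (hf : ContinuousOn f (Icc 0 T))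
    (hg : ContinuousOn g (Icc 0 T)) (hX : IsMild D T f X) (hY : IsMild D T g Y) :
    inner 𝕜 (X T) (Y T) - inner 𝕜 (X 0) (Y 0) =
      ∫ t in (0 : ℝ)..T, (inner 𝕜 (X t).snd (g t) + inner 𝕜 (f t) (Y t).snd) := by
  have hfi : IntegrableOn f (Icc 0 T) := hf.integrableOn_Icc
  have hgi : IntegrableOn g (Icc 0 T) := hg.integrableOn_Icc
  have hd : ∀ {f : ℝ → H} {X : ℝ → WithLp 2 (H × H)}, ContinuousOn f (Icc 0 T) → IsMild D T f X →
      ∀ t ∈ Icc 0 T,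
        HasDerivWithinAt (fun t => D.rot t (X t)) (D.rot t (inj (f t))) (Icc 0 T) t := by
    intro f X hf hX t ht
    refine hasDerivWithinAt_of_eq_integral (v := fun t => D.rot t (inj (f t)))
      (continuousOn_rot (continuous_inj.comp_continuousOn hf)) (fun t ht => ?_) ht
    rw [rot_zero]
    exact hX t ht
  have hXs : ContinuousOn (fun t => (X t).snd) (Icc 0 T) :=
    continuous_snd.comp_continuousOn (hX.continuousOn hfi)
  have hYs : ContinuousOn (fun t => (Y t).snd) (Icc 0 T) :=
    continuous_snd.comp_continuousOn (hY.continuousOn hgi)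
  have h1 : ∀ t ∈ Icc 0 T, HasDerivWithinAt (fun t => inner 𝕜 (X t) (Y t))
      (inner 𝕜 (X t).snd (g t) + inner 𝕜 (f t) (Y t).snd) (Icc 0 T) t := by
    intro t ht
    have := (hd hf hX t ht).inner 𝕜 (hd hg hY t ht)
    simp only [LinearIsometry.inner_map_map, inner_inj_right, inner_inj_left] at this
    exact this
  rw [eq_integral_of_hasDerivWithinAt ((hXs.inner hg).add (hf.inner hYs)) h1 ⟨hT, le_rfl⟩]
  abel

end SpectralData

/-! ### Elementary L² estimates on time intervals. -/

section L2

variable {E : Type*} [NormedAddCommGroup E] {T : ℝ} {f g : ℝ → E}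

theorem lintegral_enorm_sq {α : Type*} [MeasurableSpace α] (m : Measure α) (f : α → E) :
    ∫⁻ t, ‖f t‖ₑ ^ 2 ∂m = eLpNorm f 2 m ^ 2 := by
  rw [eLpNorm_eq_lintegral_rpow_enorm_toReal (by norm_num) (by norm_num), ← ENNReal.rpow_natCast,
    ← ENNReal.rpow_mul]
  norm_num

theorem IsL2.integrableOn (hf : IsL2 T f) : IntegrableOn f (Icc 0 T) :=
  MemLp.integrable (by norm_num) hf

theorem isL2_of_continuousOn (hf : ContinuousOn f (Icc 0 T)) : IsL2 T f := by
  obtain ⟨C, hC⟩ := isCompact_Icc.exists_bound_of_continuousOn hf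
  exact MemLp.of_bound (hf.aestronglyMeasurable measurableSet_Icc) C
    ((ae_restrict_iff' measurableSet_Icc).2 (Eventually.of_forall hC))

theorem isL2_zero : IsL2 T (fun _ => (0 : E)) := MemLp.zero

theorem measurePreserving_shift (s L : ℝ) : MeasurePreserving (fun t : ℝ => s + t)
    (volume.restrict (Icc 0 L)) (volume.restrict (Icc s (s + L))) := by
  have := (measurePreserving_add_left volume s).restrict_preimage (s := Icc s (s + L))
    measurableSet_Icc
  have h3 : (fun t => s + t) ⁻¹' Icc s (s + L) = Icc 0 L := by
    ext t; simp
  rwa [h3] at this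

theorem eLpNorm_shift_le (hf : AEStronglyMeasurable f (volume.restrict (Icc 0 T))) {s L : ℝ}
    (hs : 0 ≤ s) (hL : s + L ≤ T) :
    eLpNorm (fun t => f (s + t)) 2 (volume.restrict (Icc 0 L)) ≤
      eLpNorm f 2 (volume.restrict (Icc 0 T)) := by
  have hle : volume.restrict (Icc s (s + L)) ≤ volume.restrict (Icc 0 T) :=
    Measure.restrict_mono_set _ (Icc_subset_Icc hs hL)
  have := eLpNorm_comp_measurePreserving (p := 2) (hf.mono_measure hle)
    (measurePreserving_shift s L)
  rw [Function.comp_def] at this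
  rw [this]
  exact eLpNorm_mono_measure _ hle

theorem IsL2.shift (hf : IsL2 T f) {s L : ℝ} (hs : 0 ≤ s) (hL : s + L ≤ T) :
    IsL2 L (fun t => f (s + t)) := by
  have hle : volume.restrict (Icc s (s + L)) ≤ volume.restrict (Icc 0 T) :=
    Measure.restrict_mono_set _ (Icc_subset_Icc hs hL)
  exact (MemLp.mono_measure hle hf).comp_measurePreserving (measurePreserving_shift s L)

theorem lintegral_enorm_le_mul_eLpNorm (hf : IsL2 T f) :
    ∫⁻ t in Icc 0 T, ‖f t‖ₑ ≤ ENNReal.ofReal (√T) * eLpNorm f 2 (volume.restrict (Icc 0 T)) := by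
  have := eLpNorm_le_eLpNorm_mul_rpow_measure_univ (p := 1) (q := 2) (by norm_num) hf.1
  rw [eLpNorm_one_eq_lintegral_enorm] at this
  refine this.trans (le_of_eq ?_)
  rw [mul_comm]
  congr 1
  rcases le_or_gt 0 T with hT | hT
  · rw [Measure.restrict_apply_univ, Real.volume_Icc, sub_zero, Real.sqrt_eq_rpow,
      ← ENNReal.ofReal_rpow_of_nonneg hT (by norm_num)]
    norm_num
  · rw [Measure.restrict_apply_univ, Real.volume_Icc, Real.sqrt_eq_zero_of_nonpos hT.le]
    rw [ENNReal.ofReal_of_nonpos (by linarith)]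
    norm_num

end L2

/-! ### Bounds for the observation of regular solutions, and linearity. -/

namespace SpectralData

variable {𝕜 : Type*} [RCLike 𝕜]
variable {H : Type*} [NormedAddCommGroup H] [InnerProductSpace 𝕜 H] [CompleteSpace H]
variable [NormedSpace ℝ H]
variable {A : H →ₗ.[𝕜] H} {ι : Type*} {D : SpectralData A ι}
variable {T : ℝ} {f g w v w₂ v₂ : ℝ → H} {X Y : ℝ → WithLp 2 (H × H)}

theorem IsMild.enorm_le (hf : IsL2 T f) (hX : IsMild D T f X) {t : ℝ} (ht : t ∈ Icc 0 T) :
    ‖X t‖ₑ ≤ ‖X 0‖ₑ + ENNReal.ofReal (√T) * eLpNorm f 2 (volume.restrict (Icc 0 T)) := by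
  have h0 : (0 : ℝ) ∈ Icc 0 T := ⟨le_rfl, ht.1.trans ht.2⟩
  have h2 : ‖X t‖ₑ = ‖X 0 + ∫ s in (0 : ℝ)..t, D.rot s (inj (f s))‖ₑ := by
    rw [← hX t ht, ← ofReal_norm, ← ofReal_norm, LinearIsometry.norm_map]
  rw [h2]
  refine (enorm_add_le _ _).trans ?_
  gcongr
  rw [intervalIntegral.integral_of_le ht.1]
  refine (enorm_integral_le_lintegral_enorm _).trans ?_
  have h3 : ∀ s, ‖D.rot s (inj (f s))‖ₑ = ‖f s‖ₑ := fun s => by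
    rw [← ofReal_norm, ← ofReal_norm, LinearIsometry.norm_map, norm_inj]
  simp only [h3]
  refine le_trans ?_ (lintegral_enorm_le_mul_eLpNorm hf)
  exact lintegral_mono_set fun s hs => ⟨hs.1.le, hs.2.trans ht.2⟩

theorem st_sub {u u' x x' : H} (hu : MemPow A 1 u) (hu' : MemPow A 1 u') :
    D.st (u - u') (x - x') = D.st u x - D.st u' x' := by
  rw [st, root_sub hu hu']
  rfl

variable (D) in
include D in
theorem isSolution_sub (hf : IsL2 T f) (hg : IsL2 T g) (h : IsSolution A T f w v)
    (h₂ : IsSolution A T g w₂ v₂) :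
    IsSolution A T (f - g) (w - w₂) (v - v₂) := by
  have hfg : IsL2 T (f - g) := MemLp.sub hf hg
  rw [isSolution_iff (D := D) hfg.integrableOn]
  refine ⟨fun t ht => D.memPow_sub (h.mem t ht) (h₂.mem t ht), ?_⟩
  refine (IsMild.sub hf.integrableOn hg.integrableOn (isMild_of_isSolution (D := D)
    hf.integrableOn h) (isMild_of_isSolution hg.integrableOn h₂)).congr (fun _ _ => rfl) ?_
  intro t ht
  exact (st_sub (h.mem t ht) (h₂.mem t ht)).symm

variable (D) in
include D in
theorem isSolution_shift (hf : IsL2 T f) (h : IsSolution A T f w v) {s L : ℝ} (hs : 0 ≤ s)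
    (hL : s + L ≤ T) :
    IsSolution A L (fun t => f (s + t)) (fun t => w (s + t)) (fun t => v (s + t)) := by
  rw [isSolution_iff (D := D) (hf.shift hs hL).integrableOn]
  exact ⟨fun t ht => h.mem _ ⟨by linarith [ht.1], by linarith [ht.2]⟩,
    (isMild_of_isSolution (D := D) hf.integrableOn h).shift hf.integrableOn hs hL⟩

variable {G : Type*} [NormedAddCommGroup G] [InnerProductSpace 𝕜 G] [CompleteSpace G]
variable {B : (A.domain × H) →ₗ[𝕜] G}

theorem _root_.Cascade.IsRegular.sub (h : IsRegular A T w) (h₂ : IsRegular A T w₂) :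
    IsRegular A T (w - w₂) := by
  obtain ⟨g, hg, hg'⟩ := h
  obtain ⟨g₂, hg₂, hg₂'⟩ := h₂
  exact ⟨g - g₂, hg.sub hg₂, fun t ht => A.graph.sub_mem (hg' t ht) (hg₂' t ht)⟩

theorem _root_.Cascade.IsRegular.shift (h : IsRegular A T w) {s L : ℝ} (hs : 0 ≤ s)
    (hL : s + L ≤ T) : IsRegular A L fun t => w (s + t) := by
  obtain ⟨g, hg, hg'⟩ := h
  have hm : ∀ t ∈ Icc 0 L, s + t ∈ Icc 0 T := fun t ht =>
    ⟨by linarith [ht.1], by linarith [ht.2]⟩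
  exact ⟨fun t => g (s + t), hg.comp (by fun_prop) hm, fun t ht => hg' _ (hm t ht)⟩

theorem observe_sub {u u' x x' : H} (hu : u ∈ A.domain) (hu' : u' ∈ A.domain) :
    observe A B (u - u') (x - x') = observe A B u x - observe A B u' x' := by
  rw [observe, observe, observe, dif_pos hu, dif_pos hu', dif_pos (A.domain.sub_mem hu hu'),
    ← map_sub]
  rfl

theorem _root_.Cascade.IsRegular.mem_domain (h : IsRegular A T w) {t : ℝ} (ht : t ∈ Icc 0 T) :
    w t ∈ A.domain := by
  obtain ⟨g, hg, hg'⟩ := h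
  exact LinearPMap.mem_domain_of_mem_graph (hg' t ht)

theorem continuousOn_observe (hB : Admissible A B) (h : IsRegular A T w)
    (hv : ContinuousOn v (Icc 0 T)) : ContinuousOn (fun t => observe A B (w t) (v t)) (Icc 0 T) := by
  obtain ⟨c, hc⟩ := hB.1
  have h' := h
  obtain ⟨g, hg, hg'⟩ := h
  intro s hs
  rw [ContinuousWithinAt, tendsto_iff_norm_sub_tendsto_zero]
  have h1 : Tendsto (fun t => c * (‖g t - g s‖ + ‖v t - v s‖)) (𝓝[Icc 0 T] s) (𝓝 0) := by
    have := (((hg s hs).sub_const (g s)).norm.add ((hv s hs).sub_const (v s)).norm).const_mul c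
    simpa using this
  refine squeeze_zero' (Eventually.of_forall fun _ => norm_nonneg _) ?_ h1
  filter_upwards [self_mem_nhdsWithin] with t ht
  rw [← observe_sub (h'.mem_domain ht) (h'.mem_domain hs), observe,
    dif_pos (A.domain.sub_mem (h'.mem_domain ht) (h'.mem_domain hs))]
  refine (hc _ _).trans (le_of_eq ?_)
  congr 3
  have h2 := A.graph.sub_mem (hg' t ht) (hg' s hs)
  rw [Prod.mk_sub_mk] at h2
  exact ((LinearPMap.image_iff _).2 h2).symm

theorem isL2_observe (hB : Admissible A B) (h : IsRegular A T w)
    (hv : ContinuousOn v (Icc 0 T)) : IsL2 T (fun t => observe A B (w t) (v t)) :=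
  isL2_of_continuousOn (continuousOn_observe hB h hv)

theorem energy_one_le {u x : H} (hu : MemPow A 1 u) : energy A 1 u x ≤ ‖D.st u x‖ₑ ^ 2 := by
  rw [energy_one (D := D) hu, ← ofReal_norm, ← ENNReal.ofReal_pow (norm_nonneg _)]
  apply ENNReal.ofReal_le_ofReal
  linarith [sq_nonneg ‖D.st u x‖]

/-- `K` bounds the `L²` norm on `[0,T]` of the observation of a regular solution by the norms of the
initial data and of the source. -/
def ObsBound (D : SpectralData A ι) (B : (A.domain × H) →ₗ[𝕜] G) (T : ℝ) (K : ℝ≥0) : Prop :=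
  ∀ f w v : ℝ → H, IsL2 T f → IsSolution A T f w v → IsRegular A T w →
    eLpNorm (fun t => observe A B (w t) (v t)) 2 (volume.restrict (Icc 0 T)) ≤
      K * (‖D.st (w 0) (v 0)‖ₑ + eLpNorm f 2 (volume.restrict (Icc 0 T)))

variable (D) in
-- The energies at all times in the direct inequality are themselves bounded by the initial state
-- and the source, through `IsMild.enorm_le`.
theorem exists_obsBound (hB : Admissible A B) (hT : 0 < T) : ∃ K : ℝ≥0, D.ObsBound B T K := by
  obtain ⟨c, -, hc⟩ := hB.2 T hT
  set C : ℝ≥0 := Real.toNNReal √T with hC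
  set M : ℝ≥0 := c * ((2 + Real.toNNReal T) * (1 + C) ^ 2 + 1) with hM
  -- The squared estimate holds with constant M; since M ≤ (M + 1)², the constant M + 1 avoids a
  -- square root.
  refine ⟨M + 1, fun f w v hf h hr => ?_⟩
  have h1 := hc f w v hf h hr
  have hmild := isMild_of_isSolution (D := D) hf.integrableOn h
  set F := eLpNorm f 2 (volume.restrict (Icc 0 T))
  set s := ‖D.st (w 0) (v 0)‖ₑ
  have hE : ∀ t ∈ Icc 0 T, energy A 1 (w t) (v t) ≤ ((1 + C) * (s + F)) ^ 2 := fun t ht => by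
    refine (energy_one_le (D := D) (h.mem t ht)).trans ?_
    gcongr
    refine (hmild.enorm_le hf ht).trans ?_
    have : s + C * F ≤ (1 + C) * (s + F) := by
      calc s + C * F ≤ (s + C * F) + (F + C * s) := le_self_add
        _ = _ := by ring
    exact this
  have h2 : ∫⁻ t in Icc 0 T, energy A 1 (w t) (v t) ≤
      ((1 + C) * (s + F)) ^ 2 * Real.toNNReal T := by
    refine (setLIntegral_mono' measurableSet_Icc hE).trans (le_of_eq ?_)
    rw [setLIntegral_const, Real.volume_Icc, sub_zero]
    rfl
  rw [← ENNReal.pow_le_pow_left_iff two_ne_zero, ← lintegral_enorm_sq]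
  refine h1.trans ?_
  rw [lintegral_enorm_sq]
  have h3 : (c : ℝ≥0∞) * (energy A 1 (w 0) (v 0) + energy A 1 (w T) (v T) +
      (∫⁻ t in Icc 0 T, energy A 1 (w t) (v t)) + F ^ 2) ≤ M * (s + F) ^ 2 := by
    calc _ ≤ (c : ℝ≥0∞) * (((1 + C) * (s + F)) ^ 2 + ((1 + C) * (s + F)) ^ 2 +
          ((1 + C) * (s + F)) ^ 2 * Real.toNNReal T + (s + F) ^ 2) := by
          gcongr
          · exact hE 0 ⟨le_rfl, hT.le⟩
          · exact hE T ⟨hT.le, le_rfl⟩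
          · exact le_add_self
      _ = _ := by
          rw [hM]
          push_cast
          ring
  refine h3.trans ?_
  rw [mul_pow]
  gcongr
  have : M ≤ (M + 1) ^ 2 := by
    have : (M + 1) ^ 2 = M + (M ^ 2 + M + 1) := by ring
    rw [this]
    exact le_self_add
  exact_mod_cast this

theorem tendsto_root_zero {x : ℕ → H} (hx : ∀ m, MemPow A 1 (x m))
    (h : Tendsto (fun m => powNormSq A 1 (x m)) atTop (𝓝 0)) :
    Tendsto (fun m => D.root (x m)) atTop (𝓝 0) := by
  have : ∀ m, powNormSq A 1 (x m) = ENNReal.ofReal (‖D.root (x m)‖ ^ 2) :=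
    fun m => powNormSq_one (hx m)
  simp only [this] at h
  have h2 := (ENNReal.tendsto_toReal ENNReal.zero_ne_top).comp h
  simp only [Function.comp_def, ENNReal.toReal_ofReal (sq_nonneg _), ENNReal.toReal_zero] at h2
  have h3 := (Real.continuous_sqrt.tendsto 0).comp h2
  rw [tendsto_zero_iff_norm_tendsto_zero]
  simpa [Function.comp_def, Real.sqrt_sq (norm_nonneg _)] using h3

theorem _root_.Cascade.IsObservation.sub {y y₂ : ℝ → G} (D : SpectralData A ι)
    (h : IsObservation A B T f w v y)
    (h₂ : IsObservation A B T g w₂ v₂ y₂) (hf : IsL2 T f) (hg : IsL2 T g) (hT : 0 ≤ T)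
    (hw : IsSolution A T f w v) (hw₂ : IsSolution A T g w₂ v₂) (hB : Admissible A B) :
    IsObservation A B T (f - g) (w - w₂) (v - v₂) (y - y₂) := by
  obtain ⟨hy, fm, wm, vm, hm, hi1, hi2, hf', ho⟩ := h
  obtain ⟨hy₂, gm, xm, zm, hm₂, hi1₂, hi2₂, hf₂, ho₂⟩ := h₂
  have h0 : (0 : ℝ) ∈ Icc 0 T := ⟨le_rfl, hT⟩
  refine ⟨MemLp.sub hy hy₂, fun m => fm m - gm m, fun m => wm m - xm m, fun m => vm m - zm m,
    fun m => ⟨MemLp.sub (hm m).1 (hm₂ m).1, D.isSolution_sub (hm m).1 (hm₂ m).1 (hm m).2.1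
      (hm₂ m).2.1, (hm m).2.2.sub (hm₂ m).2.2⟩, ?_, hi2.sub hi2₂, ?_, ?_⟩
  · have k1 := tendsto_root_zero (D := D)
      (fun m => D.memPow_sub ((hm m).2.1.mem 0 h0) (hw.mem 0 h0)) hi1
    have k2 := tendsto_root_zero (D := D)
      (fun m => D.memPow_sub ((hm₂ m).2.1.mem 0 h0) (hw₂.mem 0 h0)) hi1₂
    have k3 := tendsto_powNormSq_lam (D := D) (k1.sub k2)
    refine k3.congr fun m => ?_
    rw [sub_zero, map_zero, sub_zero, map_sub,
      lam_root (D.memPow_sub ((hm m).2.1.mem 0 h0) (hw.mem 0 h0)),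
      lam_root (D.memPow_sub ((hm₂ m).2.1.mem 0 h0) (hw₂.mem 0 h0))]
    congr 1
    simp only [Pi.sub_apply]
    abel
  · have : Tendsto (fun m => eLpNorm (fm m - f) 2 (volume.restrict (Icc 0 T)) +
        eLpNorm (gm m - g) 2 (volume.restrict (Icc 0 T))) atTop (𝓝 0) := by
      simpa using hf'.add hf₂
    refine tendsto_of_tendsto_of_tendsto_of_le_of_le tendsto_const_nhds this (fun _ => zero_le)
      fun m => ?_
    have e : fm m - gm m - (f - g) = (fm m - f) - (gm m - g) := by abel
    beta_reduce
    rw [e]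
    exact eLpNorm_sub_le (((hm m).1.1).sub hf.1) (((hm₂ m).1.1).sub hg.1) (by norm_num)
  · have := ho.add ho₂
    rw [zero_add] at this
    refine tendsto_of_tendsto_of_tendsto_of_le_of_le tendsto_const_nhds this (fun _ => zero_le)
      fun m => ?_
    have l1 := isL2_observe hB (hm m).2.2 (hm m).2.1.cont_deriv
    have l2 := isL2_observe hB (hm₂ m).2.2 (hm₂ m).2.1.cont_deriv
    refine le_trans (le_of_eq ?_) (eLpNorm_sub_le (l1.1.sub hy.1) (l2.1.sub hy₂.1) (by norm_num))
    refine eLpNorm_congr_ae ?_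
    filter_upwards [ae_restrict_mem measurableSet_Icc] with t ht
    simp only [Pi.sub_apply]
    rw [observe_sub ((hm m).2.2.mem_domain ht) ((hm₂ m).2.2.mem_domain ht)]
    abel

end SpectralData

/-! ### Uniqueness, time shift and existence of the observation of a finite energy solution. -/

namespace SpectralData

variable {𝕜 : Type*} [RCLike 𝕜]
variable {H : Type*} [NormedAddCommGroup H] [InnerProductSpace 𝕜 H] [CompleteSpace H]
variable [NormedSpace ℝ H]
variable {A : H →ₗ.[𝕜] H} {ι : Type*} {D : SpectralData A ι}
variable {T : ℝ} {f g w v w₂ v₂ : ℝ → H} {X Y : ℝ → WithLp 2 (H × H)}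
variable {G : Type*} [NormedAddCommGroup G] [InnerProductSpace 𝕜 G] [CompleteSpace G]
variable {B : (A.domain × H) →ₗ[𝕜] G} {y y₂ : ℝ → G}

theorem st_zero : D.st 0 0 = 0 := by
  rw [st, root_zero]
  rfl

theorem tendsto_st_sub {wm vm : ℕ → H} {w₀ v₀ : H} (hm : ∀ m, MemPow A 1 (wm m))
    (hw : MemPow A 1 w₀)
    (h1 : Tendsto (fun m => powNormSq A 1 (wm m - w₀)) atTop (𝓝 0))
    (h2 : Tendsto vm atTop (𝓝 v₀)) :
    Tendsto (fun m => ‖D.st (wm m - w₀) (vm m - v₀)‖ₑ) atTop (𝓝 0) := by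
  have h3 := tendsto_root_zero (D := D) (fun m => D.memPow_sub (hm m) hw) h1
  have h4 : Tendsto (fun m => vm m - v₀) atTop (𝓝 0) := by simpa using h2.sub_const v₀
  have h5 : Tendsto (fun m => D.st (wm m - w₀) (vm m - v₀)) atTop (𝓝 0) :=
    ((WithLp.prod_continuous_toLp 2 H H).tendsto (0, 0)).comp (h3.prodMk_nhds h4)
  simpa using h5.enorm

/-- The bound for regular solutions passes to the limit along the approximating sequence, since
data, sources and observations all converge. -/
theorem _root_.Cascade.IsObservation.eLpNorm_le {K : ℝ≥0} (hK : D.ObsBound B T K)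
    (hB : Admissible A B) (h : IsObservation A B T f w v y) (hf : IsL2 T f)
    (hw : MemPow A 1 (w 0)) (hT : 0 ≤ T) :
    eLpNorm y 2 (volume.restrict (Icc 0 T)) ≤
      K * (‖D.st (w 0) (v 0)‖ₑ + eLpNorm f 2 (volume.restrict (Icc 0 T))) := by
  obtain ⟨hy, fm, wm, vm, hm, hi1, hi2, hf', ho⟩ := h
  have h0 : (0 : ℝ) ∈ Icc 0 T := ⟨le_rfl, hT⟩
  have hst := tendsto_st_sub (D := D) (fun m => (hm m).2.1.mem 0 h0) hw hi1 hi2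
  have hlim : Tendsto (fun m => (K * ((‖D.st (w 0) (v 0)‖ₑ +
      ‖D.st (wm m 0 - w 0) (vm m 0 - v 0)‖ₑ) + (eLpNorm f 2 (volume.restrict (Icc 0 T)) +
      eLpNorm (fm m - f) 2 (volume.restrict (Icc 0 T)))) : ℝ≥0∞) +
      eLpNorm (fun t => observe A B (wm m t) (vm m t) - y t) 2 (volume.restrict (Icc 0 T))) atTop
      (𝓝 (K * ((‖D.st (w 0) (v 0)‖ₑ + 0) + (eLpNorm f 2 (volume.restrict (Icc 0 T)) + 0)) + 0)) := by
    refine Tendsto.add (ENNReal.Tendsto.const_mul ?_ (Or.inr ENNReal.coe_ne_top)) ho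
    exact (tendsto_const_nhds.add hst).add (tendsto_const_nhds.add hf')
  simp only [add_zero] at hlim
  refine ge_of_tendsto hlim (Eventually.of_forall fun m => ?_)
  have l1 := isL2_observe hB (hm m).2.2 (hm m).2.1.cont_deriv
  have e1 : y = (fun t => observe A B (wm m t) (vm m t)) -
      fun t => observe A B (wm m t) (vm m t) - y t := by
    ext t; simp
  have e2 : eLpNorm y 2 (volume.restrict (Icc 0 T)) ≤
      eLpNorm (fun t => observe A B (wm m t) (vm m t)) 2 (volume.restrict (Icc 0 T)) +
      eLpNorm (fun t => observe A B (wm m t) (vm m t) - y t) 2 (volume.restrict (Icc 0 T)) := by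
    nth_rewrite 1 [e1]
    exact eLpNorm_sub_le l1.1 (l1.1.sub hy.1) (by norm_num)
  refine e2.trans ?_
  gcongr
  refine (hK _ _ _ (hm m).1 (hm m).2.1 (hm m).2.2).trans ?_
  gcongr
  · rw [st_sub ((hm m).2.1.mem 0 h0) hw]
    have : D.st (wm m 0) (vm m 0) = D.st (w 0) (v 0) +
        (D.st (wm m 0) (vm m 0) - D.st (w 0) (v 0)) := by abel
    nth_rewrite 1 [this]
    exact enorm_add_le _ _
  · have : fm m = f + (fm m - f) := by abel
    nth_rewrite 1 [this]
    exact eLpNorm_add_le hf.1 ((hm m).1.1.sub hf.1) (by norm_num)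

theorem _root_.Cascade.IsObservation.ae_eq (D : SpectralData A ι) (hB : Admissible A B) (hT : 0 < T)
    (hw : IsSolution A T f w v) (hf : IsL2 T f) (h : IsObservation A B T f w v y)
    (h₂ : IsObservation A B T f w v y₂) : y =ᵐ[volume.restrict (Icc 0 T)] y₂ := by
  obtain ⟨K, hK⟩ := D.exists_obsBound hB hT
  have h1 := (h.sub D h₂ hf hf hT.le hw hw hB).eLpNorm_le hK hB (MemLp.sub hf hf)
    (D.memPow_sub (hw.mem 0 ⟨le_rfl, hT.le⟩) (hw.mem 0 ⟨le_rfl, hT.le⟩)) hT.le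
  have h0 : (0 : ℝ) ∈ Icc 0 T := ⟨le_rfl, hT.le⟩
  simp only [Pi.sub_apply, sub_self, st_zero, eLpNorm_zero,
    enorm_zero, add_zero, mul_zero, nonpos_iff_eq_zero] at h1
  rw [eLpNorm_eq_zero_iff (h.1.1.sub h₂.1.1) (by norm_num)] at h1
  filter_upwards [h1] with t ht
  rwa [Pi.sub_apply, Pi.zero_apply, sub_eq_zero] at ht

theorem _root_.Cascade.IsObservation.shift (D : SpectralData A ι) (hB : Admissible A B)
    (hw : IsSolution A T f w v) (hf : IsL2 T f) (h : IsObservation A B T f w v y) {s L : ℝ}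
    (hs : 0 ≤ s) (hL : s + L ≤ T) (hL0 : 0 ≤ L) :
    IsObservation A B L (fun t => f (s + t)) (fun t => w (s + t)) (fun t => v (s + t))
      (fun t => y (s + t)) := by
  obtain ⟨hy, fm, wm, vm, hm, hi1, hi2, hf', ho⟩ := h
  have h0 : (0 : ℝ) ∈ Icc 0 T := ⟨le_rfl, by linarith⟩
  have hsT : s ∈ Icc 0 T := ⟨hs, by linarith⟩
  have hst := tendsto_st_sub (D := D) (fun m => (hm m).2.1.mem 0 h0) (hw.mem 0 h0) hi1 hi2
  have hd : ∀ m, IsMild D T (fm m - f) fun t => D.st ((wm m - w) t) ((vm m - v) t) := fun m =>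
    isMild_of_isSolution (IsL2.integrableOn (MemLp.sub (hm m).1 hf))
      (D.isSolution_sub (hm m).1 hf (hm m).2.1 hw)
  -- The approximation is given at time 0 but needed at time s. The difference solves the equation
  -- with small data and small source, so its state at s is small too.
  have hts : Tendsto (fun m => ‖D.st ((wm m - w) s) ((vm m - v) s)‖ₑ) atTop (𝓝 0) := by
    have : Tendsto (fun m => ‖D.st (wm m 0 - w 0) (vm m 0 - v 0)‖ₑ + ENNReal.ofReal (√T) *
        eLpNorm (fm m - f) 2 (volume.restrict (Icc 0 T))) atTop (𝓝 (0 + ENNReal.ofReal (√T) * 0)) :=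
      hst.add (ENNReal.Tendsto.const_mul hf' (Or.inr ENNReal.ofReal_ne_top))
    rw [mul_zero, add_zero] at this
    exact tendsto_of_tendsto_of_tendsto_of_le_of_le tendsto_const_nhds this (fun _ => zero_le)
      fun m => (hd m).enorm_le (MemLp.sub (hm m).1 hf) hsT
  refine ⟨hy.shift hs hL, fun m t => fm m (s + t), fun m t => wm m (s + t), fun m t => vm m (s + t),
    fun m => ⟨(hm m).1.shift hs hL, D.isSolution_shift (hm m).1 (hm m).2.1 hs hL,
      (hm m).2.2.shift hs hL⟩, ?_, ?_, ?_, ?_⟩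
  · simp only [add_zero]
    refine tendsto_of_tendsto_of_tendsto_of_le_of_le tendsto_const_nhds (h := fun m =>
      ‖D.st ((wm m - w) s) ((vm m - v) s)‖ₑ ^ 2) ?_ (fun _ => zero_le) fun m => ?_
    · simpa [Function.comp_def] using ((ENNReal.continuous_pow 2).tendsto 0).comp hts
    · have hmem := D.memPow_sub ((hm m).2.1.mem s hsT) (hw.mem s hsT)
      beta_reduce
      rw [powNormSq_one (D := D) hmem, ← ofReal_norm, ← ENNReal.ofReal_pow (norm_nonneg _)]
      apply ENNReal.ofReal_le_ofReal
      rw [norm_st_sq, Pi.sub_apply]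
      linarith [sq_nonneg ‖(vm m - v) s‖]
  · simp only [add_zero]
    rw [tendsto_iff_edist_tendsto_0]
    refine tendsto_of_tendsto_of_tendsto_of_le_of_le tendsto_const_nhds hts (fun _ => zero_le)
      fun m => ?_
    beta_reduce
    rw [edist_eq_enorm_sub, ← ofReal_norm, ← ofReal_norm]
    exact ENNReal.ofReal_le_ofReal (norm_snd_le (D.st ((wm m - w) s) ((vm m - v) s)))
  · refine tendsto_of_tendsto_of_tendsto_of_le_of_le tendsto_const_nhds hf' (fun _ => zero_le)
      fun m => ?_
    exact eLpNorm_shift_le (f := fm m - f) ((hm m).1.1.sub hf.1) hs hL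
  · refine tendsto_of_tendsto_of_tendsto_of_le_of_le tendsto_const_nhds ho (fun _ => zero_le)
      fun m => ?_
    have l1 := isL2_observe hB (hm m).2.2 (hm m).2.1.cont_deriv
    exact eLpNorm_shift_le (f := fun t => observe A B (wm m t) (vm m t) - y t) (l1.1.sub hy.1) hs hL

open Classical in
variable (D) in
/-- The spectral projection onto the eigenvectors with eigenvalue at most `m`. -/
def proj (m : ℕ) : H →L[𝕜] H := diag D.b fun i => if D.μ i ≤ m then 1 else 0

open Classical in
theorem abs_proj_le (m : ℕ) (i : ι) : |(if D.μ i ≤ m then 1 else 0 : ℝ)| ≤ 1 := by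
  split_ifs <;> simp

open Classical in
theorem repr_proj (m : ℕ) (x : H) (i : ι) :
    D.b.repr (D.proj m x) i = ((if D.μ i ≤ m then 1 else 0 : ℝ) : 𝕜) * D.b.repr x i :=
  repr_diag _ (abs_proj_le m) x i

theorem norm_proj_le (m : ℕ) (x : H) : ‖D.proj m x‖ ≤ ‖x‖ := by
  have := norm_diag_apply_le D.b zero_le_one (abs_proj_le (D := D) m) x
  rwa [one_mul] at this

theorem tendsto_proj (x : H) : Tendsto (fun m => D.proj m x) atTop (𝓝 x) := by
  classical
  have h1 : diag D.b (fun _ => 1) x = x := by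
    refine repr_ext D.b fun i => ?_
    rw [repr_diag D.b (C := 1) (fun i => by simp)]
    simp
  nth_rewrite 2 [← h1]
  refine tendsto_diag_apply D.b (C := 1) (fun m i => abs_proj_le m i) (fun i => by simp)
    (fun i => ?_) x
  obtain ⟨N, hN⟩ := exists_nat_ge (D.μ i)
  refine tendsto_const_nhds.congr' ?_
  filter_upwards [eventually_ge_atTop N] with m hm
  rw [if_pos (hN.trans (by exact_mod_cast hm))]

theorem proj_lam (m : ℕ) (x : H) : D.proj m (D.lam x) = D.lam (D.proj m x) := by
  refine repr_ext D.b fun i => ?_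
  rw [repr_proj, repr_lam, repr_lam, repr_proj]
  ring

theorem proj_graph (m : ℕ) {u g : H} (h : (u, g) ∈ A.graph) :
    (D.proj m u, D.proj m g) ∈ A.graph := by
  rw [D.graph_iff] at *
  intro i
  rw [repr_proj, repr_proj, h i]
  ring

theorem isSolution_proj (h : IsSolution A T f w v) (m : ℕ) :
    IsSolution A T (fun t => D.proj m (f t)) (fun t => D.proj m (w t)) (fun t => D.proj m (v t)) where
  mem t ht := by
    rw [← lam_root (D := D) (h.mem t ht), proj_lam]
    exact D.memPow_lam _
  cont s hs := by
    refine tendsto_of_tendsto_of_tendsto_of_le_of_le' tendsto_const_nhds (h.cont s hs)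
      (Eventually.of_forall fun _ => zero_le) ?_
    filter_upwards [self_mem_nhdsWithin] with t ht
    have hm := D.memPow_sub (h.mem t ht) (h.mem s hs)
    rw [← map_sub, ← lam_root (D := D) hm, proj_lam, powNormSq_lam, powNormSq_lam]
    have := norm_proj_le (D := D) m (D.root (w t - w s))
    gcongr
  cont_deriv := (D.proj m).continuous.comp_continuousOn h.cont_deriv
  deriv t ht := ((D.proj m).restrictScalars ℝ).hasFDerivAt.comp_hasDerivWithinAt t (h.deriv t ht)
  weak φ t ht := by
    have h1 := proj_graph (D := D) m (LinearPMap.mem_graph A φ)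
    obtain ⟨d, hd, hd'⟩ := (LinearPMap.mem_graph_iff _).1 h1
    have h2 : ∀ x y : H, inner 𝕜 x (D.proj m y) = inner 𝕜 (D.proj m x) y := fun x y =>
      (inner_diag D.b (abs_proj_le m) x y).symm
    simp only [h2]
    simp only at hd hd'
    rw [← hd, ← hd']
    exact h.weak d t ht

theorem isRegular_proj (hw : ContinuousOn w (Icc 0 T)) (m : ℕ) :
    IsRegular A T fun t => D.proj m (w t) := by
  classical
  -- On truncated vectors A acts as a bounded operator of norm at most m, so truncating a continuous
  -- function gives a regular one.
  have hb : ∀ i, |(if D.μ i ≤ m then D.μ i else 0 : ℝ)| ≤ m := fun i => by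
    split_ifs with h
    · rwa [abs_of_pos (D.μ_pos i)]
    · simp
  refine ⟨fun t => diag D.b (fun i => if D.μ i ≤ m then D.μ i else 0) (w t),
    (ContinuousLinearMap.continuous _).comp_continuousOn hw, fun t _ => ?_⟩
  rw [D.graph_iff]
  intro i
  rw [repr_diag D.b hb, repr_proj]
  split_ifs <;> simp

theorem tendsto_eLpNorm_proj_sub (hf : IsL2 T f) :
    Tendsto (fun m => eLpNorm ((fun t => D.proj m (f t)) - f) 2 (volume.restrict (Icc 0 T))) atTop
      (𝓝 0) := by
  have hm : ∀ m, AEStronglyMeasurable ((fun t => D.proj m (f t)) - f)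
      (volume.restrict (Icc 0 T)) := fun m =>
    ((D.proj m).continuous.comp_aestronglyMeasurable hf.1).sub hf.1
  have h1 : Tendsto (fun m => ∫⁻ t in Icc 0 T, ‖((fun t => D.proj m (f t)) - f) t‖ₑ ^ 2) atTop
      (𝓝 (∫⁻ t in Icc 0 T, 0)) := by
    refine tendsto_lintegral_of_dominated_convergence' (fun t => (2 * ‖f t‖ₑ) ^ 2)
      (fun m => (hm m).enorm.pow_const 2) (fun m => Eventually.of_forall fun t => ?_) ?_
      (Eventually.of_forall fun t => ?_)
    · beta_reduce
      gcongr
      rw [Pi.sub_apply, two_mul]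
      refine (enorm_sub_le).trans ?_
      gcongr
      rw [← ofReal_norm, ← ofReal_norm]
      exact ENNReal.ofReal_le_ofReal (norm_proj_le m _)
    · simp only [mul_pow]
      rw [lintegral_const_mul' _ _ (by norm_num), lintegral_enorm_sq]
      exact ENNReal.mul_ne_top (by norm_num) (ENNReal.pow_ne_top hf.2.ne)
    · have := ((ENNReal.continuous_pow 2).tendsto _).comp
        ((tendsto_proj (D := D) (f t)).sub_const (f t)).enorm
      simpa [Function.comp_def] using this
  simp only [lintegral_zero, lintegral_enorm_sq] at h1
  have h2 := (ENNReal.continuous_rpow_const (y := 1 / 2)).tendsto 0 |>.comp h1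
  have e : ∀ x : ℝ≥0∞, (x ^ 2) ^ ((1 : ℝ) / 2) = x := fun x => by
    rw [← ENNReal.rpow_natCast, ← ENNReal.rpow_mul]
    norm_num
  have h3 : (0 : ℝ≥0∞) ^ ((1 : ℝ) / 2) = 0 := by norm_num
  simp only [Function.comp_def, e, h3] at h2
  exact h2

variable (D) in
include D in
-- Spectral truncations of w are regular solutions whose data and sources converge to those of w. By
-- `ObsBound`, applied to differences, their observations form a Cauchy sequence in L², and its
-- limit is the observation.
theorem exists_isObservation (hB : Admissible A B) (hT : 0 < T) (hf : IsL2 T f)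
    (hw : IsSolution A T f w v) : ∃ y, IsObservation A B T f w v y := by
  obtain ⟨K, hK⟩ := D.exists_obsBound hB hT
  have h0 : (0 : ℝ) ∈ Icc 0 T := ⟨le_rfl, hT.le⟩
  have hwc : ContinuousOn w (Icc 0 T) := fun t ht => (hw.deriv t ht).continuousWithinAt
  have hfm : ∀ m, IsL2 T (fun t => D.proj m (f t)) := fun m =>
    MemLp.of_le hf ((D.proj m).continuous.comp_aestronglyMeasurable hf.1)
      (Eventually.of_forall fun t => norm_proj_le m _)
  have hsol := fun m => isSolution_proj (D := D) hw m
  have hreg := fun m => isRegular_proj (D := D) hwc m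
  have hi1 : Tendsto (fun m => powNormSq A 1 (D.proj m (w 0) - w 0)) atTop (𝓝 0) := by
    have := tendsto_powNormSq_lam (D := D) (tendsto_proj (D := D) (D.root (w 0)))
    simpa only [← proj_lam, lam_root (hw.mem 0 h0)] using this
  have hi2 : Tendsto (fun m => D.proj m (v 0)) atTop (𝓝 (v 0)) := tendsto_proj _
  have hff := tendsto_eLpNorm_proj_sub (D := D) hf
  have hst := tendsto_st_sub (D := D) (fun m => (hsol m).mem 0 h0) (hw.mem 0 h0) hi1 hi2
  have hobs : ∀ m, MemLp (fun t => observe A B (D.proj m (w t)) (D.proj m (v t))) 2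
      (volume.restrict (Icc 0 T)) := fun m => isL2_observe hB (hreg m) (hsol m).cont_deriv
  set a : ℕ → ℝ≥0∞ := fun m => ‖D.st (D.proj m (w 0) - w 0) (D.proj m (v 0) - v 0)‖ₑ +
    eLpNorm ((fun t => D.proj m (f t)) - f) 2 (volume.restrict (Icc 0 T)) with ha
  have ha0 : Tendsto a atTop (𝓝 0) := by simpa using hst.add hff
  have hdist : ∀ m k, eLpNorm ((fun t => observe A B (D.proj m (w t)) (D.proj m (v t))) -
      fun t => observe A B (D.proj k (w t)) (D.proj k (v t))) 2 (volume.restrict (Icc 0 T)) ≤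
      K * (a m + a k) := by
    intro m k
    have h1 := hK _ _ _ (MemLp.sub (hfm m) (hfm k)) (D.isSolution_sub (hfm m) (hfm k) (hsol m)
      (hsol k)) ((hreg m).sub (hreg k))
    refine le_trans (le_of_eq (eLpNorm_congr_ae ?_)) (h1.trans ?_)
    · filter_upwards [ae_restrict_mem measurableSet_Icc] with t ht
      simp only [Pi.sub_apply]
      rw [observe_sub ((hreg m).mem_domain ht) ((hreg k).mem_domain ht)]
    · rw [ha]
      have e : ∀ p q r s : ℝ≥0∞, (p + q) + (r + s) = (p + r) + (q + s) := fun p q r s => by ring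
      rw [e]
      gcongr
      · simp only [Pi.sub_apply]
        have e1 : D.st (D.proj m (w 0) - D.proj k (w 0)) (D.proj m (v 0) - D.proj k (v 0)) =
            D.st (D.proj m (w 0) - w 0) (D.proj m (v 0) - v 0) -
            D.st (D.proj k (w 0) - w 0) (D.proj k (v 0) - v 0) := by
          rw [st_sub ((hsol m).mem 0 h0) (hw.mem 0 h0), st_sub ((hsol k).mem 0 h0) (hw.mem 0 h0),
            st_sub ((hsol m).mem 0 h0) ((hsol k).mem 0 h0)]
          abel
        rw [e1]
        exact enorm_sub_le
      · have e1 : (fun t => D.proj m (f t)) - (fun t => D.proj k (f t)) =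
            ((fun t => D.proj m (f t)) - f) - ((fun t => D.proj k (f t)) - f) := by abel
        rw [e1]
        exact eLpNorm_sub_le ((hfm m).1.sub hf.1) ((hfm k).1.sub hf.1) (by norm_num)
  have hcau : CauchySeq fun m => (hobs m).toLp := by
    rw [EMetric.cauchySeq_iff]
    intro ε hε
    have h1 : Tendsto (fun m => (K : ℝ≥0∞) * (a m + a m)) atTop (𝓝 0) := by
      have := ENNReal.Tendsto.const_mul (a := K) (ha0.add ha0) (Or.inr ENNReal.coe_ne_top)
      simpa using this
    have h2 : ∀ᶠ m in atTop, (K + 1 : ℝ≥0∞) * a m < ε / 2 := by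
      have := ENNReal.Tendsto.const_mul (a := K + 1) ha0 (Or.inr (by finiteness))
      rw [mul_zero] at this
      exact this.eventually_lt_const (ENNReal.half_pos hε.ne')
    obtain ⟨N, hN⟩ := eventually_atTop.1 h2
    refine ⟨N, fun m hm k hk => ?_⟩
    rw [Lp.edist_toLp_toLp]
    refine (hdist m k).trans_lt ?_
    rw [← ENNReal.add_halves ε, mul_add]
    refine ENNReal.add_lt_add (lt_of_le_of_lt ?_ (hN m hm)) (lt_of_le_of_lt ?_ (hN k hk))
    · gcongr; exact le_self_add
    · gcongr; exact le_self_add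
  obtain ⟨Y, hY⟩ := cauchySeq_tendsto_of_complete hcau
  refine ⟨Y, Lp.memLp Y, fun m t => D.proj m (f t), fun m t => D.proj m (w t),
    fun m t => D.proj m (v t), fun m => ⟨hfm m, hsol m, hreg m⟩, hi1, hi2, hff, ?_⟩
  have h3 := (Lp.tendsto_Lp_iff_tendsto_eLpNorm' _ _).1 hY
  refine h3.congr fun m => eLpNorm_congr_ae ?_
  filter_upwards [(hobs m).coeFn_toLp] with t ht
  rw [Pi.sub_apply, ht]

end SpectralData

/-! ### Norms of negative order and time primitives of a cascade. -/

namespace SpectralData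

variable {𝕜 : Type*} [RCLike 𝕜]
variable {H : Type*} [NormedAddCommGroup H] [InnerProductSpace 𝕜 H] [CompleteSpace H]
variable {A : H →ₗ.[𝕜] H} {ι : Type*} {D : SpectralData A ι}

theorem inv_graph (x : H) : (D.inv x, x) ∈ A.graph := by
  rw [D.graph_iff]
  intro i
  rw [repr_inv, ← mul_assoc, ← RCLike.ofReal_mul, mul_inv_cancel₀ (D.μ_pos i).ne',
    RCLike.ofReal_one, one_mul]

variable [NormedSpace ℝ H]

variable (D) in
include D in
theorem powNormSq_add_le (k : ℤ) (x y : H) :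
    powNormSq A k (x + y) ≤ 2 * (powNormSq A k x + powNormSq A k y) := by
  rw [D.powNormSq_eq, D.powNormSq_eq, D.powNormSq_eq, ← ENNReal.tsum_add, ← ENNReal.tsum_mul_left]
  refine ENNReal.tsum_le_tsum fun i => ?_
  have hμ := zpow_nonneg (D.μ_pos i).le k
  have h2 : ∀ z : ℝ, 2 * ENNReal.ofReal z = ENNReal.ofReal (2 * z) := fun z => by
    rw [ENNReal.ofReal_mul (by norm_num)]
    norm_num
  rw [← ENNReal.ofReal_add (by positivity) (by positivity), h2]
  apply ENNReal.ofReal_le_ofReal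
  rw [repr_add, ← mul_add, mul_left_comm]
  refine mul_le_mul_of_nonneg_left ?_ hμ
  have h := norm_add_le (D.b.repr x i) (D.b.repr y i)
  have h' := pow_le_pow_left₀ (norm_nonneg _) h 2
  nlinarith [sq_nonneg (‖D.b.repr x i‖ - ‖D.b.repr y i‖)]

variable (D) in
include D in
theorem powNormSq_neg (k : ℤ) (x : H) : powNormSq A k (-x) = powNormSq A k x := by
  rw [D.powNormSq_eq, D.powNormSq_eq]
  exact tsum_congr fun i => by rw [repr_neg, norm_neg]

variable (D) in
include D in
theorem powNormSq_zero_right (k : ℤ) : powNormSq A k (0 : H) = 0 := by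
  rw [D.powNormSq_eq]
  simp

theorem powNormSq_inv (k : ℤ) (x : H) : powNormSq A (k + 2) (D.inv x) = powNormSq A k x := by
  rw [D.powNormSq_eq, D.powNormSq_eq]
  refine tsum_congr fun i => ?_
  have hμ := (D.μ_pos i).ne'
  rw [repr_inv, norm_mul, RCLike.norm_ofReal, mul_pow, sq_abs, zpow_add₀ hμ]
  congr 1
  have : D.μ i ^ (2 : ℤ) = D.μ i ^ 2 := by norm_cast
  rw [this]
  field_simp

theorem powNormSq_pred_le (k : ℤ) (x : H) :
    powNormSq A (k - 1) x ≤ ENNReal.ofReal D.low⁻¹ * powNormSq A k x := by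
  rw [D.powNormSq_eq, D.powNormSq_eq, ← ENNReal.tsum_mul_left]
  refine ENNReal.tsum_le_tsum fun i => ?_
  rw [← ENNReal.ofReal_mul (inv_nonneg.2 D.low_pos.le)]
  apply ENNReal.ofReal_le_ofReal
  rw [zpow_sub_one₀ (D.μ_pos i).ne', ← mul_assoc, mul_comm _ (D.μ i)⁻¹]
  have h1 : (D.μ i)⁻¹ ≤ D.low⁻¹ := inv_anti₀ D.low_pos (D.low_le i)
  have h2 := zpow_nonneg (D.μ_pos i).le k
  gcongr

variable (D) in
/-- The bounded operator `A^{-k/2}`. -/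
def lamPow (k : ℕ) : H →L[𝕜] H := diag D.b fun i => (D.om i ^ k)⁻¹

theorem abs_inv_om_pow_le (k : ℕ) (i : ι) : |(D.om i ^ k)⁻¹| ≤ ((√D.low)⁻¹) ^ k := by
  rw [← inv_pow, abs_pow]
  exact pow_le_pow_left₀ (abs_nonneg _) (D.abs_inv_om_le i) k

theorem repr_lamPow (k : ℕ) (x : H) (i : ι) :
    D.b.repr (D.lamPow k x) i = ((D.om i ^ k)⁻¹ : ℝ) * D.b.repr x i :=
  repr_diag D.b (abs_inv_om_pow_le k) x i

theorem inner_lamPow (k : ℕ) (x y : H) : inner 𝕜 (D.lamPow k x) y = inner 𝕜 x (D.lamPow k y) :=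
  inner_diag D.b (abs_inv_om_pow_le k) x y

theorem om_pow_sq (k : ℕ) (i : ι) : (D.om i ^ k) ^ 2 = D.μ i ^ k := by
  rw [← D.om_sq, ← pow_mul, ← pow_mul, mul_comm]

theorem powNormSq_neg_eq (k : ℕ) (x : H) :
    powNormSq A (-(k : ℤ)) x = ENNReal.ofReal (‖D.lamPow k x‖ ^ 2) := by
  rw [D.powNormSq_eq, ← tsum_repr_sq D.b]
  refine tsum_congr fun i => ?_
  rw [repr_lamPow, norm_mul, RCLike.norm_ofReal, mul_pow, sq_abs, inv_pow, om_pow_sq,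
    zpow_neg, zpow_natCast]

theorem powNormSq_lamPow (k : ℕ) (x : H) :
    powNormSq A k (D.lamPow k x) = ENNReal.ofReal (‖x‖ ^ 2) := by
  rw [D.powNormSq_eq, ← tsum_repr_sq D.b]
  refine tsum_congr fun i => ?_
  have hμ := (pow_pos (D.μ_pos i) k).ne'
  rw [repr_lamPow, norm_mul, RCLike.norm_ofReal, mul_pow, sq_abs, inv_pow, om_pow_sq, zpow_natCast,
    mul_inv_cancel_left₀ hμ]

theorem exists_lamPow_eq {k : ℕ} {y : H} (hy : MemPow A k y) : ∃ x, D.lamPow k x = y := by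
  have hy' : ∑' i, ENNReal.ofReal (‖((D.om i ^ k : ℝ) : 𝕜) * D.b.repr y i‖ ^ 2) ≠ ∞ := by
    rw [MemPow, D.powNormSq_eq] at hy
    convert hy using 4 with i
    rw [norm_mul, RCLike.norm_ofReal, mul_pow, sq_abs, om_pow_sq, zpow_natCast]
  obtain ⟨x, hx⟩ := exists_repr_eq D.b (fun i => ((D.om i ^ k : ℝ) : 𝕜) * D.b.repr y i) hy'
  refine ⟨x, repr_ext D.b fun i => ?_⟩
  rw [repr_lamPow, hx, ← mul_assoc, ← RCLike.ofReal_mul,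
    inv_mul_cancel₀ (pow_pos (D.om_pos i) k).ne', RCLike.ofReal_one, one_mul]

variable (D) in
include D in
/-- Duality between the spaces of order `k` and `-k`. -/
theorem norm_inner_sq_le (k : ℕ) (x y : H) (hy : MemPow A k y) :
    ENNReal.ofReal (‖(inner 𝕜 x y : 𝕜)‖ ^ 2) ≤ powNormSq A (-(k : ℤ)) x * powNormSq A k y := by
  obtain ⟨z, rfl⟩ := exists_lamPow_eq (D := D) hy
  rw [← inner_lamPow, powNormSq_neg_eq (D := D), powNormSq_lamPow,
    ← ENNReal.ofReal_mul (by positivity), ← mul_pow]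
  have := norm_inner_le_norm (𝕜 := 𝕜) (D.lamPow k x) z
  gcongr

variable (D) in
include D in
theorem powNormSq_neg_ne_top (k : ℕ) (x : H) : powNormSq A (-(k : ℤ)) x ≠ ∞ := by
  rw [powNormSq_neg_eq (D := D)]
  exact ENNReal.ofReal_ne_top

variable (D) in
include D in
/-- If the adjoint of `C` is bounded on `H_k`, then `C` is bounded for the norm of order `-k`. -/
theorem powNormSq_neg_le_of_adjoint (k : ℕ) {C : H →L[𝕜] H} {c : ℝ≥0}
    (hc : ∀ u : H, MemPow A k u →
      powNormSq A k (ContinuousLinearMap.adjoint C u) ≤ c * powNormSq A k u) (x : H) :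
    powNormSq A (-(k : ℤ)) (C x) ≤ c * powNormSq A (-(k : ℤ)) x := by
  -- Z = A^{-k} C x realises the duality: ⟨Cx, Z⟩, |A^{k/2} Z|² and |A^{-k/2} C x|² are the same
  -- number. Moving C onto Z and dividing by this number, if it is nonzero, gives the claim.
  set Z := D.lamPow k (D.lamPow k (C x)) with hZ
  have h1 : powNormSq A k Z = powNormSq A (-(k : ℤ)) (C x) := by
    rw [hZ, powNormSq_lamPow, powNormSq_neg_eq (D := D)]
  have hfin := D.powNormSq_neg_ne_top k (C x)
  have hmem : MemPow A k Z := by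
    rw [MemPow, h1]
    exact hfin
  have h2 : powNormSq A (-(k : ℤ)) (C x) = ENNReal.ofReal ‖(inner 𝕜 (C x) Z : 𝕜)‖ := by
    rw [hZ, ← inner_lamPow, inner_self_eq_norm_sq_to_K, powNormSq_neg_eq (D := D), norm_pow,
      RCLike.norm_ofReal, sq_abs]
  have h3 := D.norm_inner_sq_le k x (ContinuousLinearMap.adjoint C Z)
    (ne_top_of_le_ne_top (ENNReal.mul_ne_top ENNReal.coe_ne_top hmem) (hc Z hmem))
  rw [ContinuousLinearMap.adjoint_inner_right, ENNReal.ofReal_pow (norm_nonneg _), ← h2] at h3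
  have h4 := h3.trans (mul_le_mul_right (hc Z hmem) _)
  rw [h1, sq, ← mul_assoc] at h4
  rcases eq_or_ne (powNormSq A (-(k : ℤ)) (C x)) 0 with h0 | h0
  · rw [h0]
    exact zero_le
  · rw [mul_comm (c : ℝ≥0∞)]
    exact (ENNReal.mul_le_mul_iff_left h0 hfin).1 h4

variable {T : ℝ} {f g u v : ℝ → H}

/-- The constant of integration is fixed by requiring w'' + Aw = g for a primitive w of u. As w'' =
v, this reads Aw = g - v, and A is invertible, so the primitive is given without any integral. Its
derivative is A^{-1}(f - v') = u. -/
theorem isSolution_primitive (hf : ContinuousOn f (Icc 0 T))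
    (hg : ∀ t ∈ Icc 0 T, HasDerivWithinAt g (f t) (Icc 0 T) t) (h : IsSolution A T f u v) :
    IsSolution A T g (fun t => -D.inv (v t - g t)) u := by
  have hgc : ContinuousOn g (Icc 0 T) := fun t ht => (hg t ht).continuousWithinAt
  have huc : ContinuousOn u (Icc 0 T) := fun t ht => (h.deriv t ht).continuousWithinAt
  have hlam : ∀ t, -D.inv (v t - g t) = D.lam (-D.lam (v t - g t)) := fun t => by
    rw [map_neg, lam_lam]
  have hint : ∀ {w : ℝ → H}, ContinuousOn w (Icc 0 T) → ∀ t ∈ Icc 0 T,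
      IntervalIntegrable w volume 0 t := fun hw t ht =>
    (hw.mono (Icc_subset_Icc_right ht.2)).intervalIntegrable_of_Icc ht.1
  refine ⟨fun t _ => ?_, fun s hs => ?_, huc, fun t ht => ?_, fun φ t ht => ?_⟩
  · rw [hlam]
    exact D.memPow_lam _
  · simp only [hlam]
    exact tendsto_powNormSq_lam
      ((D.lam.continuous.comp_continuousOn (h.cont_deriv.sub hgc)).neg s hs)
  · refine hasDerivWithinAt_of_eq_integral huc (fun t ht => ?_) ht
    refine repr_ext D.b fun i => ?_
    obtain ⟨d, hd, hd'⟩ := D.exists_domain_eq i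
    have h1 := h.weak d t ht
    have h2 := eq_integral_of_hasDerivWithinAt hf hg ht
    have h3 : inner 𝕜 (D.b i) (g t) = inner 𝕜 (D.b i) (g 0) +
        ∫ s in (0 : ℝ)..t, inner 𝕜 (D.b i) (f s) := by
      rw [h2, inner_add_right]
      congr 1
      exact ((innerSL 𝕜 (D.b i)).intervalIntegral_comp_comm (hint hf t ht)).symm
    have hμ : (D.μ i : 𝕜) ≠ 0 := by exact_mod_cast (D.μ_pos i).ne'
    have i1 : IntervalIntegrable (fun s => (inner 𝕜 (D.b i) (f s) : 𝕜)) volume 0 t :=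
      ⟨(innerSL 𝕜 (D.b i)).integrable_comp (hint hf t ht).1,
        (innerSL 𝕜 (D.b i)).integrable_comp (hint hf t ht).2⟩
    have i2 : IntervalIntegrable (fun s => (inner 𝕜 (D.b i) (u s) : 𝕜)) volume 0 t :=
      ⟨(innerSL 𝕜 (D.b i)).integrable_comp (hint huc t ht).1,
        (innerSL 𝕜 (D.b i)).integrable_comp (hint huc t ht).2⟩
    rw [hd, hd'] at h1
    simp only [inner_smul_left, RCLike.conj_ofReal] at h1
    rw [intervalIntegral.integral_sub i1 (i2.const_mul _), intervalIntegral.integral_const_mul] at h1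
    rw [repr_add, repr_integral (hint huc t ht), repr_neg, repr_neg, repr_inv, repr_inv, repr_sub,
      repr_sub, RCLike.ofReal_inv]
    simp only [D.b.repr_apply_apply]
    rw [h1, h3]
    field_simp
    ring
  · have hφ := LinearPMap.mem_graph A φ
    have h1 : ∀ s, inner 𝕜 (A φ) (-D.inv (v s - g s)) =
        inner 𝕜 (φ : H) (g s) - inner 𝕜 (φ : H) (v s) := fun s => by
      rw [inner_neg_right, D.inner_graph hφ (inv_graph (D := D) _), inner_sub_right, neg_sub]
    simp only [h1, sub_sub_cancel]
    have h2 := eq_integral_of_hasDerivWithinAt h.cont_deriv h.deriv ht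
    rw [h2, inner_add_right]
    congr 1
    exact ((innerSL 𝕜 (φ : H)).intervalIntegral_comp_comm (hint h.cont_deriv t ht)).symm

variable {n : ℕ} {C : ℕ → H →L[𝕜] H}

variable (D C) in
/-- The first components of the cascade obtained by integrating a cascade with derivatives `v` in
time. -/
def primitive (v : ℕ → ℝ → H) : ℕ → ℝ → H
  | 0 => 0
  | i + 1 => fun t =>
      -D.inv (v (i + 1) t - if i + 1 = 1 then 0 else -C (i + 1) (primitive v i t))

theorem primitive_eq (v : ℕ → ℝ → H) {i : ℕ} (hi : 1 ≤ i) :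
    D.primitive C v i = fun t => -D.inv (v i t - source C (D.primitive C v) i t) := by
  obtain ⟨j, rfl⟩ := Nat.exists_eq_add_of_le' hi
  rfl

theorem source_one (u : ℕ → ℝ → H) : source C u 1 = fun _ => 0 := by
  ext t; simp [source]

theorem source_succ (u : ℕ → ℝ → H) {i : ℕ} (hi : 1 ≤ i) :
    source C u (i + 1) = fun t => -C (i + 1) (u i t) := by
  ext t
  rw [source, if_neg (by omega), Nat.add_sub_cancel]

variable {u v : ℕ → ℝ → H}

theorem _root_.Cascade.IsCascadeSolution.continuousOn_source (h : IsCascadeSolution A n C T u v)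
    {i : ℕ} (hi : i ∈ Finset.Icc 1 n) : ContinuousOn (source C u i) (Icc 0 T) := by
  rw [Finset.mem_Icc] at hi
  obtain ⟨j, rfl⟩ := Nat.exists_eq_add_of_le' hi.1
  rcases Nat.eq_zero_or_pos j with rfl | hj
  · rw [zero_add, source_one]
    exact continuousOn_const
  · rw [source_succ u hj]
    refine ((C (j + 1)).continuous.comp_continuousOn fun t ht => ?_).neg
    exact ((h j (Finset.mem_Icc.2 ⟨hj, by omega⟩)).deriv t ht).continuousWithinAt

/-- The couplings do not depend on time. Once the primitive of component i has derivative u_i, the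
source it sends to component i + 1 is a primitive of the original source; hence the induction along
the cascade. -/
theorem _root_.Cascade.IsCascadeSolution.primitive (D : SpectralData A ι)
    (h : IsCascadeSolution A n C T u v) : IsCascadeSolution A n C T (D.primitive C v) u := by
  have key : ∀ i, 1 ≤ i → i ≤ n → IsSolution A T (source C (D.primitive C v) i)
      (D.primitive C v i) (u i) := by
    intro i hi
    induction i, hi using Nat.le_induction with
    | base =>
      intro hn
      rw [primitive_eq _ le_rfl]
      refine isSolution_primitive (h.continuousOn_source (Finset.mem_Icc.2 ⟨le_rfl, hn⟩)) ?_
        (h 1 (Finset.mem_Icc.2 ⟨le_rfl, hn⟩))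
      intro t _
      rw [source_one, source_one]
      exact hasDerivWithinAt_const _ _ _
    | succ i hi ih =>
      intro hn
      rw [primitive_eq _ (by omega)]
      refine isSolution_primitive (h.continuousOn_source (Finset.mem_Icc.2 ⟨by omega, hn⟩)) ?_
        (h (i + 1) (Finset.mem_Icc.2 ⟨by omega, hn⟩))
      intro t ht
      rw [source_succ _ hi, source_succ _ hi]
      have := ((C (i + 1)).restrictScalars ℝ).hasFDerivAt.comp_hasDerivWithinAt t
        ((ih (by omega)).deriv t ht)
      exact this.neg
  intro i hi
  rw [Finset.mem_Icc] at hi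
  exact key i hi.1 hi.2

variable (D C) in
/-- The cascade `(u, v)` integrated `p` times in time. -/
def iter (u v : ℕ → ℝ → H) : ℕ → (ℕ → ℝ → H) × (ℕ → ℝ → H)
  | 0 => (u, v)
  | p + 1 => (D.primitive C (iter u v p).2, (iter u v p).1)

theorem iter_primitive (u v : ℕ → ℝ → H) (p : ℕ) :
    D.iter C (D.primitive C v) u p = D.iter C u v (p + 1) := by
  induction p with
  | zero => rfl
  | succ p ih => rw [iter, ih]; rfl

theorem _root_.Cascade.IsCascadeSolution.iter (D : SpectralData A ι)
    (h : IsCascadeSolution A n C T u v) (p : ℕ) :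
    IsCascadeSolution A n C T (D.iter C u v p).1 (D.iter C u v p).2 := by
  induction p with
  | zero => exact h
  | succ p ih => exact ih.primitive D

/-- The first argument of the hypothesis is the primitive -A^{-1}(x - s), so its norm of order 1 - p
is the norm of x - s of order -p - 1. Adding back the source s recovers the velocity x; the order of
the energy drops by one. -/
theorem energy_le_of_primitive {p : ℕ} {a b : ℝ≥0∞} {w x s : H}
    (h : energy A (1 - (p : ℤ)) (-D.inv (x - s)) w ≤ a)
    (hs : powNormSq A (-(p : ℤ) - 1) s ≤ b) :
    energy A (1 - ((p + 1 : ℕ) : ℤ)) w x ≤ 3 * a + b := by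
  rw [energy, ENNReal.div_le_iff (by norm_num) (by norm_num)] at *
  have e1 : (1 - ((p + 1 : ℕ) : ℤ)) = -(p : ℤ) := by push_cast; ring
  have e2 : (1 - (p : ℤ) - 1) = -(p : ℤ) := by ring
  have e3 : (1 - (p : ℤ)) = -(p : ℤ) - 1 + 2 := by ring
  rw [e2, e3, D.powNormSq_neg, powNormSq_inv] at h
  rw [e1]
  have h2 := D.powNormSq_add_le (-(p : ℤ) - 1) (x - s) s
  rw [sub_add_cancel] at h2
  calc powNormSq A (-(p : ℤ)) w + powNormSq A (-(p : ℤ) - 1) x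
      ≤ a * 2 + 2 * (a * 2 + b) :=
        add_le_add (le_add_self.trans h) (h2.trans (by gcongr; exact le_self_add.trans h))
    _ = (3 * a + b) * 2 := by ring

/-- Energies of negative order are controlled by the energies of order one of time primitives. -/
theorem exists_energy_le (hadj : ∀ i ∈ Finset.Icc 2 n, ∀ k : ℕ, k ≤ n - i + 1 → ∃ c : ℝ≥0, ∀ u : H,
      MemPow A k u → powNormSq A k (ContinuousLinearMap.adjoint (C i) u) ≤ c * powNormSq A k u)
    (p i : ℕ) (hi : 1 ≤ i) (hip : i + p ≤ n) :
    ∃ c : ℝ≥0, ∀ (T : ℝ) (u v : ℕ → ℝ → H), IsCascadeSolution A n C T u v → ∀ t ∈ Icc 0 T,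
      ∀ N : ℝ≥0∞, (∀ l ∈ Finset.Icc 1 i, ‖D.st ((D.iter C u v (p + i - l)).1 l t)
        ((D.iter C u v (p + i - l)).2 l t)‖ₑ ^ 2 ≤ N) →
      energy A (1 - (p : ℤ)) (u i t) (v i t) ≤ c * N := by
  -- The outer induction is on p, the inner one on the component: the source of the primitive of
  -- component i + 1 contains the primitive of component i, which must be estimated with the same p.
  induction p generalizing i with
  | zero =>
    refine ⟨1, fun T u v h t ht N hN => ?_⟩
    have h1 := hN i (Finset.mem_Icc.2 ⟨hi, le_rfl⟩)
    rw [zero_add, Nat.sub_self] at h1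
    rw [Nat.cast_zero, sub_zero, ENNReal.coe_one, one_mul]
    exact (energy_one_le (D := D) ((h i (Finset.mem_Icc.2 ⟨hi, by omega⟩)).mem t ht)).trans h1
  | succ p ihp =>
    induction i, hi using Nat.le_induction with
    | base =>
      obtain ⟨c, hc⟩ := ihp 1 le_rfl (by omega)
      refine ⟨3 * c, fun T u v h t ht N hN => ?_⟩
      have h1 := hc T _ _ (h.primitive D) t ht N fun l hl => by
        have := hN l hl
        rw [Finset.mem_Icc] at hl
        rw [iter_primitive, show p + 1 - l + 1 = p + 1 + 1 - l by omega]
        exact this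
      rw [primitive_eq _ le_rfl, source_one] at h1
      refine (energy_le_of_primitive h1 (D.powNormSq_zero_right _).le).trans (le_of_eq ?_)
      push_cast
      ring
    | succ i hi ihi =>
      obtain ⟨c, hc⟩ := ihp (i + 1) (by omega) (by omega)
      obtain ⟨c', hc'⟩ := ihi (by omega)
      -- The coupling term is needed in the norm of order -(p+1), which by duality calls for the
      -- adjoint on H_{p+1}. This order is allowed because (i + 1) + (p + 1) ≤ n.
      obtain ⟨e, he⟩ := hadj (i + 1) (Finset.mem_Icc.2 ⟨by omega, by omega⟩) (p + 1) (by omega)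
      refine ⟨3 * c + e * (D.low⁻¹.toNNReal * (c' * 2)), fun T u v h t ht N hN => ?_⟩
      have h1 := hc T _ _ (h.primitive D) t ht N fun l hl => by
        have := hN l hl
        rw [Finset.mem_Icc] at hl
        rw [iter_primitive, show p + (i + 1) - l + 1 = p + 1 + (i + 1) - l by omega]
        exact this
      have h2 := hc' T _ _ (h.primitive D) t ht N fun l hl => by
        rw [Finset.mem_Icc] at hl
        have := hN l (Finset.mem_Icc.2 ⟨hl.1, by omega⟩)
        rw [iter_primitive, show p + 1 + i - l + 1 = p + 1 + (i + 1) - l by omega]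
        exact this
      rw [primitive_eq _ (by omega), source_succ _ hi] at h1
      have h3 : powNormSq A (-(p : ℤ)) (D.primitive C v i t) ≤ c' * N * 2 := by
        rw [energy, ENNReal.div_le_iff (by norm_num) (by norm_num)] at h2
        have e1 : (1 - ((p + 1 : ℕ) : ℤ)) = -(p : ℤ) := by push_cast; ring
        rw [e1] at h2
        exact le_self_add.trans h2
      have h4 := D.powNormSq_neg_le_of_adjoint (p + 1) he (D.primitive C v i t)
      have e2 : -((p + 1 : ℕ) : ℤ) = -(p : ℤ) - 1 := by push_cast; ring
      rw [e2] at h4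
      have h5 : powNormSq A (-(p : ℤ) - 1) (-C (i + 1) (D.primitive C v i t)) ≤
          e * (ENNReal.ofReal D.low⁻¹ * (c' * N * 2)) := by
        rw [D.powNormSq_neg]
        refine h4.trans ?_
        gcongr
        refine (powNormSq_pred_le (D := D) _ _).trans ?_
        gcongr
      refine (energy_le_of_primitive h1 h5).trans (le_of_eq ?_)
      push_cast
      rw [ENNReal.ofReal]
      ring

end SpectralData

/-! ### Summing lower bounds over windows of fixed length. -/

theorem nat_mul_le_lintegral_Ioc {g : ℝ → ℝ≥0∞} {a : ℝ≥0∞} {s L : ℝ} (hL : 0 ≤ L) (n : ℕ)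
    (h : ∀ k < n, a ≤ ∫⁻ t in Ioc (s + k * L) (s + k * L + L), g t) :
    n * a ≤ ∫⁻ t in Ioc s (s + n * L), g t := by
  induction n with
  | zero => simp
  | succ n ih =>
    have hn : (0 : ℝ) ≤ n * L := by positivity
    have e : s + ((n + 1 : ℕ) : ℝ) * L = s + n * L + L := by push_cast; ring
    rw [e, ← Ioc_union_Ioc_eq_Ioc (b := s + n * L) (by linarith) (by linarith),
      lintegral_union measurableSet_Ioc (Ioc_disjoint_Ioc_of_le le_rfl), Nat.cast_succ, add_mul, one_mul]
    exact add_le_add (ih fun k hk => h k (by omega)) (h n (by omega))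

/-- Lower bounds on windows of length `L` add up to a lower bound that is linear in the length of
the time interval, for a quantity `e` that varies slowly. -/
theorem exists_le_lintegral_of_windows {L K₀ c₀ K₁ : ℝ} (hL : 0 < L) (hK₀ : 0 < K₀) (hc₀ : 0 < c₀)
    (hK₁ : 0 ≤ K₁) :
    ∃ c T₁ : ℝ, 0 < c ∧ 0 < T₁ ∧ ∀ T, T₁ ≤ T → ∀ (e : ℝ → ℝ) (g : ℝ → ℝ≥0∞) (t₀ : ℝ), t₀ ∈ Icc 0 T →
      0 ≤ e t₀ →
      (∀ s ∈ Icc 0 T, |e t₀ - e s| ≤ K₀ / T * e t₀ * |t₀ - s|) →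
      (∀ s, 0 ≤ s → s + L ≤ T → ENNReal.ofReal (c₀ * e s ^ 2 - K₁ * (K₀ / T * e t₀) ^ 2) ≤
        ∫⁻ t in Ioc s (s + L), g t) →
      ENNReal.ofReal (c * T * e t₀ ^ 2) ≤ ∫⁻ t in Icc 0 T, g t := by
  -- On a stretch of length δT with an end at t₀, e changes by at most K₀δ e(t₀) ≤ e(t₀)/2. Since δ
  -- ≤ 1/2, such a stretch fits into [0, T] on one side of t₀.
  set δ := min (1 / 2) (1 / (2 * K₀)) with hδ
  have hδ0 : 0 < δ := lt_min (by norm_num) (by positivity)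
  have hδ1 : δ ≤ 1 / 2 := min_le_left _ _
  have hδ2 : K₀ * δ ≤ 1 / 2 := by
    have := mul_le_mul_of_nonneg_left (min_le_right (1 / 2) (1 / (2 * K₀))) hK₀.le
    refine this.trans (le_of_eq ?_)
    field_simp
  -- T ≥ 2L/δ makes the number of whole windows in the stretch at least δT/(2L). The second
  -- threshold makes the error at most (c₀/8) e(t₀)², half of the main term c₀(e(t₀)/2)²; its
  -- summand 1 serves to pass from T to T².
  refine ⟨δ / (2 * L) * (c₀ / 8), max (2 * L / δ) (1 + 8 * K₁ * K₀ ^ 2 / c₀), by positivity,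
    lt_max_of_lt_left (by positivity), fun T hT e g t₀ ht₀ hM hlip hwin => ?_⟩
  have hT1 : 2 * L / δ ≤ T := (le_max_left _ _).trans hT
  have hT2 : 1 + 8 * K₁ * K₀ ^ 2 / c₀ ≤ T := (le_max_right _ _).trans hT
  have hq : 0 ≤ 8 * K₁ * K₀ ^ 2 / c₀ := by positivity
  have hT0 : 0 < T := by linarith
  set M := e t₀ with hMdef
  obtain ⟨a, ha0, haT, ha⟩ : ∃ a, 0 ≤ a ∧ a + δ * T ≤ T ∧
      ∀ s, a ≤ s → s ≤ a + δ * T → |t₀ - s| ≤ δ * T := by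
    have h1 : δ * T ≤ 1 / 2 * T := mul_le_mul_of_nonneg_right hδ1 hT0.le
    rcases le_or_gt t₀ (T / 2) with h | h
    · exact ⟨t₀, ht₀.1, by linarith, fun s h1 h2 => by rw [abs_le]; constructor <;> linarith⟩
    · exact ⟨t₀ - δ * T, by linarith, by linarith [ht₀.2],
        fun s h1 h2 => by rw [abs_le]; constructor <;> linarith⟩
  have hlow : ∀ s, a ≤ s → s ≤ a + δ * T → M / 2 ≤ e s := by
    intro s h1 h2
    have h3 := (hlip s ⟨ha0.trans h1, h2.trans haT⟩).trans
      (mul_le_mul_of_nonneg_left (ha s h1 h2) (by positivity))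
    have h4 : K₀ / T * M * (δ * T) = K₀ * δ * M := by field_simp
    have h5 := (abs_le.1 h3).2
    have h6 := mul_le_mul_of_nonneg_right hδ2 hM
    linarith
  set n := ⌊δ * T / L⌋₊ with hn
  have hn1 : (n : ℝ) * L ≤ δ * T := by
    have := Nat.floor_le (show 0 ≤ δ * T / L by positivity)
    rwa [le_div_iff₀ hL] at this
  have hn2 : δ * T / (2 * L) ≤ n := by
    have h1 := Nat.lt_floor_add_one (δ * T / L)
    have h2 : 1 ≤ δ * T / (2 * L) := by
      rw [le_div_iff₀ (by positivity), one_mul]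
      rw [div_le_iff₀ hδ0] at hT1
      linarith
    have h3 : δ * T / L = δ * T / (2 * L) + δ * T / (2 * L) := by field_simp; ring
    rw [← hn] at h1
    linarith
  have herr : K₁ * (K₀ / T * M) ^ 2 ≤ c₀ / 8 * M ^ 2 := by
    have h1 : 8 * K₁ * K₀ ^ 2 ≤ c₀ * T ^ 2 := by
      have h2 : 8 * K₁ * K₀ ^ 2 / c₀ ≤ T ^ 2 := by nlinarith
      rwa [div_le_iff₀ hc₀, mul_comm (T ^ 2)] at h2
    have h3 : K₁ * (K₀ / T * M) ^ 2 = (8 * K₁ * K₀ ^ 2) * (M ^ 2 / (8 * T ^ 2)) := by field_simp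
    have h4 : c₀ / 8 * M ^ 2 = (c₀ * T ^ 2) * (M ^ 2 / (8 * T ^ 2)) := by field_simp
    rw [h3, h4]
    exact mul_le_mul_of_nonneg_right h1 (by positivity)
  have hsum := nat_mul_le_lintegral_Ioc (g := g) (s := a) (a := ENNReal.ofReal (c₀ / 8 * M ^ 2))
    hL.le n fun k hk => by
      have hk1 : (k : ℝ) * L + L ≤ n * L := by
        have : (k : ℝ) + 1 ≤ n := by exact_mod_cast hk
        nlinarith
      have hk0 : (0 : ℝ) ≤ k * L := by positivity
      refine le_trans (ENNReal.ofReal_le_ofReal ?_) (hwin _ (by linarith) (by linarith))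
      have h1 := hlow (a + k * L) (by linarith) (by linarith)
      have h2 : (M / 2) ^ 2 ≤ e (a + k * L) ^ 2 := pow_le_pow_left₀ (by linarith) h1 2
      have h3 := mul_le_mul_of_nonneg_left h2 hc₀.le
      linarith
  refine le_trans ?_ (hsum.trans (lintegral_mono_set ?_))
  · rw [← ENNReal.ofReal_natCast, ← ENNReal.ofReal_mul (Nat.cast_nonneg _)]
    apply ENNReal.ofReal_le_ofReal
    have h1 : δ / (2 * L) * (c₀ / 8) * T * M ^ 2 = δ * T / (2 * L) * (c₀ / 8 * M ^ 2) := by ring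
    rw [h1]
    exact mul_le_mul_of_nonneg_right hn2 (by positivity)
  · exact Ioc_subset_Icc_self.trans (Icc_subset_Icc ha0 (by linarith))

/-- From |a|² ≤ 2|b|² + 2|b - a|². It transfers an observability bound from a free solution, whose
observation is a, to a solution with small source. -/
theorem ofReal_sub_le_lintegral {α E : Type*} [MeasurableSpace α] {m : Measure α}
    [NormedAddCommGroup E] {a b : α → E} (hb : AEStronglyMeasurable b m) {p q : ℝ} (hq : 0 ≤ q)
    (h1 : ENNReal.ofReal (2 * p) ≤ ∫⁻ t, ‖a t‖ₑ ^ 2 ∂m)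
    (h2 : ∫⁻ t, ‖b t - a t‖ₑ ^ 2 ∂m ≤ ENNReal.ofReal q) :
    ENNReal.ofReal (p - q) ≤ ∫⁻ t, ‖b t‖ₑ ^ 2 ∂m := by
  have h3 : ∫⁻ t, ‖a t‖ₑ ^ 2 ∂m ≤ 2 * (∫⁻ t, ‖b t‖ₑ ^ 2 ∂m + ENNReal.ofReal q) := by
    refine le_trans ?_ (mul_le_mul_right (add_le_add_right h2 _) 2)
    rw [← lintegral_add_left' (hb.enorm.pow_const 2),
      ← lintegral_const_mul' _ _ (by norm_num)]
    refine lintegral_mono fun t => ?_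
    have h4 : ‖a t‖ ≤ ‖b t‖ + ‖b t - a t‖ := by
      have := norm_sub_le (b t) (b t - a t)
      rwa [sub_sub_cancel] at this
    have h5 : ‖a t‖ ^ 2 ≤ 2 * (‖b t‖ ^ 2 + ‖b t - a t‖ ^ 2) := by
      nlinarith [norm_nonneg (a t), sq_nonneg (‖b t‖ - ‖b t - a t‖)]
    have := ENNReal.ofReal_le_ofReal h5
    rw [ENNReal.ofReal_mul (by norm_num), ENNReal.ofReal_add (by positivity) (by positivity),
      ENNReal.ofReal_pow (norm_nonneg _), ENNReal.ofReal_pow (norm_nonneg _),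
      ENNReal.ofReal_pow (norm_nonneg _), ofReal_norm, ofReal_norm, ofReal_norm] at this
    simpa using this
  rw [ENNReal.ofReal_sub _ hq]
  refine tsub_le_iff_right.2 ?_
  have h4 := h1.trans h3
  rw [ENNReal.ofReal_mul (by norm_num), ENNReal.ofReal_ofNat] at h4
  exact (ENNReal.mul_le_mul_iff_right (by norm_num) (by norm_num)).1 h4

theorem lintegral_Ioc_eq_shift (g : ℝ → ℝ≥0∞) (s L : ℝ) :
    ∫⁻ t in Ioc s (s + L), g t = ∫⁻ t in Icc 0 L, g (s + t) := by
  have h := (measurePreserving_shift s L).lintegral_comp_emb (measurableEmbedding_addLeft s) g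
  rw [h, restrict_Ioc_eq_restrict_Icc]

/-! ### A coupled pair of equations in large time. -/

namespace SpectralData

variable {𝕜 : Type*} [RCLike 𝕜]
variable {H : Type*} [NormedAddCommGroup H] [InnerProductSpace 𝕜 H] [CompleteSpace H]
variable [NormedSpace ℝ H]
variable {A : H →ₗ.[𝕜] H} {ι : Type*} {D : SpectralData A ι}
variable {T : ℝ} {f : ℝ → H} {X Y : ℝ → WithLp 2 (H × H)}

theorem st_lam (x : WithLp 2 (H × H)) : D.st (D.lam x.fst) x.snd = x := by
  rw [st, root_lam]
  rfl

theorem norm_sub_free_le {L c : ℝ} (hf : IntegrableOn f (Icc 0 T)) (hX : IsMild D T f X)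
    (hc : ∀ t ∈ Icc 0 T, ‖f t‖ ≤ c) {s : ℝ} (hs : 0 ≤ s) (hL : s + L ≤ T) {t : ℝ}
    (ht : t ∈ Icc 0 L) : ‖X (s + t) - D.rot (-t) (X s)‖ ≤ c * L := by
  have hc' : ∀ r ∈ Icc 0 L, ‖f (s + r)‖ ≤ c := fun r hr =>
    hc _ ⟨by linarith [hr.1], by linarith [hr.2]⟩
  have h0 : (0 : ℝ) ∈ Icc 0 L := ⟨le_rfl, ht.1.trans ht.2⟩
  have hc0 : 0 ≤ c := (norm_nonneg _).trans (hc' 0 h0)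
  have hfs := integrableOn_shift hf hs hL
  have h := (hX.shift hf hs hL).sub hfs (integrableOn_zero) (D.isMild_free L (X s))
  have hfs' : IntegrableOn (fun t => f (s + t) - 0) (Icc 0 L) := by simpa using hfs
  have h1 := h.abs_norm_sub_le_mul hfs' (c := c) (by simpa using hc') h0 ht
  rw [add_zero, neg_zero, rot_zero, sub_self, norm_zero, sub_zero, abs_norm, sub_zero,
    abs_of_nonneg ht.1] at h1
  exact h1.trans (mul_le_mul_of_nonneg_left ht.2 hc0)

/-- The free solution with the same state at time s is observable in the fixed time L. The true
solution stays within cL of it on the window, and the squared error integrates to at most ‖C‖²L³c².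
-/
theorem window_velocity {C : H →L[𝕜] H} {L c : ℝ} {γ : ℝ≥0} (hL0 : 0 ≤ L)
    (hγ : ∀ w v : ℝ → H, IsSolution A L (fun _ => 0) w v →
      γ * energy A 1 (w 0) (v 0) ≤ ∫⁻ t in Icc 0 L, ‖C (v t)‖ₑ ^ 2)
    (hf : IntegrableOn f (Icc 0 T)) (hX : IsMild D T f X)
    (hc : ∀ t ∈ Icc 0 T, ‖f t‖ ≤ c) {s : ℝ} (hs : 0 ≤ s) (hL : s + L ≤ T) :
    ENNReal.ofReal (γ / 4 * ‖X s‖ ^ 2 - ‖C‖ ^ 2 * L ^ 3 * c ^ 2) ≤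
      ∫⁻ t in Ioc s (s + L), ‖C (X t).snd‖ₑ ^ 2 := by
  have h1 := hγ _ _ (isSolution_of_isMild (D := D) integrableOn_zero (D.isMild_free L (X s)))
  beta_reduce at h1
  rw [neg_zero, rot_zero, energy_one (D := D) (D.memPow_lam _), st_lam, ← ENNReal.ofReal_coe_nnreal,
    ← ENNReal.ofReal_mul γ.coe_nonneg, show (γ : ℝ) * (‖X s‖ ^ 2 / 2) = 2 * (γ / 4 * ‖X s‖ ^ 2) by ring] at h1
  rw [lintegral_Ioc_eq_shift fun t => ‖C (X t).snd‖ₑ ^ 2]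
  have hcont : ContinuousOn (fun t => C (X (s + t)).snd) (Icc 0 L) :=
    C.continuous.comp_continuousOn (continuous_snd.comp_continuousOn
      ((hX.shift hf hs hL).continuousOn (integrableOn_shift hf hs hL)))
  have h0 : (0 : ℝ) ∈ Icc 0 T := ⟨le_rfl, by linarith⟩
  have hc0 : 0 ≤ c := (norm_nonneg _).trans (hc 0 h0)
  refine ofReal_sub_le_lintegral (hcont.aestronglyMeasurable measurableSet_Icc) (by positivity) h1 ?_
  calc ∫⁻ t in Icc 0 L, ‖C (X (s + t)).snd - C (D.rot (-t) (X s)).snd‖ₑ ^ 2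
      ≤ ∫⁻ _ in Icc 0 L, ENNReal.ofReal ((‖C‖ * (c * L)) ^ 2) := by
        refine setLIntegral_mono measurable_const fun t ht => ?_
        rw [← map_sub, ← ofReal_norm, ← ENNReal.ofReal_pow (norm_nonneg _)]
        apply ENNReal.ofReal_le_ofReal
        refine pow_le_pow_left₀ (norm_nonneg _) ((C.le_opNorm _).trans ?_) 2
        refine mul_le_mul_of_nonneg_left ?_ (norm_nonneg _)
        exact (norm_snd_le (X (s + t) - D.rot (-t) (X s))).trans (norm_sub_free_le hf hX hc hs hL ht)
    _ = ENNReal.ofReal (‖C‖ ^ 2 * L ^ 3 * c ^ 2) := by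
        rw [setLIntegral_const, Real.volume_Icc, ← ENNReal.ofReal_mul (by positivity)]
        congr 1
        ring

theorem IsMild.exists_norm_max (hT : 0 ≤ T) (hf : IntegrableOn f (Icc 0 T)) (hX : IsMild D T f X) :
    ∃ t₀ ∈ Icc 0 T, ∀ t ∈ Icc 0 T, ‖X t‖ ≤ ‖X t₀‖ :=
  isCompact_Icc.exists_isMaxOn (nonempty_Icc.2 hT) (hX.continuousOn hf).norm

/-- A solution that drives a second equation through its velocity is small compared to the solution
of the second equation, in large time. -/
theorem exists_norm_le_of_coupled {C : H →L[𝕜] H} {α : ℝ} (hα : 0 < α)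
    (hC : ∀ x, α * ‖C x‖ ^ 2 ≤ RCLike.re (inner 𝕜 (C x) x)) {L : ℝ} (hL : 0 < L)
    (hobs : VelocityObservableAt A C L) {K₀ : ℝ} (hK₀ : 0 < K₀) :
    ∃ K T₁ : ℝ, 0 < K ∧ 0 < T₁ ∧ ∀ T, T₁ ≤ T → ∀ (f : ℝ → H) (X Y : ℝ → WithLp 2 (H × H)) (N : ℝ),
      ContinuousOn f (Icc 0 T) → IsMild D T f X → IsMild D T (fun t => -C (X t).snd) Y →
      (∀ M, (∀ t ∈ Icc 0 T, ‖X t‖ ≤ M) → ∀ t ∈ Icc 0 T, ‖f t‖ ≤ K₀ / T * M) →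
      (∀ t ∈ Icc 0 T, ‖Y t‖ ≤ N) → ∀ t ∈ Icc 0 T, ‖X t‖ ≤ K / T * N := by
  obtain ⟨γ, hγ0, hγ⟩ := hobs
  obtain ⟨c, T₁, hc0, hT₁, hwin⟩ := exists_le_lintegral_of_windows (c₀ := γ / 4)
    (K₁ := ‖C‖ ^ 2 * L ^ 3) hL hK₀ (by positivity) (by positivity)
  refine ⟨(2 + K₀) / (α * c), T₁, by positivity, hT₁, fun T hT f X Y N hf hX hY hfX hYN => ?_⟩
  have hT0 : 0 < T := hT₁.trans_le hT
  have hfi : IntegrableOn f (Icc 0 T) := hf.integrableOn_Icc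
  obtain ⟨t₀, ht₀, hmax⟩ := hX.exists_norm_max hT0.le hfi
  have hfM := hfX _ hmax
  set M := ‖X t₀‖ with hM
  have h0 : (0 : ℝ) ∈ Icc 0 T := ⟨le_rfl, hT0.le⟩
  have hTT : T ∈ Icc 0 T := ⟨hT0.le, le_rfl⟩
  have hN0 : 0 ≤ N := (norm_nonneg _).trans (hYN 0 h0)
  -- The lower bound is cTM², quadratic in M = sup‖X‖ with a factor T, while the upper bound below
  -- is a constant times MN. Dividing by M yields the decay in 1/T.
  have hlow := hwin T hT (fun t => ‖X t‖) (fun t => ‖C (X t).snd‖ₑ ^ 2) t₀ ht₀ (norm_nonneg _)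
    (fun s hs => hX.abs_norm_sub_le_mul hfi hfM hs ht₀)
    (fun s hs hsL => window_velocity hL.le hγ hfi hX hfM hs hsL)
  beta_reduce at hlow
  rw [← hM] at hlow
  have hXs : ContinuousOn (fun t => (X t).snd) (Icc 0 T) :=
    continuous_snd.comp_continuousOn (hX.continuousOn hfi)
  have hCX : ContinuousOn (fun t => C (X t).snd) (Icc 0 T) := C.continuous.comp_continuousOn hXs
  have hC2 : ContinuousOn (fun t => ‖C (X t).snd‖ ^ 2) (Icc 0 T) := hCX.norm.pow 2
  have hYs : ContinuousOn (fun t => (Y t).snd) (Icc 0 T) :=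
    continuous_snd.comp_continuousOn (hY.continuousOn hCX.neg.integrableOn_Icc)
  have hint : ∀ {g : ℝ → ℝ}, ContinuousOn g (Icc 0 T) → IntervalIntegrable g volume 0 T :=
    fun hg => hg.intervalIntegrable_of_Icc hT0.le
  have hlow' : c * T * M ^ 2 ≤ ∫ t in (0 : ℝ)..T, ‖C (X t).snd‖ ^ 2 := by
    rw [intervalIntegral.integral_of_le hT0.le, ← integral_Icc_eq_integral_Ioc]
    have he : ∫⁻ t in Icc 0 T, ‖C (X t).snd‖ₑ ^ 2 =
        ENNReal.ofReal (∫ t in Icc 0 T, ‖C (X t).snd‖ ^ 2) := by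
      rw [ofReal_integral_eq_lintegral_ofReal hC2.integrableOn_Icc
        (Eventually.of_forall fun t => by positivity)]
      refine lintegral_congr fun t => ?_
      rw [ENNReal.ofReal_pow (norm_nonneg _), ofReal_norm]
    rw [he] at hlow
    exact (ENNReal.ofReal_le_ofReal_iff (integral_nonneg fun t => by positivity)).1 hlow
  -- The variation of Re⟨X, Y⟩ is minus the integral of the coercive term plus that of Re⟨f, Y.snd⟩.
  -- The two boundary values contribute at most 2MN, and the source at most T · (K₀/T)MN.
  have hid := congrArg RCLike.re (hX.inner_sub_inner hT0.le hf hCX.neg hY)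
  have hup : α * ∫ t in (0 : ℝ)..T, ‖C (X t).snd‖ ^ 2 ≤ (2 + K₀) * M * N := by
    have hi : ContinuousOn (fun t => inner 𝕜 (X t).snd (-C (X t).snd) + inner 𝕜 (f t) (Y t).snd)
        (Icc 0 T) := (hXs.inner hCX.neg).add (hf.inner hYs)
    have hi' : ContinuousOn (fun t => RCLike.re (inner 𝕜 (X t).snd (-C (X t).snd) +
        inner 𝕜 (f t) (Y t).snd)) (Icc 0 T) := RCLike.continuous_re.comp_continuousOn hi
    have hre : RCLike.re (∫ t in (0 : ℝ)..T,
        (inner 𝕜 (X t).snd (-C (X t).snd) + inner 𝕜 (f t) (Y t).snd)) =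
        ∫ t in (0 : ℝ)..T, RCLike.re
          (inner 𝕜 (X t).snd (-C (X t).snd) + inner 𝕜 (f t) (Y t).snd) :=
      (RCLike.reCLM.intervalIntegral_comp_comm (hi.intervalIntegrable_of_Icc hT0.le)).symm
    have hid := hid.trans hre
    have hin : ∀ {x y : WithLp 2 (H × H)} {p q : ℝ}, ‖x‖ ≤ p → ‖y‖ ≤ q → 0 ≤ p →
        |RCLike.re (inner 𝕜 x y)| ≤ p * q := fun hx hy hp =>
      (RCLike.abs_re_le_norm _).trans ((norm_inner_le_norm _ _).trans
        (mul_le_mul hx hy (norm_nonneg _) hp))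
    have hb1 := hin (hmax T hTT) (hYN T hTT) (norm_nonneg _)
    have hb0 := hin (hmax 0 h0) (hYN 0 h0) (norm_nonneg _)
    rw [map_sub] at hid
    have hmono : ∫ t in (0 : ℝ)..T, (α * ‖C (X t).snd‖ ^ 2 + RCLike.re
          (inner 𝕜 (X t).snd (-C (X t).snd) + inner 𝕜 (f t) (Y t).snd)) ≤
        ∫ t in (0 : ℝ)..T, K₀ / T * M * N := by
      refine intervalIntegral.integral_mono_on hT0.le (hint ?_) (hint continuousOn_const)
        fun t ht => ?_
      · exact (hC2.const_mul α).add hi'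
      · have h1 := hC (X t).snd
        have h2 : RCLike.re (inner 𝕜 (X t).snd (C (X t).snd)) =
            RCLike.re (inner 𝕜 (C (X t).snd) (X t).snd) := inner_re_symm _ _
        have h3 : RCLike.re (inner 𝕜 (f t) (Y t).snd) ≤ K₀ / T * M * N :=
          (RCLike.re_le_norm _).trans ((norm_inner_le_norm _ _).trans
            (mul_le_mul (hfM t ht) ((norm_snd_le _).trans (hYN t ht)) (norm_nonneg _)
              (by positivity)))
        rw [map_add, inner_neg_right, map_neg, h2]
        linarith
    rw [intervalIntegral.integral_add (hint (hC2.const_mul α))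
      (hint hi'), intervalIntegral.integral_const_mul,
      intervalIntegral.integral_const, smul_eq_mul, sub_zero, ← hid] at hmono
    have h4 : T * (K₀ / T * M * N) = K₀ * M * N := by field_simp
    rw [h4] at hmono
    linarith [(abs_le.1 hb1).1, (abs_le.1 hb0).2]
  have hfin : α * (c * T * M ^ 2) ≤ (2 + K₀) * M * N :=
    (mul_le_mul_of_nonneg_left hlow' hα.le).trans hup
  intro t ht
  refine (hmax t ht).trans ?_
  rcases (show 0 ≤ M from norm_nonneg _).eq_or_lt with h | h
  · rw [← h]
    positivity
  · rw [div_div, div_mul_eq_mul_div, le_div_iff₀ (by positivity)]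
    refine le_of_mul_le_mul_left ?_ h
    linarith

end SpectralData

/-! ### Sufficiency: observability of the cascade in large time. -/

namespace SpectralData

variable {𝕜 : Type*} [RCLike 𝕜]
variable {H : Type*} [NormedAddCommGroup H] [InnerProductSpace 𝕜 H] [CompleteSpace H]
variable [NormedSpace ℝ H]
variable {A : H →ₗ.[𝕜] H} {ι : Type*} {D : SpectralData A ι}
variable {n : ℕ} {C : ℕ → H →L[𝕜] H}

theorem _root_.Cascade.IsCascadeSolution.isMild {T : ℝ} {u v : ℕ → ℝ → H} (D : SpectralData A ι)
    (h : IsCascadeSolution A n C T u v) {i : ℕ} (hi : 1 ≤ i) (hin : i ≤ n) :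
    IsMild D T (source C u i) fun t => D.st (u i t) (v i t) :=
  isMild_of_isSolution (h.continuousOn_source (Finset.mem_Icc.2 ⟨hi, hin⟩)).integrableOn_Icc
    (h i (Finset.mem_Icc.2 ⟨hi, hin⟩))

variable (D) in
/-- In a cascade, the component `i - 1` is small compared to the component `i` in large time. -/
theorem exists_source_le (hC : CouplingAssumption A n C C) (hobs : CouplingsObservable A n C)
    (i : ℕ) (hi : 1 ≤ i) (hin : i ≤ n) :
    ∃ K T₁ : ℝ, 0 < K ∧ 0 < T₁ ∧ ∀ T, T₁ ≤ T → ∀ u v : ℕ → ℝ → H, IsCascadeSolution A n C T u v →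
      ∀ N, (∀ t ∈ Icc 0 T, ‖D.st (u i t) (v i t)‖ ≤ N) →
        (∀ t ∈ Icc 0 T, ‖source C u i t‖ ≤ K / T * N) ∧
        (2 ≤ i → ∀ t ∈ Icc 0 T,
          ‖D.st (D.primitive C v (i - 1) t) (u (i - 1) t)‖ ≤ K / T * N) := by
  induction i, hi using Nat.le_induction with
  | base =>
    refine ⟨1, 1, one_pos, one_pos, fun T hT u v _ N hN => ⟨fun t ht => ?_, fun h => by omega⟩⟩
    have hN0 : 0 ≤ N := (norm_nonneg _).trans (hN t ht)
    rw [source_one, norm_zero]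
    positivity
  | succ i hi ih =>
    obtain ⟨K₀, T₀, hK₀, hT₀, h₀⟩ := ih (by omega)
    have hmem : i + 1 ∈ Finset.Icc 2 n := Finset.mem_Icc.2 ⟨by omega, hin⟩
    obtain ⟨-, -, α, hα, hCα⟩ := hC _ hmem
    obtain ⟨L, hL, hobs'⟩ := hobs _ hmem
    obtain ⟨K, T₁, hK, hT₁, h₁⟩ := exists_norm_le_of_coupled (D := D) hα hCα
      (show 0 < L + 1 by linarith) (hobs' _ (by linarith)) hK₀
    refine ⟨(‖C (i + 1)‖ + 1) * K, max T₀ T₁, by positivity, lt_max_of_lt_left hT₀,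
      fun T hT u v h N hN => ?_⟩
    have hT0 : 0 < T := hT₀.trans_le ((le_max_left _ _).trans hT)
    have hN0 : 0 ≤ N := (norm_nonneg _).trans (hN 0 ⟨le_rfl, hT0.le⟩)
    -- The pair is component i of the integrated cascade, whose velocity is u_i, and component i + 1
    -- of the original cascade, whose source is -C_{i+1} u_i. The induction hypothesis is applied to
    -- the integrated cascade.
    have hp := h.primitive D
    have hY : IsMild D T (fun t => -C (i + 1) (u i t))
        fun t => D.st (u (i + 1) t) (v (i + 1) t) := by
      rw [← source_succ u hi]
      exact h.isMild D (by omega) hin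
    have key := h₁ T ((le_max_right _ _).trans hT) _ _ _ N
      (hp.continuousOn_source (Finset.mem_Icc.2 ⟨hi, by omega⟩)) (hp.isMild D hi (by omega)) hY
      (fun M hM => (h₀ T ((le_max_left _ _).trans hT) _ _ hp M hM).1) hN
    refine ⟨fun t ht => ?_, fun _ t ht => (key t ht).trans ?_⟩
    · rw [source_succ u hi, norm_neg]
      refine ((C (i + 1)).le_opNorm _).trans ?_
      have h1 : ‖u i t‖ ≤ K / T * N :=
        (norm_snd_le (D.st (D.primitive C v i t) (u i t))).trans (key t ht)
      have h2 : (‖C (i + 1)‖ + 1) * K / T * N = (‖C (i + 1)‖ + 1) * (K / T * N) := by ring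
      rw [h2]
      have h3 : 0 ≤ K / T * N := by positivity
      exact mul_le_mul (by linarith) h1 (norm_nonneg _) (by positivity)
    · gcongr
      nlinarith [norm_nonneg (C (i + 1))]

variable (D) in
-- `exists_source_le` applied repeatedly from component n downwards: each step costs one integration
-- in time and a factor K/T, which is bounded as T stays above a threshold.
theorem exists_iter_le (hC : CouplingAssumption A n C C) (hobs : CouplingsObservable A n C)
    (d : ℕ) (hd : d + 1 ≤ n) :
    ∃ K T₁ : ℝ, 0 < K ∧ 0 < T₁ ∧ ∀ T, T₁ ≤ T → ∀ u v : ℕ → ℝ → H, IsCascadeSolution A n C T u v →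
      ∀ N, (∀ t ∈ Icc 0 T, ‖D.st (u n t) (v n t)‖ ≤ N) → ∀ t ∈ Icc 0 T,
        ‖D.st ((D.iter C u v d).1 (n - d) t) ((D.iter C u v d).2 (n - d) t)‖ ≤ K * N := by
  induction d with
  | zero => exact ⟨1, 1, one_pos, one_pos, fun T _ u v _ N hN t ht => by
      rw [one_mul]
      exact hN t ht⟩
  | succ d ih =>
    obtain ⟨K, T₁, hK, hT₁, h₁⟩ := ih (by omega)
    obtain ⟨K₂, T₂, hK₂, hT₂, h₂⟩ := D.exists_source_le hC hobs (n - d) (by omega) (by omega)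
    refine ⟨K₂ / T₂ * K, max T₁ T₂, by positivity, lt_max_of_lt_left hT₁,
      fun T hT u v h N hN t ht => ?_⟩
    have h3 := (h₂ T ((le_max_right _ _).trans hT) _ _ (h.iter D d) _
      (h₁ T ((le_max_left _ _).trans hT) u v h N hN)).2 (by omega) t ht
    have hN0 : 0 ≤ N := (norm_nonneg _).trans (hN t ht)
    have hT2 := (le_max_right _ _).trans hT
    rw [mul_assoc]
    refine le_trans ?_ (h3.trans ?_)
    · rw [Nat.sub_sub]
      rfl
    · gcongr

variable {G : Type*} [NormedAddCommGroup G] [InnerProductSpace 𝕜 G] [CompleteSpace G]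
variable {B : (A.domain × H) →ₗ[𝕜] G}

/-- The comparison with a free solution, now through B. The error is the observation of a solution
with zero initial state and source f on the window, so `ObsBound` controls it although B is
unbounded on the energy space in general. -/
theorem window_observation (D : SpectralData A ι) (hB : Admissible A B) {L c T : ℝ} {R K : ℝ≥0}
    (hL0 : 0 < L)
    (hK : D.ObsBound B L K)
    (hR : ∀ w v : ℝ → H, IsSolution A L (fun _ => 0) w v →
      ∃ y : ℝ → G, IsObservation A B L (fun _ => 0) w v y ∧
        R * energy A 1 (w 0) (v 0) ≤ ∫⁻ t in Icc 0 L, ‖y t‖ₑ ^ 2)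
    {f w v : ℝ → H} {y : ℝ → G} (hf : IsL2 T f) (hw : IsSolution A T f w v)
    (hy : IsObservation A B T f w v y)
    (hc : ∀ t ∈ Icc 0 T, ‖f t‖ ≤ c) {s : ℝ} (hs : 0 ≤ s) (hL : s + L ≤ T) :
    ENNReal.ofReal (R / 4 * ‖D.st (w s) (v s)‖ ^ 2 - K ^ 2 * L * c ^ 2) ≤
      ∫⁻ t in Ioc s (s + L), ‖y t‖ₑ ^ 2 := by
  have hsT : s ∈ Icc 0 T := ⟨hs, by linarith⟩
  have h0 : (0 : ℝ) ∈ Icc 0 L := ⟨le_rfl, hL0.le⟩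
  have hc0 : 0 ≤ c := (norm_nonneg _).trans (hc s hsT)
  set x := D.st (w s) (v s) with hx
  have hfree := isSolution_of_isMild (D := D) integrableOn_zero (D.isMild_free L x)
  obtain ⟨z, hz, hRz⟩ := hR _ _ hfree
  rw [neg_zero, rot_zero, energy_one (D := D) (D.memPow_lam _), st_lam, ← ENNReal.ofReal_coe_nnreal,
    ← ENNReal.ofReal_mul R.coe_nonneg,
    show (R : ℝ) * (‖x‖ ^ 2 / 2) = 2 * (R / 4 * ‖x‖ ^ 2) by ring] at hRz
  rw [lintegral_Ioc_eq_shift fun t => ‖y t‖ₑ ^ 2]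
  have hys := hy.shift D hB hw hf hs hL hL0.le
  refine ofReal_sub_le_lintegral hys.1.1 (by positivity) hRz ?_
  have hfs := hf.shift hs hL
  have hws := D.isSolution_shift hf hw hs hL
  have hd := hys.sub D hz hfs isL2_zero hL0.le hws hfree hB
  have hb := hd.eLpNorm_le hK hB (MemLp.sub hfs isL2_zero)
    (D.memPow_sub (hws.mem 0 h0) (hfree.mem 0 h0)) hL0.le
  have e0 : D.st (((fun t => w (s + t)) - fun t => D.lam (D.rot (-t) x).fst) 0)
      (((fun t => v (s + t)) - fun t => (D.rot (-t) x).snd) 0) = 0 := by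
    rw [Pi.sub_apply, Pi.sub_apply, st_sub (hws.mem 0 h0) (hfree.mem 0 h0), neg_zero, rot_zero,
      st_lam, add_zero, hx, sub_self]
  rw [e0, enorm_zero, zero_add] at hb
  have hfc : eLpNorm ((fun t => f (s + t)) - fun _ => 0) 2 (volume.restrict (Icc 0 L)) ^ 2 ≤
      ENNReal.ofReal (L * c ^ 2) := by
    rw [← lintegral_enorm_sq]
    calc ∫⁻ t in Icc 0 L, ‖f (s + t) - (0 : H)‖ₑ ^ 2
        ≤ ∫⁻ _ in Icc 0 L, ENNReal.ofReal (c ^ 2) := by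
          refine setLIntegral_mono measurable_const fun t ht => ?_
          rw [sub_zero, ← ofReal_norm, ← ENNReal.ofReal_pow (norm_nonneg _)]
          apply ENNReal.ofReal_le_ofReal
          exact pow_le_pow_left₀ (norm_nonneg _)
            (hc _ ⟨by linarith [ht.1], by linarith [ht.2]⟩) 2
      _ = ENNReal.ofReal (L * c ^ 2) := by
          rw [setLIntegral_const, Real.volume_Icc, ← ENNReal.ofReal_mul (by positivity), sub_zero,
            mul_comm]
  calc ∫⁻ t in Icc 0 L, ‖y (s + t) - z t‖ₑ ^ 2
      = eLpNorm ((fun t => y (s + t)) - z) 2 (volume.restrict (Icc 0 L)) ^ 2 := by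
        rw [← lintegral_enorm_sq]
        rfl
    _ ≤ (K * eLpNorm ((fun t => f (s + t)) - fun _ => 0) 2 (volume.restrict (Icc 0 L))) ^ 2 := by
        gcongr
    _ ≤ ENNReal.ofReal (K ^ 2 * L * c ^ 2) := by
        rw [mul_pow, mul_assoc, ENNReal.ofReal_mul (by positivity)]
        refine mul_le_mul' (le_of_eq ?_) hfc
        rw [ENNReal.ofReal_pow K.coe_nonneg, ENNReal.ofReal_coe_nnreal]

/-- The cascade is observable in large time if the couplings and the last equation are. -/
theorem exists_cascadeObservableAt (D : SpectralData A ι) (hn : 1 ≤ n) (hB : Admissible A B)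
    (hC : CouplingAssumption A n C C) (hobs : CouplingsObservable A n C) (hobsB : Observable A B) :
    ∃ T₁ : ℝ, 0 < T₁ ∧ ∀ T, T₁ < T → CascadeObservableAt A n C B T := by
  obtain ⟨L', hL', hobsB⟩ := hobsB
  set L := L' + 1 with hL
  have hL0 : 0 < L := by linarith
  obtain ⟨R, hR0, hR⟩ := hobsB L (by linarith)
  obtain ⟨KB, hKB⟩ := D.exists_obsBound hB hL0
  obtain ⟨Kn, Tn, hKn, hTn, hsrc⟩ := D.exists_source_le hC hobs n hn le_rfl
  obtain ⟨c, T₁, hc0, hT₁, hwin⟩ := exists_le_lintegral_of_windows (c₀ := R / 4)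
    (K₁ := KB ^ 2 * L) hL0 hKn (by positivity) (by positivity)
  choose! Kd Td hKd hTd hiter using fun d hd => D.exists_iter_le hC hobs d hd
  have hadj := fun i hi => (hC i hi).1
  choose! ce hce using fun i (hi : i ∈ Finset.Icc 1 n) => exists_energy_le (D := D) hadj (n - i) i
    (Finset.mem_Icc.1 hi).1 (by have := (Finset.mem_Icc.1 hi).2; omega)
  -- Sums stand in for maxima: this threshold exceeds each `Td d`, and `Km` exceeds each `Kd d`.
  set Tm := T₁ + Tn + ∑ d ∈ Finset.range n, Td d with hTm
  have hsum0 : 0 ≤ ∑ d ∈ Finset.range n, Td d := Finset.sum_nonneg fun d hd =>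
    (hTd d (Finset.mem_range.1 hd)).le
  set Km := ∑ d ∈ Finset.range n, Kd d with hKm
  have hKd0 : ∀ d ∈ Finset.range n, 0 ≤ Kd d := fun d hd => (hKd d (Finset.mem_range.1 hd)).le
  refine ⟨Tm, by positivity, fun T hT => ?_⟩
  have hT0 : 0 < T := by linarith
  have h0 : (0 : ℝ) ∈ Icc 0 T := ⟨le_rfl, hT0.le⟩
  have hnn : n ∈ Finset.Icc 1 n := Finset.mem_Icc.2 ⟨hn, le_rfl⟩
  have hb0 : 0 ≤ Km ^ 2 / (c * T) := by positivity
  set q : ℝ≥0 := (∑ i ∈ Finset.Icc 1 n, ce i) * (Km ^ 2 / (c * T)).toNNReal + 1 with hq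
  have hq0 : q ≠ 0 := by positivity
  refine ⟨q⁻¹, inv_pos.2 (pos_iff_ne_zero.2 hq0), fun u v h => ?_⟩
  have hsn := h.continuousOn_source hnn
  have hfL := isL2_of_continuousOn hsn
  obtain ⟨y, hy⟩ := D.exists_isObservation hB hT0 hfL (h n hnn)
  refine ⟨y, hy, ?_⟩
  rw [ENNReal.coe_inv hq0, ENNReal.inv_mul_le_iff (by exact_mod_cast hq0) ENNReal.coe_ne_top]
  have hX := h.isMild D hn le_rfl
  obtain ⟨t₀, ht₀, hmax⟩ := hX.exists_norm_max hT0.le hfL.integrableOn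
  have hfM := (hsrc T (by linarith) u v h _ hmax).1
  -- The source of the last component is at most Kn/T times its largest state norm, so the windows
  -- sum up for the observation as well.
  have hlow := hwin T (by linarith) (fun t => ‖D.st (u n t) (v n t)‖) (fun t => ‖y t‖ₑ ^ 2) t₀ ht₀
    (norm_nonneg _) (fun s hs => hX.abs_norm_sub_le_mul hfL.integrableOn hfM hs ht₀)
    (fun s hs hsL => window_observation D hB hL0 hKB hR hfL (h n hnn) hy hfM hs hsL)
  beta_reduce at hlow
  set M := ‖D.st (u n t₀) (v n t₀)‖ with hM
  have hE : ∀ i ∈ Finset.Icc 1 n, energy A (1 + (i : ℤ) - (n : ℤ)) (u i 0) (v i 0) ≤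
      ce i * ENNReal.ofReal ((Km * M) ^ 2) := by
    intro i hi
    have hin := Finset.mem_Icc.1 hi
    have e1 : 1 + (i : ℤ) - (n : ℤ) = 1 - ((n - i : ℕ) : ℤ) := by omega
    rw [e1]
    -- With p = n - i, component l is integrated n - l times whatever i is: exactly the iterate that
    -- `exists_iter_le` bounds by component n.
    refine hce i hi T u v h 0 h0 _ fun l hl => ?_
    have hl := Finset.mem_Icc.1 hl
    have hd : n - i + i - l < n := by omega
    have hdr : n - i + i - l ∈ Finset.range n := Finset.mem_range.2 hd
    have h1 := hiter (n - i + i - l) hd T (by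
      have := Finset.single_le_sum (f := Td)
        (fun d hd => (hTd d (Finset.mem_range.1 hd)).le) hdr
      linarith) u v h M hmax 0 h0
    rw [show n - (n - i + i - l) = l by omega] at h1
    rw [← ofReal_norm, ← ENNReal.ofReal_pow (norm_nonneg _)]
    apply ENNReal.ofReal_le_ofReal
    refine pow_le_pow_left₀ (norm_nonneg _) (h1.trans ?_) 2
    exact mul_le_mul_of_nonneg_right (Finset.single_le_sum (f := Kd) hKd0 hdr) (norm_nonneg _)
  have e2 : (Km * M) ^ 2 = Km ^ 2 / (c * T) * (c * T * M ^ 2) := by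
    rw [mul_pow, ← mul_assoc, div_mul_cancel₀ _ (mul_pos hc0 hT0).ne']
  calc ∑ i ∈ Finset.Icc 1 n, energy A (1 + (i : ℤ) - (n : ℤ)) (u i 0) (v i 0)
      ≤ ∑ i ∈ Finset.Icc 1 n, (ce i : ℝ≥0∞) * ENNReal.ofReal ((Km * M) ^ 2) :=
        Finset.sum_le_sum hE
    _ = (∑ i ∈ Finset.Icc 1 n, (ce i : ℝ≥0∞)) * ENNReal.ofReal (Km ^ 2 / (c * T)) *
          ENNReal.ofReal (c * T * M ^ 2) := by
        rw [← Finset.sum_mul, e2, ENNReal.ofReal_mul hb0, ← mul_assoc]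
    _ ≤ q * ∫⁻ t in Icc 0 T, ‖y t‖ₑ ^ 2 := by
        refine mul_le_mul' ?_ hlow
        rw [hq, ENNReal.ofReal]
        push_cast
        exact le_self_add

end SpectralData

/-! ### Construction of cascades with almost prescribed primitives. -/

namespace SpectralData

variable {𝕜 : Type*} [RCLike 𝕜]
variable {H : Type*} [NormedAddCommGroup H] [InnerProductSpace 𝕜 H] [CompleteSpace H]
variable [NormedSpace ℝ H]
variable {A : H →ₗ.[𝕜] H} {ι : Type*} {D : SpectralData A ι}
variable {n : ℕ} {C : ℕ → H →L[𝕜] H} {T : ℝ} {u v u' v' : ℕ → ℝ → H}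

section Support

variable (D) in
include D in
theorem isSolution_zero (T : ℝ) : IsSolution A T (fun _ => 0) 0 0 := by
  refine (isSolution_of_isMild (D := D) integrableOn_zero (D.isMild_free T 0)).congr
    (fun _ _ => rfl) (fun t _ => ?_) fun t _ => ?_
  · simp only [map_zero, WithLp.zero_fst, Pi.zero_apply]
  · simp only [map_zero, WithLp.zero_snd, Pi.zero_apply]

theorem source_congr {j : ℕ} (h : ∀ l < j, u l = u' l) {l : ℕ} (hl0 : 1 ≤ l) (hl : l ≤ j) :
    source C u l = source C u' l := by
  ext t
  rw [source, source, h (l - 1) (by omega)]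

theorem source_eq_zero {j : ℕ} (h : ∀ l < j, u l = 0) (hj : 1 ≤ j) :
    source C u j = fun _ => 0 := by
  ext t
  rw [source, h (j - 1) (by omega)]
  simp

theorem primitive_congr {j : ℕ} (h : ∀ l ≤ j, v l = v' l) {l : ℕ} (hl : l ≤ j) :
    D.primitive C v l = D.primitive C v' l := by
  induction l with
  | zero => rfl
  | succ l ih => rw [primitive, primitive, h _ hl, ih (by omega)]

theorem iter_congr {j : ℕ} (hu : ∀ l ≤ j, u l = u' l) (hv : ∀ l ≤ j, v l = v' l) (p : ℕ) {l : ℕ}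
    (hl : l ≤ j) : (D.iter C u v p).1 l = (D.iter C u' v' p).1 l ∧
      (D.iter C u v p).2 l = (D.iter C u' v' p).2 l := by
  induction p generalizing l with
  | zero => exact ⟨hu l hl, hv l hl⟩
  | succ p ih => exact ⟨primitive_congr (fun l hl => (ih hl).2) hl, (ih hl).1⟩

theorem primitive_eq_zero {j : ℕ} (h : ∀ l < j, v l = 0) {l : ℕ} (hl : l < j) :
    D.primitive C v l = 0 := by
  induction l with
  | zero => rfl
  | succ l ih =>
    rw [primitive, h _ hl, ih (by omega)]
    ext t
    simp

theorem iter_eq_zero {j : ℕ} (hu : ∀ l < j, u l = 0) (hv : ∀ l < j, v l = 0) (p : ℕ) {l : ℕ}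
    (hl : l < j) : (D.iter C u v p).1 l = 0 ∧ (D.iter C u v p).2 l = 0 := by
  induction p generalizing l with
  | zero => exact ⟨hu l hl, hv l hl⟩
  | succ p ih => exact ⟨primitive_eq_zero (fun l hl => (ih hl).2) hl, (ih hl).1⟩

theorem isCascadeSolution_single {j : ℕ} (D : SpectralData A ι) {w s : ℝ → H}
    (h : IsSolution A T (fun _ => 0) w s) :
    IsCascadeSolution A j C T (Pi.single j w) (Pi.single j s) := by
  intro l hl
  have hl := Finset.mem_Icc.1 hl
  have h0 : ∀ k < j, (Pi.single j w : ℕ → ℝ → H) k = 0 := fun k hk => Pi.single_eq_of_ne hk.ne _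
  rw [source_eq_zero (fun k hk => h0 k (by omega)) hl.1]
  rcases hl.2.eq_or_lt with rfl | hlt
  · rw [Pi.single_eq_same, Pi.single_eq_same]
    exact h
  · rw [Pi.single_eq_of_ne hlt.ne, Pi.single_eq_of_ne hlt.ne]
    exact D.isSolution_zero T

end Support

section ShiftState

variable (D) in
/-- The effect of the integration in time of a free solution `w` on `(A^{1/2} w, w')`. -/
def primState (x : WithLp 2 (H × H)) : WithLp 2 (H × H) :=
  WithLp.toLp 2 (-D.lam x.snd, D.lam x.fst)

theorem continuous_primState : Continuous D.primState :=
  (WithLp.prod_continuous_toLp 2 H H).comp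
    ((D.lam.continuous.comp continuous_snd).neg.prodMk (D.lam.continuous.comp continuous_fst))

theorem denseRange_lam : DenseRange D.lam := by
  classical
  intro y
  refine mem_closure_of_tendsto (tendsto_proj (D := D) y) (Eventually.of_forall fun m => ?_)
  -- Truncated vectors lie in the range of A^{-1/2}, because A^{1/2} is bounded on them.
  have hb : ∀ i, |(if D.μ i ≤ m then D.om i else 0 : ℝ)| ≤ √m := fun i => by
    split_ifs with h
    · rw [abs_of_pos (D.om_pos i)]
      exact Real.sqrt_le_sqrt h
    · simp
  refine ⟨diag D.b (fun i => if D.μ i ≤ m then D.om i else 0) y, repr_ext D.b fun i => ?_⟩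
  rw [repr_lam, repr_diag D.b hb, repr_proj, ← mul_assoc, ← RCLike.ofReal_mul]
  congr 2
  split_ifs
  · exact inv_mul_cancel₀ (D.om_pos i).ne'
  · exact mul_zero _

theorem denseRange_primState : DenseRange D.primState := by
  have h1 : Function.Surjective fun x : WithLp 2 (H × H) => (x.snd, x.fst) :=
    fun p => ⟨WithLp.toLp 2 (p.2, p.1), rfl⟩
  have h2 : Function.Surjective fun p : H × H => (WithLp.toLp 2 (-p.1, p.2) : WithLp 2 (H × H)) :=
    fun x => ⟨(-x.fst, x.snd), WithLp.ofLp_injective 2 (Prod.ext (neg_neg _) rfl)⟩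
  have h3 : Continuous fun p : H × H => (WithLp.toLp 2 (-p.1, p.2) : WithLp 2 (H × H)) :=
    (WithLp.prod_continuous_toLp 2 H H).comp
      (_root_.continuous_fst.neg.prodMk _root_.continuous_snd)
  have h4 : DenseRange (Prod.map D.lam D.lam) := denseRange_lam.prodMap denseRange_lam
  exact (h2.denseRange.comp h4 h3).comp h1.denseRange
    (h3.comp (D.lam.continuous.prodMap D.lam.continuous))

variable (D) in
/-- The effect of `p` integrations in time on the initial state of a solution, where `c` lists the
initial values of the sources. -/
def primStateIter (c : ℕ → H) : ℕ → WithLp 2 (H × H) → WithLp 2 (H × H)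
  | 0, x => x
  | p + 1, x => D.primState (primStateIter c p x - inj (c p))

theorem denseRange_primStateIter (c : ℕ → H) (p : ℕ) : DenseRange (D.primStateIter c p) := by
  induction p with
  | zero => exact denseRange_id
  | succ p ih =>
    have h1 : Continuous fun x => D.primState (x - inj (c p)) :=
      continuous_primState.comp (continuous_id.sub continuous_const)
    have h2 : Function.Surjective fun x : WithLp 2 (H × H) => x - inj (c p) :=
      fun x => ⟨x + inj (c p), add_sub_cancel_right _ _⟩
    exact (denseRange_primState.comp h2.denseRange continuous_primState).comp ih h1

theorem st_primitive {w x s : H} (hw : MemPow A 1 w) :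
    D.st (-D.inv (x - s)) w = D.primState (D.st w x - inj s) := by
  have h1 : -D.inv (x - s) = D.lam (-D.lam (x - s)) := by rw [map_neg, lam_lam]
  rw [st, h1, root_lam]
  have h2 : (D.st w x - inj s).fst = D.root w := sub_zero _
  have h3 : (D.st w x - inj s).snd = x - s := rfl
  rw [primState, h2, h3, lam_root hw]

/-- Integrating in time acts on the state at a fixed time by an affine map. Its translations come
from the sources, hence from lower components only, so the state of a top component can be chosen
after them. -/
theorem st_iter {j : ℕ} (h : IsCascadeSolution A j C T u v) (hj : 1 ≤ j) {t : ℝ} (ht : t ∈ Icc 0 T)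
    (p : ℕ) : D.st ((D.iter C u v p).1 j t) ((D.iter C u v p).2 j t) =
      D.primStateIter (fun k => source C (D.iter C u v (k + 1)).1 j t) p
        (D.st (u j t) (v j t)) := by
  induction p with
  | zero => rfl
  | succ p ih =>
    rw [primStateIter, ← ih, ← st_primitive
      ((h.iter D p j (Finset.mem_Icc.2 ⟨hj, le_rfl⟩)).mem t ht)]
    congr 1
    exact congrFun (primitive_eq (D := D) (C := C) (D.iter C u v p).2 hj) t

end ShiftState

section Extension

/-- A cascade can be extended by one component with prescribed initial state up to an arbitrarily
small error, for the `p`-th primitive. -/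
theorem exists_extend {j : ℕ} (h : IsCascadeSolution A j C T u v) (hj : 1 ≤ j) (hT : 0 ≤ T) (p : ℕ)
    {η : ℝ} (hη : 0 < η) : ∃ w s : ℝ → H,
      IsCascadeSolution A (j + 1) C T (Function.update u (j + 1) w) (Function.update v (j + 1) s) ∧
      ‖D.st ((D.iter C (Function.update u (j + 1) w) (Function.update v (j + 1) s) p).1 (j + 1) 0)
        ((D.iter C (Function.update u (j + 1) w) (Function.update v (j + 1) s) p).2 (j + 1) 0)‖ ≤
        η := by
  have h0 : (0 : ℝ) ∈ Icc 0 T := ⟨le_rfl, hT⟩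
  set c : ℕ → H := fun k => -C (j + 1) ((D.iter C u v (k + 1)).1 j 0) with hc
  -- The vectors c depend only on components up to j, so they are known before x is chosen. The
  -- affine map has dense range but need not reach 0, hence the error η.
  obtain ⟨x, hx⟩ := (denseRange_primStateIter (D := D) c p).exists_dist_lt 0 hη
  rw [dist_zero_left] at hx
  have hf : IntegrableOn (fun t => -C (j + 1) (u j t)) (Icc 0 T) := by
    refine ContinuousOn.integrableOn_Icc
      ((C (j + 1)).continuous.comp_continuousOn fun t ht => ?_).neg
    exact ((h j (Finset.mem_Icc.2 ⟨hj, le_rfl⟩)).deriv t ht).continuousWithinAt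
  have hX := D.isMild_duhamel T (fun t => -C (j + 1) (u j t)) x
  have hX0 : (fun t => D.rot (-t) (x + ∫ s in (0 : ℝ)..t, D.rot s (inj (-C (j + 1) (u j s))))) 0
      = x := by
    simp only [intervalIntegral.integral_same, add_zero, neg_zero, rot_zero]
  set X := fun t => D.rot (-t) (x + ∫ s in (0 : ℝ)..t, D.rot s (inj (-C (j + 1) (u j s))))
  have hS := isSolution_of_isMild hf hX
  refine ⟨fun t => D.lam (X t).fst, fun t => (X t).snd, ?_⟩
  set u' := Function.update u (j + 1) fun t => D.lam (X t).fst with hu'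
  set v' := Function.update v (j + 1) fun t => (X t).snd with hv'
  have hu : ∀ l ≤ j, u' l = u l := fun l hl => Function.update_of_ne (by omega) _ _
  have hv : ∀ l ≤ j, v' l = v l := fun l hl => Function.update_of_ne (by omega) _ _
  have hs : IsCascadeSolution A (j + 1) C T u' v' := by
    intro l hl
    have hl := Finset.mem_Icc.1 hl
    rcases hl.2.eq_or_lt with rfl | hlt
    · rw [source_succ _ hj, hu j le_rfl, hu', hv', Function.update_self, Function.update_self]
      exact hS
    · rw [source_congr (j := j) (fun l hl => hu l hl.le) hl.1 (by omega), hu l (by omega),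
        hv l (by omega)]
      exact h l (Finset.mem_Icc.2 ⟨hl.1, by omega⟩)
  refine ⟨hs, ?_⟩
  rw [st_iter hs (by omega) h0]
  have e1 : D.st (u' (j + 1) 0) (v' (j + 1) 0) = x := by
    rw [hu', hv', Function.update_self, Function.update_self, st_lam, hX0]
  have e2 : (fun k => source C (D.iter C u' v' (k + 1)).1 (j + 1) 0) = c := by
    ext k
    rw [source_succ _ hj, (iter_congr hu hv (k + 1) le_rfl).1]
  rw [e1, e2]
  exact hx.le

/-- Components are added one at a time. A new component does not affect the primitives of those
below it, so the smallness already obtained is kept. -/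
theorem exists_extend_to {j : ℕ} (h : IsCascadeSolution A j C T u v) (hj : 1 ≤ j) (hT : 0 ≤ T)
    (N : ℕ) {η : ℝ} (hη : 0 < η) (k : ℕ) (hk : j ≤ k) : ∃ u' v' : ℕ → ℝ → H,
      IsCascadeSolution A k C T u' v' ∧ (∀ l ≤ j, u' l = u l) ∧ (∀ l ≤ j, v' l = v l) ∧
      ∀ l, j < l → l ≤ k → ‖D.st ((D.iter C u' v' (N - l)).1 l 0)
        ((D.iter C u' v' (N - l)).2 l 0)‖ ≤ η := by
  induction k, hk using Nat.le_induction with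
  | base => exact ⟨u, v, h, fun _ _ => rfl, fun _ _ => rfl, fun l h1 h2 => by omega⟩
  | succ k hk ih =>
    obtain ⟨u₁, v₁, h₁, hu, hv, hb⟩ := ih
    obtain ⟨w, s, h₂, hb₂⟩ := exists_extend (D := D) h₁ (by omega) hT (N - (k + 1)) hη
    have hu₂ : ∀ l ≤ k, Function.update u₁ (k + 1) w l = u₁ l :=
      fun l hl => Function.update_of_ne (by omega) _ _
    have hv₂ : ∀ l ≤ k, Function.update v₁ (k + 1) s l = v₁ l :=
      fun l hl => Function.update_of_ne (by omega) _ _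
    refine ⟨_, _, h₂, fun l hl => (hu₂ l (by omega)).trans (hu l hl),
      fun l hl => (hv₂ l (by omega)).trans (hv l hl), fun l h1 h2 => ?_⟩
    rcases h2.eq_or_lt with rfl | hlt
    · exact hb₂
    · have := iter_congr (D := D) (C := C) hu₂ hv₂ (N - l) (show l ≤ k by omega)
      rw [this.1, this.2]
      exact hb l h1 (by omega)

end Extension

theorem energy_succ_primitive (k : ℤ) (w x : H) :
    energy A (k + 1) (-D.inv x) w = energy A k w x := by
  rw [energy, energy, D.powNormSq_neg, show k + 1 = k - 1 + 2 by ring, powNormSq_inv,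
    show k - 1 + 2 - 1 = k by ring, add_comm]

/-- The first nonzero component has no source, and for a free solution each integration in time
raises the order of the energy by exactly one. -/
theorem energy_iter {j : ℕ} (hj : 1 ≤ j) (hu : ∀ l < j, u l = 0) (hv : ∀ l < j, v l = 0) (k : ℤ)
    (t : ℝ) (p : ℕ) : energy A (k + p) ((D.iter C u v p).1 j t) ((D.iter C u v p).2 j t) =
      energy A k (u j t) (v j t) := by
  induction p with
  | zero => rw [Nat.cast_zero, add_zero]; rfl
  | succ p ih =>
    have h1 : (D.iter C u v (p + 1)).1 j t = -D.inv ((D.iter C u v p).2 j t) := by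
      have h2 := congrFun (primitive_eq (D := D) (C := C) (D.iter C u v p).2 hj) t
      have h3 : source C (D.primitive C (D.iter C u v p).2) j = fun _ => 0 :=
        source_eq_zero (fun l hl => (iter_eq_zero (D := D) (C := C) hu hv (p + 1) hl).1) hj
      rw [h3, sub_zero] at h2
      exact h2
    rw [h1, show k + ((p + 1 : ℕ) : ℤ) = k + p + 1 by push_cast; ring, ← ih]
    exact energy_succ_primitive _ _ _

end SpectralData

/-! ### Necessity: observability of the couplings and of the last equation. -/

namespace SpectralData

variable {𝕜 : Type*} [RCLike 𝕜]
variable {H : Type*} [NormedAddCommGroup H] [InnerProductSpace 𝕜 H] [CompleteSpace H]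
variable [NormedSpace ℝ H]
variable {A : H →ₗ.[𝕜] H} {ι : Type*} {D : SpectralData A ι}
variable {n : ℕ} {C : ℕ → H →L[𝕜] H} {T : ℝ}

theorem enorm_snd_le (x : WithLp 2 (H × H)) : ‖x.snd‖ₑ ≤ ‖x‖ₑ := by
  rw [← ofReal_norm, ← ofReal_norm]
  exact ENNReal.ofReal_le_ofReal (norm_snd_le x)

theorem eLpNorm_le_const_mul {E : Type*} [NormedAddCommGroup E] {f : ℝ → E} {T : ℝ} {c : ℝ≥0∞}
    (h : ∀ t ∈ Icc 0 T, ‖f t‖ₑ ≤ c) :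
    eLpNorm f 2 (volume.restrict (Icc 0 T)) ≤ (Real.toNNReal √T : ℝ≥0∞) * c := by
  have := eLpNorm_le_of_ae_enorm_bound (p := 2) (f := f) (μ := volume.restrict (Icc 0 T)) (C := c)
    ((ae_restrict_iff' measurableSet_Icc).2 (Eventually.of_forall h))
  refine this.trans (le_of_eq ?_)
  rw [smul_eq_mul, mul_comm]
  congr 1
  rw [Measure.restrict_apply_univ, Real.volume_Icc, sub_zero, ENNReal.toReal_ofNat,
    ENNReal.ofReal, ← ENNReal.coe_rpow_of_nonneg _ (by norm_num)]
  congr 1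
  rw [← NNReal.coe_inj, NNReal.coe_rpow, Real.coe_toNNReal _ (Real.sqrt_nonneg _),
    ← one_div, ← Real.sqrt_eq_rpow]
  rcases le_or_gt 0 T with hT | hT
  · rw [Real.coe_toNNReal _ hT]
  · rw [Real.toNNReal_of_nonpos hT.le, NNReal.coe_zero, Real.sqrt_zero, Real.sqrt_eq_zero_of_nonpos hT.le]

variable (D C) in
/-- The sources of the primitives of a cascade are controlled along the cascade. -/
theorem exists_eLpNorm_source_le (T : ℝ) {i : ℕ} (hi : 1 ≤ i) (l : ℕ) (hl : i ≤ l) (hln : l ≤ n) :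
    ∃ K : ℝ≥0, ∀ (u v : ℕ → ℝ → H), IsCascadeSolution A n C T u v → ∀ η : ℝ≥0,
      (∀ l, i ≤ l → l ≤ n →
        ‖D.st ((D.iter C u v (n - l)).1 l 0) ((D.iter C u v (n - l)).2 l 0)‖ₑ ≤ η) →
      eLpNorm (source C (D.iter C u v (n - l)).1 l) 2 (volume.restrict (Icc 0 T)) ≤
        K * (η + eLpNorm (source C (D.iter C u v (n - i)).1 i) 2 (volume.restrict (Icc 0 T))) := by
  induction l, hl using Nat.le_induction with
  | base =>
    refine ⟨1, fun u v _ η _ => ?_⟩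
    rw [ENNReal.coe_one, one_mul]
    exact le_add_self
  | succ l hl ih =>
    obtain ⟨K, hK⟩ := ih (by omega)
    refine ⟨Real.toNNReal √T * (‖C (l + 1)‖₊ * (1 + Real.toNNReal √T * K)), fun u v h η hη => ?_⟩
    have h1 := hK u v h η hη
    have h2 := h.iter D (n - l)
    set F := eLpNorm (source C (D.iter C u v (n - i)).1 i) 2 (volume.restrict (Icc 0 T))
    have hc : IsL2 T (source C (D.iter C u v (n - l)).1 l) :=
      isL2_of_continuousOn (h2.continuousOn_source (Finset.mem_Icc.2 ⟨by omega, by omega⟩))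
    have h3 : ∀ t ∈ Icc 0 T, ‖source C (D.iter C u v (n - (l + 1))).1 (l + 1) t‖ₑ ≤
        ‖C (l + 1)‖₊ * (1 + Real.toNNReal √T * K) * (η + F) := by
      intro t ht
      -- The source sent to component l + 1 is made of the velocity of the (n-l)-th primitive of
      -- component l. That velocity is bounded by its initial state, at most η, and its own source.
      have e1 : (D.iter C u v (n - (l + 1))).1 l = (D.iter C u v (n - l)).2 l := by
        rw [show n - l = n - (l + 1) + 1 by omega]
        rfl
      rw [source_succ _ (by omega), enorm_neg, e1, mul_assoc]
      refine ((C (l + 1)).le_opENorm _).trans ?_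
      refine mul_le_mul_right ?_ _
      refine (enorm_snd_le (D.st ((D.iter C u v (n - l)).1 l t) _)).trans ?_
      refine ((h2.isMild D (by omega) (by omega)).enorm_le hc ht).trans ?_
      calc _ ≤ (η : ℝ≥0∞) + ENNReal.ofReal √T * (K * (η + F)) :=
            add_le_add (hη l hl (by omega)) (mul_le_mul_right h1 _)
        _ ≤ (η + F) + ENNReal.ofReal √T * (K * (η + F)) := by
            gcongr
            exact le_self_add
        _ = (1 + Real.toNNReal √T * K) * (η + F) := by
            rw [ENNReal.ofReal]
            ring
    refine (eLpNorm_le_const_mul h3).trans (le_of_eq ?_)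
    push_cast
    ring

variable {G : Type*} [NormedAddCommGroup G] [InnerProductSpace 𝕜 G] [CompleteSpace G]
variable {B : (A.domain × H) →ₗ[𝕜] G}

/-- A cascade with only the last component nonzero is a free solution of the single equation, and
the energy of index n is e_1. -/
theorem observableAt_of_cascade (D : SpectralData A ι) (hn : 1 ≤ n)
    (h : CascadeObservableAt A n C B T) : ObservableAt A B T := by
  obtain ⟨c, hc, h⟩ := h
  refine ⟨c, hc, fun w v hw => ?_⟩
  obtain ⟨y, hy, hle⟩ := h _ _ (isCascadeSolution_single (j := n) D hw)
  rw [source_eq_zero (fun k hk => Pi.single_eq_of_ne hk.ne _) hn, Pi.single_eq_same,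
    Pi.single_eq_same] at hy
  refine ⟨y, hy, le_trans ?_ hle⟩
  refine mul_le_mul_right ?_ _
  refine le_trans (le_of_eq ?_) (Finset.single_le_sum (fun _ _ => zero_le)
    (Finset.mem_Icc.2 ⟨hn, le_rfl⟩))
  rw [Pi.single_eq_same, Pi.single_eq_same, add_sub_cancel_right]

theorem eLpNorm_velocity_le (P : H →L[𝕜] H) (x : WithLp 2 (H × H)) :
    eLpNorm (fun t => P (D.rot (-t) x).snd) 2 (volume.restrict (Icc 0 T)) ≤
      (Real.toNNReal √T * ‖P‖₊ : ℝ≥0) * ‖x‖ₑ := by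
  refine (eLpNorm_le_const_mul (c := ‖P‖ₑ * ‖x‖ₑ) fun t _ => ?_).trans (le_of_eq ?_)
  · refine (P.le_opENorm _).trans (mul_le_mul_right ?_ _)
    refine (enorm_snd_le _).trans (le_of_eq ?_)
    rw [← ofReal_norm, LinearIsometry.norm_map, ofReal_norm]
  · rw [ENNReal.coe_mul, mul_assoc]
    rfl

/-- With i = j + 1, the cascade is started at component j by a free solution, and its later
components are chosen by `exists_extend_to`. For the state z of the (n-j)-th primitive of component
j, the observation is then at most a constant times a small η plus the L² norm `V z` of C_{j+1}
applied to the velocity of the free solution from z. Observability of the cascade turns this into a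
bound of ‖z‖, first for a dense set of z. -/
theorem velocityObservableAt_of_cascade (D : SpectralData A ι) (hB : Admissible A B) (hT : 0 < T)
    (h : CascadeObservableAt A n C B T) {i : ℕ} (hi : 2 ≤ i) (hin : i ≤ n) :
    VelocityObservableAt A (C i) T := by
  obtain ⟨c, hc, h⟩ := h
  obtain ⟨j, rfl⟩ := Nat.exists_eq_add_of_le' (show 1 ≤ i by omega)
  have hj : 1 ≤ j := by omega
  have h0 : (0 : ℝ) ∈ Icc 0 T := ⟨le_rfl, hT.le⟩
  obtain ⟨KB, hKB⟩ := D.exists_obsBound hB hT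
  obtain ⟨K, hK⟩ := D.exists_eLpNorm_source_le C (n := n) T (i := j + 1) (by omega) n hin le_rfl
  set V : WithLp 2 (H × H) → ℝ≥0∞ := fun z =>
    eLpNorm (fun t => C (j + 1) (D.rot (-t) z).snd) 2 (volume.restrict (Icc 0 T)) with hV
  have hVsub : ∀ z z', V z ≤ V z' + (Real.toNNReal √T * ‖C (j + 1)‖₊ : ℝ≥0) * ‖z - z'‖ₑ := by
    intro z z'
    have hm : ∀ x : WithLp 2 (H × H), AEStronglyMeasurable
        (fun t => C (j + 1) (D.rot (-t) x).snd) (volume.restrict (Icc 0 T)) := fun x =>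
      ((C (j + 1)).continuous.comp (continuous_snd.comp
        ((continuous_rot_apply (D := D) x).comp continuous_neg))).aestronglyMeasurable
    have h1 : (fun t => C (j + 1) (D.rot (-t) z).snd) =
        (fun t => C (j + 1) (D.rot (-t) z').snd) +
          fun t => C (j + 1) (D.rot (-t) (z - z')).snd := by
      ext t
      rw [Pi.add_apply, map_sub (D.rot (-t)), WithLp.sub_snd, map_sub, add_sub_cancel]
    simp only [hV]
    rw [h1]
    exact (eLpNorm_add_le (hm _) (hm _) (by norm_num)).trans
      (add_le_add_right (eLpNorm_velocity_le _ _) _)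
  have hdense : ∀ x (η : ℝ≥0), 0 < η →
      c * ENNReal.ofReal (‖D.primStateIter (fun _ => 0) (n - j) x‖ ^ 2 / 2) ≤
        (KB * (η + K * (η + V (D.primStateIter (fun _ => 0) (n - j) x)))) ^ 2 := by
    intro x η hη
    have hfree := isSolution_of_isMild (D := D) integrableOn_zero (D.isMild_free T x)
    obtain ⟨u, v, hcas, hu, hv, hsmall⟩ := exists_extend_to (D := D)
      (isCascadeSolution_single (C := C) (j := j) D hfree) hj hT.le n
      (show (0 : ℝ) < η from hη) n (by omega)
    have hu0 : ∀ l < j, u l = 0 := fun l hl => by rw [hu l hl.le, Pi.single_eq_of_ne hl.ne]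
    have hv0 : ∀ l < j, v l = 0 := fun l hl => by rw [hv l hl.le, Pi.single_eq_of_ne hl.ne]
    have hux : D.st (u j 0) (v j 0) = x := by
      rw [hu j le_rfl, hv j le_rfl, Pi.single_eq_same, Pi.single_eq_same, st_lam, neg_zero, rot_zero]
    have hjm : j ∈ Finset.Icc 1 n := Finset.mem_Icc.2 ⟨hj, by omega⟩
    have hsm : ∀ l, j + 1 ≤ l → l ≤ n →
        ‖D.st ((D.iter C u v (n - l)).1 l 0) ((D.iter C u v (n - l)).2 l 0)‖ₑ ≤ η := by
      intro l h1 h2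
      rw [← ofReal_norm, ← ENNReal.ofReal_coe_nnreal]
      exact ENNReal.ofReal_le_ofReal (hsmall l h1 h2)
    obtain ⟨y, hy, hle⟩ := h u v hcas
    have hsrc0 : ∀ p, source C (D.iter C u v p).1 j = fun _ => 0 := fun p =>
      source_eq_zero (fun l hl => (iter_eq_zero (D := D) (C := C) hu0 hv0 p hl).1) hj
    have hj' : IsCascadeSolution A j C T u v := fun l hl => hcas l
      (Finset.mem_Icc.2 ⟨(Finset.mem_Icc.1 hl).1, by have := (Finset.mem_Icc.1 hl).2; omega⟩)
    have hz : D.st ((D.iter C u v (n - j)).1 j 0) ((D.iter C u v (n - j)).2 j 0) =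
        D.primStateIter (fun _ => 0) (n - j) x := by
      rw [st_iter hj' hj h0, hux]
      simp only [hsrc0]
    set z := D.primStateIter (fun _ => 0) (n - j) x with hzdef
    have hw := hcas.iter D (n - j) j hjm
    rw [hsrc0] at hw
    have hvel : ∀ t ∈ Icc 0 T, (D.iter C u v (n - j)).2 j t = (D.rot (-t) z).snd := by
      intro t ht
      have h1 := (isMild_of_isSolution (D := D) integrableOn_zero hw).eq ht
      simp only [inj_zero, map_zero, intervalIntegral.integral_zero, add_zero, hz] at h1
      exact congrArg WithLp.snd h1
    have hF : eLpNorm (source C (D.iter C u v (n - (j + 1))).1 (j + 1)) 2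
        (volume.restrict (Icc 0 T)) = V z := by
      refine eLpNorm_congr_norm_ae ((ae_restrict_iff' measurableSet_Icc).2
        (Eventually.of_forall fun t ht => ?_))
      have e1 : (D.iter C u v (n - (j + 1))).1 j = (D.iter C u v (n - j)).2 j := by
        rw [show n - j = n - (j + 1) + 1 by omega]
        rfl
      rw [source_succ _ hj, norm_neg, e1, hvel t ht]
    have hKF := hK u v hcas η hsm
    rw [hF, Nat.sub_self] at hKF
    have hn : n ∈ Finset.Icc 1 n := Finset.mem_Icc.2 ⟨by omega, le_rfl⟩
    have hyb := hy.eLpNorm_le hKB hB (isL2_of_continuousOn (hcas.continuousOn_source hn))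
      ((hcas n hn).mem 0 h0) hT.le
    have hn0 := hsm n hin le_rfl
    rw [Nat.sub_self] at hn0
    -- The weakened energy of component j is the energy of order one of its (n-j)-th primitive; this
    -- is where the indices of the weakened energies fit.
    have hen : energy A (1 + (j : ℤ) - (n : ℤ)) (u j 0) (v j 0) = ENNReal.ofReal (‖z‖ ^ 2 / 2) := by
      rw [← energy_iter (D := D) (C := C) hj hu0 hv0 _ 0 (n - j),
        show 1 + (j : ℤ) - (n : ℤ) + ((n - j : ℕ) : ℤ) = 1 by omega, energy_one (D := D) (hw.mem 0 h0), hz]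
    calc c * ENNReal.ofReal (‖z‖ ^ 2 / 2)
        ≤ c * ∑ l ∈ Finset.Icc 1 n, energy A (1 + (l : ℤ) - (n : ℤ)) (u l 0) (v l 0) := by
          rw [← hen]
          exact mul_le_mul_right (Finset.single_le_sum (f := fun l : ℕ =>
            energy A (1 + (l : ℤ) - (n : ℤ)) (u l 0) (v l 0)) (fun _ _ => zero_le) hjm) _
      _ ≤ _ := hle
      _ = eLpNorm y 2 (volume.restrict (Icc 0 T)) ^ 2 := lintegral_enorm_sq _ _
      _ ≤ _ := by
          gcongr
          refine hyb.trans (mul_le_mul_right ?_ _)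
          exact add_le_add hn0 hKF
  -- The factor 2/c + 1 replaces the square root of 2/c, which it dominates.
  set K₂ : ℝ≥0 := (2 / c + 1) * (KB * (1 + K)) with hK₂
  have hrange : ∀ x (η : ℝ≥0), 0 < η → ‖D.primStateIter (fun _ => 0) (n - j) x‖ₑ ≤
      K₂ * (η + V (D.primStateIter (fun _ => 0) (n - j) x)) := by
    intro x η hη
    have h1 := hdense x η hη
    set z := D.primStateIter (fun _ => 0) (n - j) x
    have h2 : (KB : ℝ≥0∞) * (η + K * (η + V z)) ≤ KB * (1 + K) * (η + V z) := by
      rw [mul_assoc, add_mul, one_mul]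
      gcongr
      exact le_self_add
    have h3 : ‖z‖ₑ ^ 2 = (2 / c : ℝ≥0) * (c * ENNReal.ofReal (‖z‖ ^ 2 / 2)) := by
      rw [← mul_assoc, ← ENNReal.coe_mul, div_mul_cancel₀ _ hc.ne', ← ofReal_norm,
        ← ENNReal.ofReal_pow (norm_nonneg _), ENNReal.ofReal_div_of_pos (by norm_num)]
      rw [ENNReal.ofReal_ofNat, ENNReal.coe_ofNat, ENNReal.mul_div_cancel (by norm_num) (by norm_num)]
    rw [← ENNReal.pow_le_pow_left_iff two_ne_zero, h3]
    calc _ ≤ ((2 / c + 1 : ℝ≥0) : ℝ≥0∞) ^ 2 * (KB * (1 + K) * (η + V z)) ^ 2 := by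
          refine mul_le_mul' ?_ (h1.trans ?_)
          · rw [← ENNReal.coe_pow, ENNReal.coe_le_coe]
            have : 0 ≤ 2 / c := zero_le
            nlinarith
          · gcongr
      _ = _ := by
          rw [hK₂]
          push_cast
          ring
  set M : ℝ≥0 := Real.toNNReal √T * ‖C (j + 1)‖₊ with hM
  -- `V` is Lipschitz with constant `M`, so the bound extends from the dense range to all z. With η
  -- and the distance both equal to ε/q, the total error is (K₂(1 + M) + 1) ε/q = ε.
  have hall : ∀ z, ‖z‖ₑ ≤ K₂ * V z := by
    intro z
    refine ENNReal.le_of_forall_pos_le_add fun ε hε _ => ?_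
    set q : ℝ≥0 := K₂ * (1 + M) + 1 with hq
    have hq0 : q ≠ 0 := by positivity
    have hη : 0 < ε / q := div_pos hε (pos_iff_ne_zero.2 hq0)
    obtain ⟨x, hx⟩ := (denseRange_primStateIter (D := D) (fun _ => 0) (n - j)).exists_dist_lt z
      (show (0 : ℝ) < (ε / q : ℝ≥0) from hη)
    have h1 := hrange x _ hη
    set z' := D.primStateIter (fun _ => 0) (n - j) x
    have h2 : ‖z - z'‖ₑ ≤ (ε / q : ℝ≥0) := by
      rw [dist_eq_norm] at hx
      rw [← ofReal_norm, ← ENNReal.ofReal_coe_nnreal]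
      exact ENNReal.ofReal_le_ofReal hx.le
    have h3 : ‖z' - z‖ₑ ≤ (ε / q : ℝ≥0) := by rwa [← enorm_neg, neg_sub]
    have h4 : ‖z‖ₑ ≤ ‖z'‖ₑ + ‖z - z'‖ₑ := by
      have := enorm_add_le z' (z - z')
      rwa [add_sub_cancel] at this
    calc ‖z‖ₑ ≤ K₂ * ((ε / q : ℝ≥0) + (V z + M * (ε / q : ℝ≥0))) + (ε / q : ℝ≥0) := by
          refine h4.trans (add_le_add (h1.trans ?_) h2)
          gcongr
          refine (hVsub z' z).trans ?_
          gcongr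
      _ = K₂ * V z + (q * (ε / q) : ℝ≥0) := by
          rw [ENNReal.coe_mul q, hq]
          push_cast
          ring
      _ = K₂ * V z + ε := by rw [mul_div_cancel₀ _ hq0]
  refine ⟨((K₂ + 1) ^ 2)⁻¹, by positivity, fun w v hw => ?_⟩
  have hk : (K₂ + 1) ^ 2 ≠ 0 := by positivity
  rw [ENNReal.coe_inv hk, ENNReal.inv_mul_le_iff (by exact_mod_cast hk) ENNReal.coe_ne_top]
  have hvel : ∀ t ∈ Icc 0 T, v t = (D.rot (-t) (D.st (w 0) (v 0))).snd := by
    intro t ht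
    have h1 := (isMild_of_isSolution (D := D) integrableOn_zero hw).eq ht
    simp only [inj_zero, map_zero, intervalIntegral.integral_zero, add_zero] at h1
    exact congrArg WithLp.snd h1
  have hV2 : ∫⁻ t in Icc 0 T, ‖C (j + 1) (v t)‖ₑ ^ 2 = V (D.st (w 0) (v 0)) ^ 2 := by
    rw [hV, ← lintegral_enorm_sq]
    exact setLIntegral_congr_fun measurableSet_Icc fun t ht => by rw [hvel t ht]
  rw [hV2]
  refine (energy_one_le (D := D) (hw.mem 0 h0)).trans ?_
  push_cast
  rw [← mul_pow]
  gcongr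
  refine (hall _).trans ?_
  gcongr
  exact le_self_add

end SpectralData

/-! ### Minimal times and monotonicity in T. -/

theorem exists_isMinimalTime {P : ℝ → Prop} (hmono : ∀ T T' : ℝ, 0 < T → T < T' → P T → P T')
    {T₀ : ℝ} (hT₀ : 0 < T₀) (h : ∀ T, T₀ < T → P T) : ∃ Tm, IsMinimalTime P Tm ∧ Tm ≤ T₀ := by
  set S := {T : ℝ | 0 < T ∧ P T} with hS
  have hbdd : BddBelow S := ⟨0, fun T hT => hT.1.le⟩
  have hne : S.Nonempty := ⟨T₀ + 1, by linarith, h _ (by linarith)⟩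
  refine ⟨sInf S, ⟨Real.sInf_nonneg fun T hT => hT.1.le, fun T hT => ?_, fun T hT0 hT hP => ?_⟩, ?_⟩
  · obtain ⟨T', hT', hlt⟩ := exists_lt_of_csInf_lt hne hT
    exact hmono T' T hT'.1 hlt hT'.2
  · exact notMem_of_lt_csInf hT hbdd ⟨hT0, hP⟩
  · by_contra! hlt
    obtain ⟨T, h1, h2⟩ := exists_between hlt
    exact notMem_of_lt_csInf h2 hbdd ⟨hT₀.trans h1, h T h1⟩

namespace SpectralData

variable {𝕜 : Type*} [RCLike 𝕜]
variable {H : Type*} [NormedAddCommGroup H] [InnerProductSpace 𝕜 H] [CompleteSpace H]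
variable [NormedSpace ℝ H]
variable {A : H →ₗ.[𝕜] H} {ι : Type*}
variable {T T' : ℝ}

theorem isSolution_mono (D : SpectralData A ι) {f w v : ℝ → H} (hf : IsL2 T' f)
    (h : IsSolution A T' f w v) (hT : T ≤ T') : IsSolution A T f w v := by
  have := D.isSolution_shift hf h (s := 0) (L := T) le_rfl (by rwa [zero_add])
  simpa only [zero_add] using this

theorem velocityObservableAt_mono (D : SpectralData A ι) {P : H →L[𝕜] H} (hT : T ≤ T')
    (h : VelocityObservableAt A P T) : VelocityObservableAt A P T' := by
  obtain ⟨γ, hγ, h⟩ := h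
  exact ⟨γ, hγ, fun w v hw => (h w v (D.isSolution_mono isL2_zero hw hT)).trans
    (lintegral_mono_set (Icc_subset_Icc_right hT))⟩

variable {G : Type*} [NormedAddCommGroup G] [InnerProductSpace 𝕜 G] [CompleteSpace G]
variable {B : (A.domain × H) →ₗ[𝕜] G}

/-- The observation on the longer interval restricts to an observation on the shorter one. By
uniqueness it agrees there, almost everywhere, with the one that carries the lower bound. -/
theorem observableAt_mono (D : SpectralData A ι) (hB : Admissible A B) (hT0 : 0 < T) (hT : T ≤ T')
    (h : ObservableAt A B T) : ObservableAt A B T' := by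
  obtain ⟨R, hR, h⟩ := h
  refine ⟨R, hR, fun w v hw => ?_⟩
  have hwT := D.isSolution_mono isL2_zero hw hT
  obtain ⟨z, hz, hle⟩ := h w v hwT
  obtain ⟨y, hy⟩ := D.exists_isObservation hB (hT0.trans_le hT) isL2_zero hw
  refine ⟨y, hy, hle.trans ?_⟩
  have hyT := hy.shift D hB hw isL2_zero (s := 0) (L := T) le_rfl (by rwa [zero_add]) hT0.le
  simp only [zero_add] at hyT
  have hae := hz.ae_eq D hB hT0 hwT isL2_zero hyT
  calc ∫⁻ t in Icc 0 T, ‖z t‖ₑ ^ 2 = ∫⁻ t in Icc 0 T, ‖y t‖ₑ ^ 2 :=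
        lintegral_congr_ae (hae.mono fun t ht => by simp only [ht])
    _ ≤ _ := lintegral_mono_set (Icc_subset_Icc_right hT)

end SpectralData

end Cascade

end

/-! ### The equivalence and the lower bound on the time. -/

theorem corollary2p8 {𝕜 : Type*} [RCLike 𝕜]
    {H : Type*} [NormedAddCommGroup H] [InnerProductSpace 𝕜 H] [CompleteSpace H]
    [NormedSpace ℝ H]
    {G : Type*} [NormedAddCommGroup G] [InnerProductSpace 𝕜 G] [CompleteSpace G]
    (n : ℕ) (hn : 2 ≤ n) (A : H →ₗ.[𝕜] H) (C : ℕ → H →L[𝕜] H)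
    (B : (A.domain × H) →ₗ[𝕜] G)
    (hA : Cascade.StandingAssumption A)
    (hC : Cascade.CouplingAssumption A n C C)
    (hB : Cascade.Admissible A B) :
    ((∃ Tstar : ℝ, 0 < Tstar ∧ ∀ T : ℝ, Tstar < T → Cascade.CascadeObservableAt A n C B T) ↔
      (Cascade.CouplingsObservable A n C ∧ Cascade.Observable A B)) ∧
    ∀ Tstar : ℝ, 0 < Tstar → (∀ T : ℝ, Tstar < T → Cascade.CascadeObservableAt A n C B T) →
      ∃ (Tc : ℕ → ℝ) (T₀ : ℝ),
        (∀ i ∈ Finset.Icc 2 n,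
          Cascade.IsMinimalTime (Cascade.VelocityObservableAt A (C i)) (Tc i)) ∧
        Cascade.IsMinimalTime (Cascade.ObservableAt A B) T₀ ∧
        max ((Finset.Icc 2 n).sup' (Finset.nonempty_Icc.2 hn) Tc) T₀ ≤ Tstar := by
  obtain ⟨ι, ⟨D⟩⟩ := hA.exists_spectralData
  -- Necessity loses no time: each observability holds at every T at which the cascade is
  -- observable, so one threshold `Tstar` serves both the equivalence and the bound on the minimal
  -- times.
  have hvel : ∀ Tstar : ℝ, 0 < Tstar →
      (∀ T : ℝ, Tstar < T → Cascade.CascadeObservableAt A n C B T) →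
      ∀ i ∈ Finset.Icc 2 n, ∀ T : ℝ, Tstar < T → Cascade.VelocityObservableAt A (C i) T :=
    fun Tstar h0 h i hi T hT => D.velocityObservableAt_of_cascade hB (h0.trans hT) (h T hT)
      (Finset.mem_Icc.1 hi).1 (Finset.mem_Icc.1 hi).2
  have hobs : ∀ Tstar : ℝ, (∀ T : ℝ, Tstar < T → Cascade.CascadeObservableAt A n C B T) →
      ∀ T : ℝ, Tstar < T → Cascade.ObservableAt A B T :=
    fun Tstar h T hT => D.observableAt_of_cascade (by omega) (h T hT)
  refine ⟨⟨fun ⟨Tstar, h0, h⟩ => ⟨fun i hi => ⟨Tstar, h0, hvel Tstar h0 h i hi⟩,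
    Tstar, h0, hobs Tstar h⟩, fun h => D.exists_cascadeObservableAt (by omega) hB hC h.1 h.2⟩,
    fun Tstar h0 h => ?_⟩
  have hmin : ∀ i ∈ Finset.Icc 2 n, ∃ Tm,
      Cascade.IsMinimalTime (Cascade.VelocityObservableAt A (C i)) Tm ∧ Tm ≤ Tstar := fun i hi =>
    Cascade.exists_isMinimalTime (fun _ _ _ hT => D.velocityObservableAt_mono hT.le) h0
      (hvel Tstar h0 h i hi)
  choose! Tc hTc using hmin
  obtain ⟨T₀, hT₀, hle⟩ := Cascade.exists_isMinimalTime
    (fun _ _ hT0 hT => D.observableAt_mono hB hT0 hT.le) h0 (hobs Tstar h)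
  exact ⟨Tc, T₀, fun i hi => (hTc i hi).1, hT₀,
    max_le (Finset.sup'_le _ _ fun i hi => (hTc i hi).2) hle⟩
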